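/- Let $\Lambda = \mathbf{k}Q/I$ be a gentle algebra over a field $\mathbf{k}$ (so $Q$ is a finite quiver and $I$ is admissible and generated by paths of length two). A homotopy letter is a nontrivial path of $Q$ not in $I$ (direct) or the formal inverse of one (inverse). A (possibly infinite) homotopy string is a reduced word in the arrows and inverse arrows, partitioned into homotopy letters such that consecutive letters of the same direction compose to an element of $I$; its infinite ends consist eventually of single arrows, directed so that degrees tend to $-\infty$. A homotopy band is a cyclic word of this kind, with as many direct as inverse homotopy letters, which is not a proper power. Words are graded, and homotopy strings are taken up to inversion. Let $P^\bullet_\tau$ be the string complex of a homotopy string $\tau$, and let $B^\bullet_{\sigma,\lambda}$ be the band complex of a homotopy band $\sigma$ and $\lambda \in \mathbf{k}^*$, where $\lambda$ is placed on a direct homotopy letter; they are complexes of projective $\Lambda$-modules with one summand $P_x=\Lambda e_x$ for each vertex of the unfolded diagram (each vertex modulo the period, for a band). Isomorphisms of complexes below are in the homotopy category, i.e. in $\mathsf{D}^b(\Lambda) \simeq \mathsf{K}^{b,-}(\mathrm{proj}\,\Lambda)$. Let $f^\bullet \colon B^\bullet_{\sigma,\lambda} \to P^\bullet_\tau$ be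 a graph map determined by a (possibly trivial) finite maximal common homotopy substring $\rho$ of ${}^\infty\sigma^\infty$ and $\tau$, where $\tau$ is oriented such that $\rho$ is read in the same direction in both words. So the components of $f^\bullet$ are identities (up to the nonzero scalars forced by commutativity) along $\rho$, and paths $f_L$, $f_R$ (possibly empty) at the vertices next to the left and the right end of $\rho$. At each end $x$ of $\rho$, in the unfolded diagrams: if $f_L$ (resp. $f_R$) is nonempty, then the adjacent letters of $\sigma$ and $\tau$ are both directed towards $x$ or both away from $x$ and the square with $f_L$ (resp. $f_R$) commutes; if it is empty, then the adjacent letter of $\sigma$ is directed away from $x$ and the adjacent letter of $\tau$ is absent, or directed towards $x$ and has nonzero composition with that of $\sigma$ (the nonvanishing is automatic for nontrivial $\rho$; for trivial $\rho$ it fixes the relative orientation of $\sigma$ and $\tau$). Let $M^\bullet_{f^\bullet}$ be the mapping cone of $f^\bullet$. 1. Suppose that $\rho$ is a proper subword of (a rotation of) $\sigma$. Then, after suitable rotation of $\sigma$, there are decompositions $\sigma = \rho\alpha$ and $\tau = \delta\tau_L\rho\tau_R\gamma$, where $\tau_L$ and $\tau_R$ are the homotopy letters adjacent to $\rho$ (possibly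 absent), and $M^\bullet_{f^\bullet} \cong P^\bullet_c$ for the homotopy string $c = \delta\tau_L\overline{\alpha}\tau_R\gamma$. Here, writing $\alpha = \alpha_m\cdots\alpha_1$, the word is reduced: $\tau_L\overline{\alpha_1}$ and $\overline{\alpha_m}\tau_R$ (or $\tau_L\overline{\alpha_1}\tau_R$ if $m = 1$) become single homotopy letters. If $\tau_L$ is absent, then the homotopy letter containing $\overline{\alpha_1}$ is omitted from $c$, and if $\tau_R$ is absent, then the homotopy letter containing $\overline{\alpha_m}$ is omitted. Moreover, if $f_L \neq \emptyset$ then $\tau_L\overline{\alpha_1} = \overline{f_L}$, and if $f_R \neq \emptyset$ then $\overline{\alpha_m}\tau_R = f_R$. 2. Suppose that there is an integer $\ell \geq 1$ such that $\rho$ is a proper subword of (a rotation of) $\sigma^{\ell+1}$ and (a rotation of) $\sigma^\ell$ is a subword of $\rho$. Then, after suitable rotation of $\sigma$, there is a decomposition $\sigma = \beta\alpha$, with $\beta$ or $\alpha$ possibly trivial, such that $\rho = \sigma^\ell\beta$ and $\tau = \delta\sigma^\ell\beta\gamma$ for some homotopy strings $\gamma$ and $\delta$, and $M^\bullet_{f^\bullet}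 \cong P^\bullet_c$ for the homotopy string $c = \delta\sigma^{\ell-1}\beta\gamma$. -/

import Mathlib

open CategoryTheory

universe u

noncomputable section

namespace Gentle

/-! ### Bound quivers and gentle algebras -/

/-- A quiver with vertices `V` and arrows `E`, together with a set of zero relations of length two:
`rel b a` says that the path "first `a`, then `b`" (written `b a`) is one of the generators of the
ideal `I`. -/
structure BoundQuiver (V E : Type u) where
  src : E → V
  tgt : E → V
  rel : E → E → Prop
  rel_comp : ∀ b a, rel b a → src b = tgt a

variable {V E : Type u}

namespace BoundQuiver

/-- `p = [a₁, …, aᵣ]` is a nontrivial path `a₁ ⋯ aᵣ` (composed from right to left, so that it starts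
at `src aᵣ` and ends at `tgt a₁`) which contains no relation, that is, which does not lie in `I`. -/
def IsPath (Q : BoundQuiver V E) (p : List E) : Prop :=
  p ≠ [] ∧ p.IsChain (fun b a => Q.src b = Q.tgt a ∧ ¬ Q.rel b a)

/-- `p` is a nontrivial path outside `I`, which starts at `x` and ends at `y`. -/
def IsPathFromTo (Q : BoundQuiver V E) (p : List E) (x y : V) : Prop :=
  Q.IsPath p ∧ (∀ a ∈ p.getLast?, Q.src a = x) ∧ (∀ a ∈ p.head?, Q.tgt a = y)

/-- The bound quiver is gentle; the last field says that `I` is admissible. (The ideal `I` is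
generated by paths of length two by construction, and finiteness of the quiver is assumed
separately.) -/
structure IsGentle (Q : BoundQuiver V E) : Prop where
  out_le : ∀ v, {a | Q.src a = v}.encard ≤ 2
  in_le : ∀ v, {a | Q.tgt a = v}.encard ≤ 2
  nonrel_left : ∀ a b b', Q.src b = Q.tgt a → Q.src b' = Q.tgt a →
    ¬ Q.rel b a → ¬ Q.rel b' a → b = b'
  nonrel_right : ∀ b a a', Q.src b = Q.tgt a → Q.src b = Q.tgt a' →
    ¬ Q.rel b a → ¬ Q.rel b a' → a = a'
  rel_left : ∀ a b b', Q.rel b a → Q.rel b' a → b = b'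
  rel_right : ∀ b a a', Q.rel b a → Q.rel b a' → a = a'
  admissible : ∃ N : ℕ, ∀ p, Q.IsPath p → p.length ≤ N

/-- The defining relations of the bound path algebra `k Q / I` on the generators `V ⊕ E` (the
idempotents of the vertices, and the arrows). -/
inductive AlgRel (k : Type u) [Field k] [Fintype V] (Q : BoundQuiver V E) :
    FreeAlgebra k (V ⊕ E) → FreeAlgebra k (V ⊕ E) → Prop
  | idem (v : V) : AlgRel k Q
      (FreeAlgebra.ι k (Sum.inl v) * FreeAlgebra.ι k (Sum.inl v)) (FreeAlgebra.ι k (Sum.inl v))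
  | orth (v w : V) (h : v ≠ w) : AlgRel k Q
      (FreeAlgebra.ι k (Sum.inl v) * FreeAlgebra.ι k (Sum.inl w)) 0
  | one : AlgRel k Q (∑ v : V, FreeAlgebra.ι k (Sum.inl v)) 1
  | tgt (a : E) : AlgRel k Q
      (FreeAlgebra.ι k (Sum.inl (Q.tgt a)) * FreeAlgebra.ι k (Sum.inr a))
      (FreeAlgebra.ι k (Sum.inr a))
  | src (a : E) : AlgRel k Q
      (FreeAlgebra.ι k (Sum.inr a) * FreeAlgebra.ι k (Sum.inl (Q.src a)))
      (FreeAlgebra.ι k (Sum.inr a))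
  | zero (b a : E) (h : Q.rel b a) : AlgRel k Q
      (FreeAlgebra.ι k (Sum.inr b) * FreeAlgebra.ι k (Sum.inr a)) 0

/-- The algebra `Λ = k Q / I`. Products are composed from right to left. -/
def Alg (k : Type u) [Field k] [Fintype V] (Q : BoundQuiver V E) : Type u :=
  RingQuot (AlgRel k Q)

instance (k : Type u) [Field k] [Fintype V] (Q : BoundQuiver V E) : Ring (Alg k Q) :=
  inferInstanceAs (Ring (RingQuot (AlgRel k Q)))

instance (k : Type u) [Field k] [Fintype V] (Q : BoundQuiver V E) : Algebra k (Alg k Q) :=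
  inferInstanceAs (Algebra k (RingQuot (AlgRel k Q)))

/-- The quotient map onto `Λ` from the free algebra on the vertices and arrows. -/
def algMk (k : Type u) [Field k] [Fintype V] (Q : BoundQuiver V E) :
    FreeAlgebra k (V ⊕ E) →ₐ[k] Alg k Q :=
  RingQuot.mkAlgHom k (AlgRel k Q)

theorem algMk_rel (k : Type u) [Field k] [Fintype V] (Q : BoundQuiver V E)
    {x y : FreeAlgebra k (V ⊕ E)} (h : AlgRel k Q x y) : algMk k Q x = algMk k Q y :=
  RingQuot.mkAlgHom_rel k h

section Elements

variable (k : Type u) [Field k] [Fintype V] (Q : BoundQuiver V E)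

/-- The idempotent `e_v` of `Λ`. -/
def vert (v : V) : Alg k Q :=
  algMk k Q (FreeAlgebra.ι k (Sum.inl v))

/-- The element of `Λ` given by an arrow. -/
def arr (a : E) : Alg k Q :=
  algMk k Q (FreeAlgebra.ι k (Sum.inr a))

/-- The element of `Λ` given by the path `a₁ ⋯ aᵣ`. -/
def pathElt (p : List E) : Alg k Q := (p.map (arr k Q)).prod

theorem vert_mul_self (v : V) : vert k Q v * vert k Q v = vert k Q v := by
  have h := algMk_rel k Q (AlgRel.idem (k := k) (Q := Q) v)
  rwa [map_mul] at h

theorem vert_mul_arr (a : E) : vert k Q (Q.tgt a) * arr k Q a = arr k Q a := by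
  have h := algMk_rel k Q (AlgRel.tgt (k := k) (Q := Q) a)
  rwa [map_mul] at h

theorem arr_mul_vert (a : E) : arr k Q a * vert k Q (Q.src a) = arr k Q a := by
  have h := algMk_rel k Q (AlgRel.src (k := k) (Q := Q) a)
  rwa [map_mul] at h

theorem arr_mul_arr (b a : E) (hba : Q.rel b a) : arr k Q b * arr k Q a = 0 := by
  have h := algMk_rel k Q (AlgRel.zero (k := k) (Q := Q) b a hba)
  rwa [map_mul, map_zero] at h

theorem vert_mul_pathElt {p : List E} {x y : V} (h : Q.IsPathFromTo p x y) :
    vert k Q y * pathElt k Q p = pathElt k Q p := by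
  obtain ⟨⟨hne, -⟩, -, h2⟩ := h
  cases p with
  | nil => exact absurd rfl hne
  | cons a l =>
    have : Q.tgt a = y := h2 a (by simp)
    subst this
    simp [pathElt, ← mul_assoc, vert_mul_arr]

theorem pathElt_mul_vert {p : List E} {x y : V} (h : Q.IsPathFromTo p x y) :
    pathElt k Q p * vert k Q x = pathElt k Q p := by
  obtain ⟨⟨hne, -⟩, h1, -⟩ := h
  obtain ⟨l, a, rfl⟩ := List.eq_nil_or_concat p |>.resolve_left hne
  have : Q.src a = x := h1 a (by simp)
  subst this
  simp [pathElt, mul_assoc, arr_mul_vert]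

theorem pathElt_mul_pathElt {p q : List E}
    (h : ∃ b ∈ p.getLast?, ∃ a ∈ q.head?, Q.rel b a) :
    pathElt k Q p * pathElt k Q q = 0 := by
  obtain ⟨b, hb, a, ha, hr⟩ := h
  have hp : p ≠ [] := by rintro rfl; simp at hb
  obtain ⟨l, b', rfl⟩ := List.eq_nil_or_concat p |>.resolve_left hp
  obtain rfl : b' = b := by simpa using hb
  cases q with
  | nil => simp at ha
  | cons a' m =>
    obtain rfl : a' = a := by simpa using ha
    simp only [pathElt, List.concat_eq_append, List.map_append, List.map_cons, List.map_nil,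
      List.prod_append, List.prod_cons, List.prod_nil, mul_one]
    rw [mul_assoc, ← mul_assoc (arr k Q b'), arr_mul_arr k Q b' a' hr, zero_mul, mul_zero]

end Elements

end BoundQuiver

open BoundQuiver

/-! ### Complexes of projectives given by matrices -/

/-- A graded family of indecomposable projectives `P_{v i} = Λ e_{v i}`, placed in degree `deg i`, for
`i ∈ J`, with a differential given by a row-finite matrix with entries in `Λ`. The entry `d i j` lies
in `e_{v i} Λ e_{v j}`, and right multiplication by it is a map `P_{v i} → P_{v j}`. -/
structure MatrixComplex (k : Type u) [Field k] [Fintype V] (Q : BoundQuiver V E) (I : Type) where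
  J : Set I
  v : I → V
  deg : I → ℤ
  d : I → I →₀ Alg k Q
  d_supp : ∀ i ∈ J, ∀ j, d i j ≠ 0 → j ∈ J ∧ deg j = deg i + 1
  vert_mul_d : ∀ i j, vert k Q (v i) * d i j = d i j
  d_mul_vert : ∀ i j, d i j * vert k Q (v j) = d i j
  d_sq : ∀ i ∈ J, Finsupp.linearCombination (Alg k Q) d (d i) = 0

namespace MatrixComplex

variable {k : Type u} [Field k] [Fintype V] {Q : BoundQuiver V E} {I I' : Type}
  (C : MatrixComplex k Q I)

/-- The left `Λ`-module `⨁ Λ e_{v i}` over all `i ∈ J` with `deg i = n`, as a submodule of the free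
module on `I`. -/
def piece (n : ℤ) : Submodule (Alg k Q) (I →₀ Alg k Q) where
  carrier := {x | ∀ i, x i * vert k Q (C.v i) = x i ∧ (x i ≠ 0 → i ∈ C.J ∧ C.deg i = n)}
  zero_mem' := by intro i; simp
  add_mem' := by
    intro x y hx hy i
    refine ⟨by simp [add_mul, (hx i).1, (hy i).1], fun h => ?_⟩
    by_cases h1 : x i = 0
    · exact (hy i).2 (by intro h2; exact h (by simp [h1, h2]))
    · exact (hx i).2 h1
  smul_mem' := by
    intro r x hx i
    refine ⟨by simp [mul_assoc, (hx i).1], fun h => (hx i).2 ?_⟩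
    intro h1
    exact h (by simp [h1])

/-- The action of a matrix on row vectors: `x ↦ ∑ i, x i • F i`. -/
abbrev rowMap (F : I → I' →₀ Alg k Q) :
    (I →₀ Alg k Q) →ₗ[Alg k Q] (I' →₀ Alg k Q) :=
  Finsupp.linearCombination (Alg k Q) F

theorem rowMap_mem (n : ℤ) (x : I →₀ Alg k Q) (hx : x ∈ C.piece n) :
    rowMap C.d x ∈ C.piece (n + 1) := by
  rw [rowMap, Finsupp.linearCombination_apply]
  refine Submodule.sum_mem _ fun i _ => ?_
  by_cases h0 : x i = 0
  · simp [h0]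
  · refine Submodule.smul_mem _ _ fun j => ⟨C.d_mul_vert i j, fun hj => ?_⟩
    obtain ⟨hJ, hd⟩ := (hx i).2 h0
    obtain ⟨hJ', hd'⟩ := C.d_supp i hJ j hj
    exact ⟨hJ', by rw [hd', hd]⟩

theorem rowMap_rowMap (n : ℤ) (x : I →₀ Alg k Q) (hx : x ∈ C.piece n) :
    rowMap C.d (rowMap C.d x) = 0 := by
  have h : rowMap C.d x = ∑ i ∈ x.support, x i • C.d i := Finsupp.linearCombination_apply _ _
  rw [h, map_sum]
  refine Finset.sum_eq_zero fun i hi => ?_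
  rw [map_smul, C.d_sq i ((hx i).2 (Finsupp.mem_support_iff.mp hi)).1, smul_zero]

/-- The differential from degree `n` to degree `m = n + 1`. -/
def dMap (n m : ℤ) (h : n + 1 = m) : C.piece n →ₗ[Alg k Q] C.piece m :=
  (rowMap C.d).restrict (fun x hx => h ▸ C.rowMap_mem n x hx)

open Classical in
/-- The cochain complex of `Λ`-modules given by the matrix. -/
def toComplex : CochainComplex (ModuleCat.{u} (Alg k Q)) ℤ where
  X n := ModuleCat.of (Alg k Q) (C.piece n)
  d n m := if h : n + 1 = m then ModuleCat.ofHom (C.dMap n m h) else 0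
  shape n m h := by
    rw [dif_neg]
    exact h
  d_comp_d' l m n h h' := by
    rw [ComplexShape.up_Rel] at h h'
    rw [dif_pos h, dif_pos h']
    refine ModuleCat.hom_ext (LinearMap.ext fun x => Subtype.ext ?_)
    exact C.rowMap_rowMap l x.1 x.2

/-- The chain map `f` is given by right multiplication with the matrix `F`. -/
def IsGivenBy {C : MatrixComplex k Q I} {D : MatrixComplex k Q I'}
    (f : C.toComplex ⟶ D.toComplex) (F : I → I' →₀ Alg k Q) : Prop :=
  ∀ (n : ℤ) (x : C.piece n), Subtype.val (p := (· ∈ D.piece n)) ((f.f n).hom x) = rowMap F x.1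

end MatrixComplex

/-! ### Words in homotopy letters -/

/-- A homotopy letter: a path `a₁ ⋯ aᵣ`, read either directly or inversely. -/
structure Letter (E : Type u) where
  path : List E
  direct : Bool

namespace Letter

/-- The formal inverse of a homotopy letter. -/
def inv (x : Letter E) : Letter E := ⟨x.path, !x.direct⟩

/-- A homotopy letter as an element of the free group on the arrows. Since homotopy letters are reduced
words, a homotopy letter is determined by this element. -/
def elt (x : Letter E) : FreeGroup E :=
  if x.direct then (x.path.map FreeGroup.of).prod else (x.path.map FreeGroup.of).prod⁻¹

/-- `x` is a homotopy letter whose left end is the vertex `y` and whose right end is the vertex `z`: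
words are written from right to left, so a direct letter starts at its right end. -/
def Joins (Q : BoundQuiver V E) (x : Letter E) (y z : V) : Prop :=
  if x.direct then Q.IsPathFromTo x.path z y else Q.IsPathFromTo x.path y z

/-- The neighbouring letters `x y` of a word are a part of its partition into homotopy letters: if
both are direct or both are inverse, then the composition is a relation; if they have different
directions, then the word is reduced where they meet. -/
def Break (Q : BoundQuiver V E) (x y : Letter E) : Prop :=
  match x.direct, y.direct with
  | true, true => ∃ b ∈ x.path.getLast?, ∃ a ∈ y.path.head?, Q.rel b a
  | false, false => ∃ b ∈ y.path.getLast?, ∃ a ∈ x.path.head?, Q.rel b a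
  | true, false => x.path.getLast? ≠ y.path.getLast?
  | false, true => x.path.head? ≠ y.path.head?

end Letter

/-- A (finite or infinite) graded word which is partitioned into homotopy letters. The vertices of
the unfolded diagram are the positions `i ∈ J`, where `J` is an interval of integers, read from left
to right. The letter number `i` joins the positions `i` and `i + 1`. A direct letter points to the
right in the unfolded diagram, an inverse letter points to the left, and the degree goes up by one
along each arrow of the diagram. Values outside `J` are irrelevant. -/
structure HWord (Q : BoundQuiver V E) where
  J : Set ℤ
  nonempty : J.Nonempty
  ordConnected : J.OrdConnected
  v : ℤ → V
  deg : ℤ → ℤ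
  letter : ℤ → Letter E
  joins : ∀ i ∈ J, i + 1 ∈ J → (letter i).Joins Q (v i) (v (i + 1))
  deg_succ : ∀ i ∈ J, i + 1 ∈ J →
    deg (i + 1) = if (letter i).direct then deg i + 1 else deg i - 1
  break' : ∀ i, i - 1 ∈ J → i ∈ J → i + 1 ∈ J → (letter (i - 1)).Break Q (letter i)

namespace HWord

variable {Q : BoundQuiver V E}

/-- The `L` consecutive letters of a word which start at position `p`. -/
def segment (W : HWord Q) (p : ℤ) (L : ℕ) : List (Letter E) :=
  (List.range L).map (fun r : ℕ => W.letter (p + r))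

theorem path_of_direct (W : HWord Q) {t : ℤ} (h : t ∈ W.J) (h' : t + 1 ∈ W.J)
    (hd : (W.letter t).direct = true) :
    Q.IsPathFromTo (W.letter t).path (W.v (t + 1)) (W.v t) := by
  have := W.joins t h h'
  rwa [Letter.Joins, if_pos hd] at this

theorem path_of_inverse (W : HWord Q) {t : ℤ} (h : t - 1 ∈ W.J) (h' : t ∈ W.J)
    (hd : (W.letter (t - 1)).direct = false) :
    Q.IsPathFromTo (W.letter (t - 1)).path (W.v (t - 1)) (W.v t) := by
  have := W.joins (t - 1) h (by simpa using h')
  rwa [Letter.Joins, if_neg (by simp [hd]), sub_add_cancel] at this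

section Rows

variable (k : Type u) [Field k] [Fintype V] (W : HWord Q) {I : Type} (π : ℤ → I) (scal : ℤ → k)

open Classical in
/-- The components of the differential of the unfolded diagram which start at position `t`: to the
right along a direct letter, to the left along an inverse letter. The scalar `scal t` is placed on
the letter `t` if it is direct. Positions are labelled by `π`. -/
def row (t : ℤ) : I →₀ Alg k Q :=
  (if t ∈ W.J ∧ t + 1 ∈ W.J ∧ (W.letter t).direct = true then
    Finsupp.single (π (t + 1)) (scal t • pathElt k Q (W.letter t).path) else 0) +
  (if t - 1 ∈ W.J ∧ t ∈ W.J ∧ (W.letter (t - 1)).direct = false then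
    Finsupp.single (π (t - 1)) (pathElt k Q (W.letter (t - 1)).path) else 0)

variable {k W π scal}

theorem row_cases {P : (I →₀ Alg k Q) → Prop} (t : ℤ)
    (h0 : P 0) (hadd : ∀ x y, P x → P y → P (x + y))
    (h1 : t ∈ W.J → t + 1 ∈ W.J → (W.letter t).direct = true →
      P (Finsupp.single (π (t + 1)) (scal t • pathElt k Q (W.letter t).path)))
    (h2 : t - 1 ∈ W.J → t ∈ W.J → (W.letter (t - 1)).direct = false →
      P (Finsupp.single (π (t - 1)) (pathElt k Q (W.letter (t - 1)).path))) :
    P (W.row k π scal t) := by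
  unfold row
  refine hadd _ _ ?_ ?_
  · split_ifs with h
    · exact h1 h.1 h.2.1 h.2.2
    · exact h0
  · split_ifs with h
    · exact h2 h.1 h.2.1 h.2.2
    · exact h0

theorem vert_mul_row (t : ℤ) (j : I) :
    vert k Q (W.v t) * W.row k π scal t j = W.row k π scal t j := by
  refine row_cases (P := fun x => vert k Q (W.v t) * x j = x j) t (by simp)
    (fun x y hx hy => by simp [mul_add, hx, hy]) (fun h h' hd => ?_) (fun h h' hd => ?_)
  · by_cases hj : π (t + 1) = j
    · subst hj
      simp [vert_mul_pathElt k Q (path_of_direct W h h' hd)]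
    · simp [hj]
  · by_cases hj : π (t - 1) = j
    · subst hj
      simp [vert_mul_pathElt k Q (path_of_inverse W h h' hd)]
    · simp [hj]

theorem row_mul_vert (vI : I → V) (hv : ∀ t, vI (π t) = W.v t) (t : ℤ) (j : I) :
    W.row k π scal t j * vert k Q (vI j) = W.row k π scal t j := by
  refine row_cases (P := fun x => x j * vert k Q (vI j) = x j) t (by simp)
    (fun x y hx hy => by simp [add_mul, hx, hy]) (fun h h' hd => ?_) (fun h h' hd => ?_)
  · by_cases hj : π (t + 1) = j
    · subst hj
      simp [hv, pathElt_mul_vert k Q (path_of_direct W h h' hd)]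
    · simp [hj]
  · by_cases hj : π (t - 1) = j
    · subst hj
      simp [hv, pathElt_mul_vert k Q (path_of_inverse W h h' hd)]
    · simp [hj]

theorem row_supp (t : ℤ) (j : I) (hj : W.row k π scal t j ≠ 0) :
    ∃ s ∈ W.J, π s = j ∧ W.deg s = W.deg t + 1 := by
  revert hj
  refine row_cases (P := fun x => x j ≠ 0 → ∃ s ∈ W.J, π s = j ∧ W.deg s = W.deg t + 1) t
    (by simp) (fun x y hx hy hxy => ?_) (fun h h' hd hj => ?_) (fun h h' hd hj => ?_)
  · by_cases h : x j = 0
    · exact hy (by intro h2; exact hxy (by simp [h, h2]))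
    · exact hx h
  · refine ⟨t + 1, h', ?_, by rw [W.deg_succ t h h', if_pos hd]⟩
    by_contra hne
    exact hj (by simp [hne])
  · refine ⟨t - 1, h, ?_, ?_⟩
    · by_contra hne
      exact hj (by simp [hne])
    · have := W.deg_succ (t - 1) h (by simpa using h')
      rw [if_neg (by simp [hd]), sub_add_cancel] at this
      omega

theorem row_sq (d : I → I →₀ Alg k Q) (hd : ∀ t, d (π t) = W.row k π scal t) (t : ℤ) :
    Finsupp.linearCombination (Alg k Q) d (W.row k π scal t) = 0 := by
  refine row_cases (P := fun x => Finsupp.linearCombination (Alg k Q) d x = 0) t (by simp)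
    (fun x y hx hy => by rw [map_add, hx, hy, add_zero]) (fun h h' hdir => ?_)
    (fun h h' hdir => ?_)
  · rw [Finsupp.linearCombination_single, hd, row]
    have h1 : t + 1 - 1 = t := by ring
    rw [if_neg (c := _ ∧ _ ∧ (W.letter (t + 1 - 1)).direct = false) (by simp [h1, hdir]), add_zero]
    split_ifs with hc
    · have hb := W.break' (t + 1) (by rwa [h1]) h' hc.2.1
      rw [h1] at hb
      simp only [Letter.Break, hdir, hc.2.2] at hb
      rw [Finsupp.smul_single, smul_eq_mul, smul_mul_smul_comm, pathElt_mul_pathElt k Q hb,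
        smul_zero, Finsupp.single_zero]
    · simp
  · rw [Finsupp.linearCombination_single, hd, row]
    have h1 : t - 1 + 1 = t := by ring
    rw [if_neg (c := _ ∧ _ ∧ (W.letter (t - 1)).direct = true) (by simp [hdir]), zero_add]
    split_ifs with hc
    · have hb := W.break' (t - 1) hc.1 h (by rwa [h1])
      simp only [Letter.Break, hdir, hc.2.2] at hb
      rw [Finsupp.smul_single, smul_eq_mul, pathElt_mul_pathElt k Q hb, Finsupp.single_zero]
    · simp

end Rows

end HWord

/-- A finite or infinite homotopy string (with a grading). An infinite end consists, from some point
on, of single arrows whose consecutive products vanish, directed such that the degrees tend to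
`-∞`. -/
structure HString (Q : BoundQuiver V E) extends HWord Q where
  left_tail : ¬ BddBelow J → ∃ N : ℤ, ∀ i < N,
    (letter i).direct = true ∧ (letter i).path.length = 1
  right_tail : ¬ BddAbove J → ∃ N : ℤ, ∀ i > N,
    (letter i).direct = false ∧ (letter i).path.length = 1

/-- A homotopy band `σ` with `n` homotopy letters, given by the periodic word `^∞σ^∞`. It has as many
direct as inverse letters (the degree is periodic) and it is not a proper power. -/
structure HBand (Q : BoundQuiver V E) extends HWord Q where
  J_eq : J = Set.univ
  n : ℕ
  n_pos : 0 < n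
  letter_add : ∀ i, letter (i + n) = letter i
  v_add : ∀ i, v (i + n) = v i
  deg_add : ∀ i, deg (i + n) = deg i
  primitive : ∀ m : ℕ, 0 < m → (∀ i, letter (i + m) = letter i) → n ≤ m

/-! ### String and band complexes -/

namespace HString

variable {Q : BoundQuiver V E} (τ : HString Q) (k : Type u) [Field k] [Fintype V]

/-- The data of the string complex `P_τ`: one projective for each position of `τ`. -/
def matrixComplex : MatrixComplex k Q ℤ where
  J := τ.J
  v := τ.v
  deg := τ.deg
  d := τ.row k id (fun _ => 1)
  d_supp i _ j hj := by
    obtain ⟨s, hs, rfl, hd⟩ := HWord.row_supp i j hj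
    exact ⟨hs, hd⟩
  vert_mul_d i j := HWord.vert_mul_row i j
  d_mul_vert i j := HWord.row_mul_vert τ.v (fun _ => rfl) i j
  d_sq i _ := HWord.row_sq _ (fun _ => rfl) i

/-- The string complex `P_τ`. -/
def complex : CochainComplex (ModuleCat.{u} (Alg k Q)) ℤ := (τ.matrixComplex k).toComplex

end HString

namespace HBand

variable {Q : BoundQuiver V E} (σ : HBand Q)

instance : NeZero σ.n := ⟨σ.n_pos.ne'⟩

/-- The rotation of the band which starts at position `s`, as a list of `n` homotopy letters. -/
def rotation (s : ℤ) : List (Letter E) := σ.segment s σ.n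

theorem periodic {α : Type*} (f : ℤ → α) (hf : ∀ i, f (i + σ.n) = f i) (t : ℤ) :
    f (((t : ZMod σ.n).val : ℕ) : ℤ) = f t := by
  have hp : Function.Periodic f (σ.n : ℤ) := hf
  rw [ZMod.val_intCast]
  conv_rhs => rw [← Int.emod_add_mul_ediv t σ.n, mul_comm]
  exact (hp.int_mul (t / σ.n) _).symm

variable (k : Type u) [Field k]

/-- The scalar `lam`, placed on the letters which are congruent to the letter number `d`. -/
def scal (d : ℤ) (lam : kˣ) (t : ℤ) : k :=
  if (t : ZMod σ.n) = (d : ZMod σ.n) then lam else 1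

variable [Fintype V]

theorem row_add (d : ℤ) (lam : kˣ) (t : ℤ) :
    σ.row k (fun i : ℤ => (i : ZMod σ.n)) (σ.scal k d lam) (t + σ.n) =
      σ.row k (fun i : ℤ => (i : ZMod σ.n)) (σ.scal k d lam) t := by
  have h1 : t + σ.n - 1 = t - 1 + σ.n := by ring
  simp [HWord.row, h1, σ.letter_add, scal, σ.J_eq]

/-- The data of the band complex `B_{σ,λ}`, where `λ` is placed on the direct letter number `d`: one
projective for each of the `n` positions of the band modulo rotation by a full period. -/
def matrixComplex (d : ℤ) (lam : kˣ) : MatrixComplex k Q (ZMod σ.n) where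
  J := Set.univ
  v i := σ.v (i.val : ℤ)
  deg i := σ.deg (i.val : ℤ)
  d i := σ.row k (fun i : ℤ => (i : ZMod σ.n)) (σ.scal k d lam) (i.val : ℤ)
  d_supp i _ j hj := by
    obtain ⟨s, hs, rfl, hd⟩ := HWord.row_supp _ j hj
    exact ⟨Set.mem_univ _, by rw [σ.periodic _ σ.deg_add s, hd]⟩
  vert_mul_d i j := HWord.vert_mul_row _ j
  d_mul_vert i j := HWord.row_mul_vert (fun i : ZMod σ.n => σ.v (i.val : ℤ))
    (fun t => σ.periodic _ σ.v_add t) _ j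
  d_sq i _ := HWord.row_sq _ (fun t => σ.periodic _ (σ.row_add k d lam) t) _

/-- The band complex `B_{σ,λ}`, where `λ` is placed on the letter number `d` (a direct letter). -/
def complex (d : ℤ) (lam : kˣ) : CochainComplex (ModuleCat.{u} (Alg k Q)) ℤ :=
  (σ.matrixComplex k d lam).toComplex

end HBand

/-! ### Overlaps and graph maps -/

/-- The condition at one end `x` of an overlap. Here `σl` and `τl` are the paths of the letters of `σ`
and `τ` which are adjacent to the overlap at `x`; `σin` and `τin` say whether the corresponding arrows
of the unfolded diagrams point towards `x`, and `pres` says whether `τ` has such a letter. The path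
`f` is the component of the graph map next to the identity at `x`; `f = []` means that it is empty.

If `f` is nonempty, then both arrows point towards `x` or both point away from `x`, and `f` makes the
square commute. If `f` is empty, then the arrow of `σ` points away from `x`, and the letter of `τ` is
absent or points towards `x`. In the latter case the composition through `x` is a nonzero path, which
is automatic for a nontrivial overlap, and for a trivial overlap says on which of the two sides of `x`
the letters of `σ` and `τ` are. -/
def EndCondition (Q : BoundQuiver V E) (σl : List E) (σin : Prop) (pres : Prop) (τl : List E)
    (τin : Prop) (f : List E) : Prop :=
  (f ≠ [] ∧ pres ∧ σin ∧ τin ∧ σl = f ++ τl) ∨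
  (f ≠ [] ∧ pres ∧ ¬ σin ∧ ¬ τin ∧ τl = σl ++ f) ∨
  (f = [] ∧ ¬ σin ∧ (pres → τin ∧ Q.IsPath (τl ++ σl)))

/-- A finite maximal common homotopy substring `ρ` of the (unfolded) band `σ` and of the string `τ`
which satisfies the endpoint conditions of graph maps `B_σ → P_τ`. It consists of the `L` letters
starting at position `s` of `σ` and at position `p` of `τ`. -/
structure Overlap {Q : BoundQuiver V E} (σ : HBand Q) (τ : HString Q) where
  s : ℤ
  p : ℤ
  L : ℕ
  mem : ∀ r : ℕ, r ≤ L → p + r ∈ τ.J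
  v_eq : ∀ r : ℕ, r ≤ L → τ.v (p + r) = σ.v (s + r)
  deg_eq : ∀ r : ℕ, r ≤ L → τ.deg (p + r) = σ.deg (s + r)
  letter_eq : ∀ r : ℕ, r < L → τ.letter (p + r) = σ.letter (s + r)
  fL : List E
  fR : List E
  left_end : EndCondition Q (σ.letter (s - 1)).path ((σ.letter (s - 1)).direct = true)
    (p - 1 ∈ τ.J) (τ.letter (p - 1)).path ((τ.letter (p - 1)).direct = true) fL
  right_end : EndCondition Q (σ.letter (s + L)).path ((σ.letter (s + L)).direct = false)
    (p + L + 1 ∈ τ.J) (τ.letter (p + L)).path ((τ.letter (p + L)).direct = false) fR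

namespace Overlap

variable {Q : BoundQuiver V E} {σ : HBand Q} {τ : HString Q} (ov : Overlap σ τ)

/-- The word `ρ`. -/
def word : List (Letter E) := σ.segment ov.s ov.L

variable {k : Type u} [Field k] [Fintype V]

/-- The scalars of a graph map along the unfolded band are determined, up to a common factor, by the
commutativity of the squares of the unfolded diagram. -/
def IsBalanced (σ : HBand Q) (d : ℤ) (lam : kˣ) (c : ℤ → kˣ) : Prop :=
  ∀ t, if (σ.letter t).direct = true then (c t : k) = σ.scal k d lam t * c (t + 1)
    else c (t + 1) = c t

open Classical in
/-- The components of the graph map which start at the position `i` of the band: (multiples of)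
identities at all the positions of the overlap which lie over `i`, and `f_L` and `f_R` next to the two
ends of the overlap. -/
def graphRow (c : ℤ → kˣ) (i : ZMod σ.n) : ℤ →₀ Alg k Q :=
  (∑ r ∈ Finset.range (ov.L + 1), if ((ov.s + r : ℤ) : ZMod σ.n) = i then
    Finsupp.single (ov.p + r) ((c (ov.s + r) : k) • vert k Q (σ.v (ov.s + r))) else 0) +
  (if ov.fL ≠ [] ∧ ((ov.s - 1 : ℤ) : ZMod σ.n) = i then
    Finsupp.single (ov.p - 1) ((c (ov.s - 1) : k) • pathElt k Q ov.fL) else 0) +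
  (if ov.fR ≠ [] ∧ ((ov.s + ov.L + 1 : ℤ) : ZMod σ.n) = i then
    Finsupp.single (ov.p + ov.L + 1) ((c (ov.s + ov.L + 1) : k) • pathElt k Q ov.fR) else 0)

/-- `f : B_{σ,λ} → P_τ` is the graph map determined by the overlap (up to a nonzero scalar factor). -/
def IsGraphMap {d : ℤ} {lam : kˣ} (f : σ.complex k d lam ⟶ τ.complex k) : Prop :=
  ∃ c : ℤ → kˣ, IsBalanced σ d lam c ∧
    MatrixComplex.IsGivenBy (C := σ.matrixComplex k d lam) (D := τ.matrixComplex k) f (ov.graphRow c)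

end Overlap

/-! ### Concatenations -/

/-- The word `W` is the concatenation `δ w γ`, where the list `w` of letters starts at position `p` of
`W`. The positions of `δ` are numbered as in `W`, and the positions of `γ` are numbered such that its
left end is `0`. -/
structure IsConcat {Q : BoundQuiver V E} (W : HWord Q) (p : ℤ) (δ : HWord Q) (w : List (Letter E))
    (γ : HWord Q) : Prop where
  mem : ∀ r : ℕ, r ≤ w.length → p + r ∈ W.J
  middle : W.segment p w.length = w
  left_mem : ∀ i, i ∈ δ.J ↔ i ≤ p ∧ i ∈ W.J
  left_v : ∀ i ∈ δ.J, W.v i = δ.v i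
  left_deg : ∀ i ∈ δ.J, W.deg i = δ.deg i
  left_letter : ∀ i ∈ δ.J, i + 1 ∈ δ.J → W.letter i = δ.letter i
  right_mem : ∀ i, i ∈ γ.J ↔ 0 ≤ i ∧ p + w.length + i ∈ W.J
  right_v : ∀ i ∈ γ.J, W.v (p + w.length + i) = γ.v i
  right_deg : ∀ i ∈ γ.J, W.deg (p + w.length + i) = γ.deg i
  right_letter : ∀ i ∈ γ.J, i + 1 ∈ γ.J → W.letter (p + w.length + i) = γ.letter i

/-- The formal inverse of a list of homotopy letters. -/
def invList (w : List (Letter E)) : List (Letter E) := (w.map Letter.inv).reverse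

/-- The power `w ^ m` of a list of homotopy letters. -/
def power (w : List (Letter E)) (m : ℕ) : List (Letter E) := (List.replicate m w).flatten

/-- The word `c` is obtained from the concatenation `δ w γ` of a word `δ` with right end `p`, a
nonempty list `w` of homotopy letters and a word `γ` with left end `0` by reduction at the two places
where they meet: the last letter `τ_L` of `δ` and the first letter of `w` are replaced by the single
homotopy letter which is their product in the free group on the arrows, and so are the last letter of
`w` and the first letter `τ_R` of `γ` (if `w` has only one letter `x`, then `τ_L x τ_R` is replaced by
one homotopy letter). If `δ` is trivial, so that there is no `τ_L`, then the first letter of `w` is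
omitted (with what was merged with it), and similarly the last one if `γ` is trivial. So the positions
of `c` are the positions of `δ` except its right end, the inner positions of `w`, and the positions of
`γ` except its left end. The vertex and the degree at the `r`-th position of `w` are `vw r` and
`gw r`. -/
structure IsReducedConcat {Q : BoundQuiver V E} (c : HWord Q) (p : ℤ) (δ : HWord Q)
    (w : List (Letter E)) (vw : ℤ → V) (gw : ℤ → ℤ) (γ : HWord Q) : Prop where
  ne_nil : w ≠ []
  mem : ∀ i, i ∈ c.J ↔ (i < p ∧ i ∈ δ.J) ∨ (p ≤ i ∧ i + 1 < p + w.length) ∨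
    (p + w.length ≤ i + 1 ∧ i + 2 - p - w.length ∈ γ.J)
  left_v : ∀ i ∈ c.J, i < p → c.v i = δ.v i
  left_deg : ∀ i ∈ c.J, i < p → c.deg i = δ.deg i
  left_letter : ∀ i ∈ c.J, i + 1 < p → c.letter i = δ.letter i
  middle_v : ∀ i ∈ c.J, p ≤ i → i + 1 < p + w.length → c.v i = vw (i + 1 - p)
  middle_deg : ∀ i ∈ c.J, p ≤ i → i + 1 < p + w.length → c.deg i = gw (i + 1 - p)
  middle_letter : ∀ (r : ℕ) (x : Letter E), w[r]? = some x → p + r - 1 ∈ c.J → p + r ∈ c.J →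
    (c.letter (p + r - 1)).elt = (if r = 0 then (δ.letter (p - 1)).elt else 1) * x.elt *
      (if r + 1 = w.length then (γ.letter 0).elt else 1)
  right_v : ∀ i ∈ c.J, p + w.length ≤ i + 1 → c.v i = γ.v (i + 2 - p - w.length)
  right_deg : ∀ i ∈ c.J, p + w.length ≤ i + 1 → c.deg i = γ.deg (i + 2 - p - w.length)
  right_letter : ∀ i ∈ c.J, i + 1 ∈ c.J → p + w.length ≤ i + 1 →
    c.letter i = γ.letter (i + 2 - p - w.length)

/-- The complexes `X` and `Y` are isomorphic in the homotopy category of complexes of `Λ`-modules. For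
right bounded complexes of projectives with bounded cohomology this is isomorphism in the bounded
derived category, which is equivalent to `K^{b,-}(proj Λ)`. -/
def IsoInHomotopyCategory {R : Type u} [Ring R] (X Y : CochainComplex (ModuleCat.{u} R) ℤ) : Prop :=
  Nonempty ((HomotopyCategory.quotient (ModuleCat.{u} R) (ComplexShape.up ℤ)).obj X ≅
    (HomotopyCategory.quotient (ModuleCat.{u} R) (ComplexShape.up ℤ)).obj Y)

end Gentle

end

open Gentle

/-! The cone of `f` is built from the summands of B[1] and P_τ, and its differential contains the
identities of `f` along ρ. Cancelling such identities (Gaussian elimination) preserves the homotopy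
type; what survives is a string. Two regimes occur, according to whether the number L of letters of
ρ is smaller than the number n of letters of the band.

Short overlap, L < n. The L + 1 positions of ρ are distinct modulo n, so all the identities can be
cancelled at once. There remain the positions of τ outside ρ and the n - L - 1 inner positions of α.
The new differential consists of the old components between these, of f_L and f_R, and of zigzags:
enter ρ along τ_L or τ_R, go back along a cancelled identity, and leave along the band or along a
component of `f`. The zigzag that enters along τ_L and would go on to the right along σ vanishes: at
the end of ρ, τ_L is on the same strand as the neighbouring letter of σ, so its product with the
next letter of σ is zero. The right end is symmetric. What is left are exactly the merged letters at
the two ends of α. The scalars (λ, the coefficients of `f`, the sign of the band differential in the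
cone) are absorbed by rescaling summands, because the diagram of c is a line and not a cycle. This
is carried by `nonempty_homotopyEquiv_mappingCone`, its matrix form
`isoInHomotopyCategory_mappingCone_of_elimination`, the string `Overlap.surgery`, and the
computation `Overlap.surgery_d`.

Long overlap, n ≤ L. A window of n positions of ρ meets every class of band positions once, so
inverting `f` on it gives a retraction: `f` is a degreewise split monomorphism, and the cone is its
cokernel (`isoInHomotopyCategory_mappingCone_of_exact`). Let c be τ with one period removed from ρ.
There are two graph maps P_τ → P_c: one is the identity on the left part, the other shifts the right
part by n (`HString.AgreeLeft.comm`, `HString.AgreeRight.comm`). If κ is the factor by which the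
coefficients of `f` grow along a period, then (shift) - κ (identity) annihilates the image of `f` by
telescoping, and triangularity shows that it is a cokernel.

Gentleness enters through one principle. The half-edges at a vertex fall into strands, and two
neighbouring letters are separate letters of a word exactly if they meet on different strands
(`Letter.break_iff`). Hence a break depends only on strands (`Letter.Break.of_same`). This shows
both that the new words are homotopy strings and that the unwanted products of paths vanish. -/

noncomputable section

namespace Gentle

open BoundQuiver

/-! ### Homological perturbation and Gaussian elimination in a mapping cone -/

section Reduction

open CochainComplex Limits

variable {𝒞 : Type*} [Category 𝒞] [Preadditive 𝒞]

/-- A contraction datum `(ι, π, h)` on a complex, in the form of perturbation theory: the complement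
of the contracted part, with the perturbed differential, is homotopy equivalent to the complex. -/
theorem nonempty_homotopyEquiv_of_reduction {M N : CochainComplex 𝒞 ℤ}
    (ι : ∀ n, N.X n ⟶ M.X n) (π : ∀ n, M.X n ⟶ N.X n) (h : ∀ n m : ℤ, M.X n ⟶ M.X m)
    (h_zero : ∀ n m, m + 1 ≠ n → h n m = 0)
    (ι_π : ∀ n, ι n ≫ π n = 𝟙 _)
    (ι_h : ∀ n m, ι n ≫ h n m = 0) (h_π : ∀ n m, h n m ≫ π m = 0)
    (h_h : ∀ n m l, h n m ≫ h m l = 0)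
    (proj : ∀ l n m, l + 1 = n → n + 1 = m →
      (𝟙 _ - h n l ≫ M.d l n) ≫ π n ≫ ι n ≫ (𝟙 _ - M.d n m ≫ h m n) =
        𝟙 _ - h n l ≫ M.d l n - M.d n m ≫ h m n)
    (hd : ∀ n m, n + 1 = m → N.d n m = ι n ≫ M.d n m ≫ π m -
      ι n ≫ M.d n m ≫ h m n ≫ M.d n m ≫ π m) :
    Nonempty (HomotopyEquiv M N) := by
  have key1 : ∀ n m, n + 1 = m → π n ≫ N.d n m = π n ≫ ι n ≫ (𝟙 _ - M.d n m ≫ h m n) ≫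
      M.d n m ≫ π m := fun n m hnm => by
    rw [hd n m hnm]; simp
  have key2 : ∀ n m, n + 1 = m → N.d n m ≫ ι m = ι n ≫ M.d n m ≫ (𝟙 _ - h m n ≫ M.d n m) ≫
      π m ≫ ι m := fun n m hnm => by
    rw [hd n m hnm]; simp
  -- The perturbed projection (1 - hd)π and, below, the perturbed inclusion ι(1 - dh), composed from
  -- left to right. Both commute with the differentials because `proj` turns (1 - hd)πι(1 - dh) into
  -- 1 - hd - dh, after which d² = 0 finishes.
  let q : M ⟶ N :=
    { f := fun n => (𝟙 _ - h n (n - 1) ≫ M.d (n - 1) n) ≫ π n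
      comm' := by
        intro n m hnm
        have hnm' : n + 1 = m := hnm
        obtain rfl : n = m - 1 := by omega
        have := proj (m - 1 - 1) (m - 1) m (by omega) (by omega)
        rw [Category.assoc, key1 _ _ hnm', reassoc_of% this]
        simp }
  let i : N ⟶ M :=
    { f := fun n => ι n ≫ (𝟙 _ - M.d n (n + 1) ≫ h (n + 1) n)
      comm' := by
        intro n m hnm
        have hnm' : n + 1 = m := hnm
        subst hnm'
        have := proj n (n + 1) (n + 1 + 1) (by omega) (by omega)
        rw [← Category.assoc (N.d _ _), key2 _ _ rfl]
        simp only [Category.assoc]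
        rw [this]
        simp }
  have hiq : i ≫ q = 𝟙 N := by
    ext n
    simp [i, q, reassoc_of% ι_h, h_π, reassoc_of% h_h, ι_π]
  -- By `proj`, q followed by i is 1 - hd - dh, so -h is a homotopy to the identity. The other
  -- composite is strictly the identity by `hiq`.
  refine ⟨⟨q, i, ⟨fun n m => - h n m, fun n m hnm => ?_, fun n => ?_⟩, Homotopy.ofEq hiq⟩⟩
  · rw [h_zero n m hnm, neg_zero]
  · have h1 : (ComplexShape.up ℤ).Rel (n - 1) n := by simp
    have h2 : (ComplexShape.up ℤ).Rel n (n + 1) := by simp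
    rw [dNext_eq _ h2, prevD_eq _ h1]
    have := proj (n - 1) n (n + 1) (by omega) rfl
    simp only [HomologicalComplex.comp_f, q, i, Category.assoc, this, HomologicalComplex.id_f,
      Preadditive.comp_neg, Preadditive.neg_comp]
    abel

/-- Gaussian elimination in the mapping cone of `f : X ⟶ Y`: the components of `f` for which `r` is
an inverse are cancelled, and the complements in `X` and `Y` are the summands of `N`. -/
theorem nonempty_homotopyEquiv_mappingCone [HasBinaryBiproducts 𝒞]
    {X Y N : CochainComplex 𝒞 ℤ} (f : X ⟶ Y)
    (ιX : ∀ n m : ℤ, n + 1 = m → (N.X n ⟶ X.X m)) (πX : ∀ n m : ℤ, n + 1 = m → (X.X m ⟶ N.X n))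
    (ιY : ∀ n, N.X n ⟶ Y.X n) (πY : ∀ n, Y.X n ⟶ N.X n) (r : ∀ n, Y.X n ⟶ X.X n)
    (ι_π : ∀ n m (h : n + 1 = m), ιX n m h ≫ πX n m h + ιY n ≫ πY n = 𝟙 _)
    (πX_ιY : ∀ n m (h : n + 1 = m), πX n m h ≫ ιY n = 0)
    (πY_ιX : ∀ n m (h : n + 1 = m), πY n ≫ ιX n m h = 0)
    (ιY_r : ∀ n, ιY n ≫ r n = 0) (r_πX : ∀ n m (h : n + 1 = m), r m ≫ πX n m h = 0)
    (ιX_f_r : ∀ n m (h : n + 1 = m), ιX n m h ≫ f.f m ≫ r m = 0)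
    (projX : ∀ n m (h : n + 1 = m), (𝟙 _ - πX n m h ≫ ιX n m h) ≫ (𝟙 _ - f.f m ≫ r m) = 0)
    (projY : ∀ n, (𝟙 _ - r n ≫ f.f n) ≫ (𝟙 _ - πY n ≫ ιY n) = 0)
    (hd : ∀ n m l (h : n + 1 = m) (h' : m + 1 = l), N.d n m =
      - ιX n m h ≫ X.d m l ≫ πX m l h' + ιX n m h ≫ f.f m ≫ πY m + ιY n ≫ Y.d n m ≫ πY m +
      ιY n ≫ Y.d n m ≫ r m ≫ X.d m l ≫ πX m l h' - ιY n ≫ Y.d n m ≫ r m ≫ f.f m ≫ πY m) :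
    Nonempty (HomotopyEquiv (mappingCone f) N) := by
  open mappingCone in
  refine nonempty_homotopyEquiv_of_reduction
    (fun n => ιX n (n + 1) rfl ≫ (inl f).v (n + 1) n (by omega) + ιY n ≫ (inr f).f n)
    (fun n => (fst f).1.v n (n + 1) rfl ≫ πX n (n + 1) rfl + (snd f).v n n (add_zero n) ≫ πY n)
    (fun n m => if h : m + 1 = n then
      (snd f).v n n (add_zero n) ≫ r n ≫ (inl f).v n m (by omega) else 0)
    (fun n m h => dif_neg h) ?_ ?_ ?_ ?_ ?_ ?_
  · intro n
    simpa using ι_π n (n + 1) rfl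
  · intro n m
    split_ifs with h
    · simp [reassoc_of% ιY_r]
    · simp
  · intro n m
    split_ifs with h
    · subst h
      simp [r_πX]
    · simp
  · intro n m l
    split_ifs <;> simp
  · intro l n m hl hm
    obtain rfl : l = n - 1 := by omega
    subst hm
    have hX := projX n (n + 1) rfl
    have hY := projY n
    have e1 := πX_ιY n (n + 1) rfl
    have e2 := πY_ιX n (n + 1) rfl
    have d1 := inl_v_d f (n + 1) n (n + 1 + 1) (by omega) (by omega)
    have d2 := inl_v_d f n (n - 1) (n + 1) (by omega) (by omega)
    rw [dif_pos (by omega), dif_pos rfl]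
    simp only [Preadditive.sub_comp, Preadditive.comp_sub, Category.id_comp, Category.comp_id,
      Category.assoc, sub_eq_zero] at hX hY
    apply ext_from f (n + 1) n rfl
    · have hX' := congr($hX ≫ (inl f).v (n + 1) n (by omega))
      simp only [Preadditive.sub_comp, Category.id_comp, Category.assoc] at hX'
      simp only [Preadditive.sub_comp, Preadditive.comp_sub, Preadditive.add_comp,
        Preadditive.comp_add, Category.id_comp, Category.comp_id, Category.assoc,
        inl_v_fst_v_assoc, inl_v_snd_v_assoc, zero_comp, comp_zero, reassoc_of% e1,
        reassoc_of% d1, inr_f_snd_v_assoc, add_zero, sub_zero]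
      rw [← sub_eq_zero] at hX' ⊢
      rw [← neg_eq_zero, ← hX']
      abel
    -- On the summand Y the required identity is a combination of `projX` preceded by r d, of
    -- `projY`, and of `projY` followed by d r.
    · have hX' := congr(r n ≫ X.d n (n + 1) ≫ $hX ≫ (inl f).v (n + 1) n (by omega))
      have hY' := congr($hY ≫ (inr f).f n)
      have hY'' := congr($hY ≫ Y.d n (n + 1) ≫ r (n + 1) ≫ (inl f).v (n + 1) n (by omega))
      simp only [Preadditive.sub_comp, Preadditive.comp_sub, Category.id_comp,
        Category.assoc] at hX' hY' hY''
      simp only [Preadditive.sub_comp, Preadditive.comp_sub, Preadditive.add_comp,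
        Preadditive.comp_add, Category.id_comp, Category.comp_id, Category.assoc,
        inr_f_fst_v_assoc, inl_v_fst_v_assoc, inl_v_snd_v_assoc, zero_comp, comp_zero,
        reassoc_of% e1, reassoc_of% e2, inr_f_d_assoc,
        reassoc_of% d1, d2, inr_f_snd_v_assoc, add_zero, sub_zero, zero_add]
      rw [← sub_eq_zero] at hX' hY' hY'' ⊢
      simp only [f.comm_assoc] at hY''
      rw [← neg_eq_zero]
      calc _ = _ + _ - _ := ?_
        _ = (0 : _ ⟶ _) + 0 - 0 := congrArg₂ _ (congrArg₂ _ hX' hY') hY''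
        _ = 0 := by simp
      abel
  · intro n m h
    subst h
    have d1 := inl_v_d f (n + 1) n (n + 1 + 1) (by omega) (by omega)
    rw [hd n (n + 1) (n + 1 + 1) rfl rfl]
    have e1 := ιX_f_r n (n + 1) rfl
    simp [reassoc_of% d1, reassoc_of% e1]
    abel

end Reduction
end Gentle

/-! ### Maps between complexes of projectives as matrices over Λ -/

namespace Gentle

open BoundQuiver

variable {V E : Type u}

namespace MatrixComplex

variable {k : Type u} [Field k] [Fintype V] {Q : BoundQuiver V E} {I I' I'' : Type}

/-- The generator of the summand `Λ e_{v i}`. -/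
def basis (C : MatrixComplex k Q I) (i : I) : I →₀ Alg k Q :=
  Finsupp.single i (vert k Q (C.v i))

/-- The possible images of a generator of `Λ e_v` under a map to the degree `n` part. -/
def cell (C : MatrixComplex k Q I) (v : V) (n : ℤ) : AddSubgroup (I →₀ Alg k Q) where
  carrier := {x | x ∈ C.piece n ∧ vert k Q v • x = x}
  zero_mem' := ⟨zero_mem _, smul_zero _⟩
  add_mem' := fun hx hy => ⟨add_mem hx.1 hy.1, by rw [smul_add, hx.2, hy.2]⟩
  neg_mem' := fun hx => ⟨neg_mem hx.1, by rw [smul_neg, hx.2]⟩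

theorem smul_mem_cell {C : MatrixComplex k Q I} {v : V} {n : ℤ} {x : I →₀ Alg k Q}
    (a : k) (hx : x ∈ C.cell v n) : a • x ∈ C.cell v n := by
  refine ⟨?_, by rw [smul_comm, hx.2]⟩
  have := (C.piece n).smul_mem (algebraMap k _ a) hx.1
  rwa [algebraMap_smul] at this

theorem single_mem_cell {C : MatrixComplex k Q I} {v : V} {n : ℤ} {i : I} {a : Alg k Q}
    (hi : i ∈ C.J) (hn : C.deg i = n) (h1 : vert k Q v * a = a)
    (h2 : a * vert k Q (C.v i) = a) : Finsupp.single i a ∈ C.cell v n := by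
  classical
  refine ⟨fun j => ?_, by rw [Finsupp.smul_single, smul_eq_mul, h1]⟩
  by_cases hij : i = j
  · subst hij
    simp [h2, hi, hn]
  · simp [hij]

theorem basis_mem_cell (C : MatrixComplex k Q I) {i : I} (hi : i ∈ C.J) :
    C.basis i ∈ C.cell (C.v i) (C.deg i) :=
  single_mem_cell hi rfl (vert_mul_self k Q _) (vert_mul_self k Q _)

theorem d_mem_cell (C : MatrixComplex k Q I) {i : I} (hi : i ∈ C.J) :
    C.d i ∈ C.cell (C.v i) (C.deg i + 1) := by
  refine ⟨fun j => ⟨C.d_mul_vert i j, fun h => C.d_supp i hi j h⟩, ?_⟩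
  ext j
  simpa using C.vert_mul_d i j

/-- The matrix `F` defines maps of degree `e` from the summands of `C` to those of `D`. -/
def IsMatrix (C : MatrixComplex k Q I) (D : MatrixComplex k Q I') (e : ℤ)
    (F : I → I' →₀ Alg k Q) : Prop :=
  ∀ i ∈ C.J, F i ∈ D.cell (C.v i) (C.deg i + e)

theorem rowMap_basis_eq_smul {C : MatrixComplex k Q I} (F : I → I' →₀ Alg k Q) (i : I) :
    rowMap F (C.basis i) = vert k Q (C.v i) • F i := by
  simp [basis, rowMap]

theorem IsMatrix.rowMap_basis {C : MatrixComplex k Q I} {D : MatrixComplex k Q I'} {e : ℤ}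
    {F : I → I' →₀ Alg k Q} (hF : IsMatrix C D e F) {i : I} (hi : i ∈ C.J) :
    rowMap F (C.basis i) = F i := by
  rw [rowMap_basis_eq_smul, (hF i hi).2]

theorem isMatrix_d (C : MatrixComplex k Q I) : IsMatrix C C 1 C.d := fun _ hi => C.d_mem_cell hi

theorem IsMatrix.rowMap_mem {C : MatrixComplex k Q I} {D : MatrixComplex k Q I'} {e : ℤ}
    {F : I → I' →₀ Alg k Q} (hF : IsMatrix C D e F) {n m : ℤ} (h : n + e = m)
    {x : I →₀ Alg k Q} (hx : x ∈ C.piece n) : rowMap F x ∈ D.piece m := by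
  rw [rowMap, Finsupp.linearCombination_apply]
  refine Submodule.sum_mem _ fun i _ => ?_
  by_cases h0 : x i = 0
  · simp [h0]
  · obtain ⟨hi, hd⟩ := (hx i).2 h0
    refine Submodule.smul_mem _ _ ?_
    rw [← h, ← hd]
    exact (hF i hi).1

/-- The maps between the graded pieces given by a matrix. -/
def mapOf {C : MatrixComplex k Q I} {D : MatrixComplex k Q I'} {e : ℤ}
    {F : I → I' →₀ Alg k Q} (hF : IsMatrix C D e F) (n m : ℤ) (h : n + e = m) :
    C.toComplex.X n ⟶ D.toComplex.X m :=
  ModuleCat.ofHom (X := C.piece n) (Y := D.piece m)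
    ((rowMap F).restrict fun _ hx => hF.rowMap_mem h hx)

theorem toComplex_d (C : MatrixComplex k Q I) (n m : ℤ) (h : n + 1 = m) :
    C.toComplex.d n m = mapOf C.isMatrix_d n m h := by
  simp only [toComplex, dif_pos h]
  rfl

/-- Since x i = x i e_{v i}, an element of the degree n part is the combination of the generators
with coefficients x i. This reduces all identities between maps of complexes to generators. -/
theorem eq_of_eq_basis {M : Type*} [AddCommMonoid M] [Module (Alg k Q) M]
    (C : MatrixComplex k Q I) {n : ℤ} {S T : (I →₀ Alg k Q) →ₗ[Alg k Q] M}
    (h : ∀ i ∈ C.J, C.deg i = n → S (C.basis i) = T (C.basis i)) {x : I →₀ Alg k Q}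
    (hx : x ∈ C.piece n) : S x = T x := by
  have h1 : x = ∑ i ∈ x.support, x i • C.basis i := by
    conv_lhs => rw [← Finsupp.sum_single x]
    refine Finset.sum_congr rfl fun i _ => ?_
    rw [basis, Finsupp.smul_single, smul_eq_mul, (hx i).1]
  rw [h1, map_sum, map_sum]
  refine Finset.sum_congr rfl fun i hi => ?_
  obtain ⟨hJ, hd⟩ := (hx i).2 (Finsupp.mem_support_iff.mp hi)
  rw [map_smul, map_smul, h i hJ hd]

/-- The map `φ` between graded pieces is the restriction of the map `S`. -/
def Realizes {C : MatrixComplex k Q I} {D : MatrixComplex k Q I'} {n m : ℤ}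
    (φ : C.toComplex.X n ⟶ D.toComplex.X m)
    (S : (I →₀ Alg k Q) →ₗ[Alg k Q] (I' →₀ Alg k Q)) : Prop :=
  ∀ x : C.piece n, Subtype.val (p := (· ∈ D.piece m)) (φ.hom x) = S x.1

section Realizes

variable {C : MatrixComplex k Q I} {D : MatrixComplex k Q I'} {N : MatrixComplex k Q I''}
  {n m l : ℤ} {φ ψ : C.toComplex.X n ⟶ D.toComplex.X m} {χ : D.toComplex.X m ⟶ N.toComplex.X l}
  {S T : (I →₀ Alg k Q) →ₗ[Alg k Q] (I' →₀ Alg k Q)}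
  {U : (I' →₀ Alg k Q) →ₗ[Alg k Q] (I'' →₀ Alg k Q)}

theorem Realizes.comp (hφ : Realizes φ S) (hχ : Realizes χ U) : Realizes (φ ≫ χ) (U ∘ₗ S) :=
  fun x => (hχ (φ.hom x)).trans (congrArg U (hφ x))

theorem Realizes.add (hφ : Realizes φ S) (hψ : Realizes ψ T) : Realizes (φ + ψ) (S + T) :=
  fun x => congrArg₂ (· + ·) (hφ x) (hψ x)

theorem Realizes.sub (hφ : Realizes φ S) (hψ : Realizes ψ T) : Realizes (φ - ψ) (S - T) :=
  fun x => congrArg₂ (· - ·) (hφ x) (hψ x)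

theorem Realizes.neg (hφ : Realizes φ S) : Realizes (-φ) (-S) :=
  fun x => congrArg (- ·) (hφ x)

theorem Realizes.zero : Realizes (0 : C.toComplex.X n ⟶ D.toComplex.X m) 0 := fun _ => rfl

theorem Realizes.id : Realizes (𝟙 (C.toComplex.X n)) LinearMap.id := fun _ => rfl

theorem realizes_mapOf {e : ℤ} {F : I → I' →₀ Alg k Q} (hF : IsMatrix C D e F) (h : n + e = m) :
    Realizes (mapOf hF n m h) (rowMap F) := fun _ => rfl

theorem realizes_d (h : n + 1 = m) : Realizes (C.toComplex.d n m) (rowMap C.d) := by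
  rw [C.toComplex_d n m h]
  exact realizes_mapOf _ _

theorem realizes_f {f : C.toComplex ⟶ D.toComplex} {F : I → I' →₀ Alg k Q} (hf : IsGivenBy f F)
    (n : ℤ) : Realizes (f.f n) (rowMap F) := hf n

/-- Two maps from the degree `n` part agree if they agree on the generators. -/
theorem Realizes.eq_of_basis (hφ : Realizes φ S) (hψ : Realizes ψ T)
    (h : ∀ i ∈ C.J, C.deg i = n → S (C.basis i) = T (C.basis i)) : φ = ψ :=
  ModuleCat.hom_ext (LinearMap.ext fun x => Subtype.ext
    ((hφ x).trans ((C.eq_of_eq_basis h x.2).trans (hψ x).symm)))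

end Realizes

open CochainComplex in
/-- Gaussian elimination in the mapping cone of a chain map which is given by a matrix `F`. -/
theorem isoInHomotopyCategory_mappingCone_of_elimination
    {B : MatrixComplex k Q I} {D : MatrixComplex k Q I'} {N : MatrixComplex k Q I''}
    (f : B.toComplex ⟶ D.toComplex) {F : I → I' →₀ Alg k Q} (hf : IsGivenBy f F)
    {ιX : I'' → I →₀ Alg k Q} (hιX : IsMatrix N B 1 ιX)
    {πX : I → I'' →₀ Alg k Q} (hπX : IsMatrix B N (-1) πX)
    {ιY : I'' → I' →₀ Alg k Q} (hιY : IsMatrix N D 0 ιY)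
    {πY : I' → I'' →₀ Alg k Q} (hπY : IsMatrix D N 0 πY)
    {r : I' → I →₀ Alg k Q} (hr : IsMatrix D B 0 r)
    (ι_π : ∀ i ∈ N.J, rowMap πX (ιX i) + rowMap πY (ιY i) = N.basis i)
    (πX_ιY : ∀ i ∈ B.J, rowMap ιY (πX i) = 0)
    (πY_ιX : ∀ i ∈ D.J, rowMap ιX (πY i) = 0)
    (ιY_r : ∀ i ∈ N.J, rowMap r (ιY i) = 0) (r_πX : ∀ i ∈ D.J, rowMap πX (r i) = 0)
    (ιX_F_r : ∀ i ∈ N.J, rowMap r (rowMap F (ιX i)) = 0)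
    (projX : ∀ i ∈ B.J, rowMap r (rowMap F (B.basis i - rowMap ιX (πX i))) =
      B.basis i - rowMap ιX (πX i))
    (projY : ∀ i ∈ D.J, rowMap ιY (rowMap πY (D.basis i - rowMap F (r i))) =
      D.basis i - rowMap F (r i))
    (hd : ∀ i ∈ N.J, N.d i = - rowMap πX (rowMap B.d (ιX i)) + rowMap πY (rowMap F (ιX i)) +
      rowMap πY (rowMap D.d (ιY i)) + rowMap πX (rowMap B.d (rowMap r (rowMap D.d (ιY i)))) -
      rowMap πY (rowMap F (rowMap r (rowMap D.d (ιY i))))) :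
    IsoInHomotopyCategory (mappingCone f) N.toComplex := by
  have rιX := fun n m h => realizes_mapOf (n := n) (m := m) hιX h
  have rπX := fun n m h => realizes_mapOf (n := n) (m := m) hπX h
  have rιY := fun n => realizes_mapOf (n := n) hιY (add_zero n)
  have rπY := fun n => realizes_mapOf (n := n) hπY (add_zero n)
  have rr := fun n => realizes_mapOf (n := n) hr (add_zero n)
  have rf := realizes_f hf
  obtain ⟨e⟩ := nonempty_homotopyEquiv_mappingCone (N := N.toComplex) f
    (fun n m h => mapOf hιX n m h) (fun n m h => mapOf hπX m n (by omega))
    (fun n => mapOf hιY n n (add_zero n)) (fun n => mapOf hπY n n (add_zero n))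
    (fun n => mapOf hr n n (add_zero n))
    (fun n m h => (((rιX n m h).comp (rπX _ _ _)).add ((rιY n).comp (rπY n))).eq_of_basis
      Realizes.id fun i hi _ => by
        simpa [hιX.rowMap_basis hi, hιY.rowMap_basis hi] using ι_π i hi)
    (fun n m h => ((rπX _ _ _).comp (rιY n)).eq_of_basis Realizes.zero
      fun i hi _ => by simpa [hπX.rowMap_basis hi] using πX_ιY i hi)
    (fun n m h => ((rπY n).comp (rιX _ _ _)).eq_of_basis Realizes.zero
      fun i hi _ => by simpa [hπY.rowMap_basis hi] using πY_ιX i hi)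
    (fun n => ((rιY n).comp (rr _)).eq_of_basis Realizes.zero
      fun i hi _ => by simpa [hιY.rowMap_basis hi] using ιY_r i hi)
    (fun n m h => ((rr m).comp (rπX _ _ _)).eq_of_basis Realizes.zero
      fun i hi _ => by simpa [hr.rowMap_basis hi] using r_πX i hi)
    (fun n m h => ((rιX _ _ _).comp ((rf m).comp (rr m))).eq_of_basis Realizes.zero
      fun i hi _ => by simpa [hιX.rowMap_basis hi] using ιX_F_r i hi)
    (fun n m h => ((Realizes.id.sub ((rπX _ _ _).comp (rιX _ _ _))).comp
      (Realizes.id.sub ((rf m).comp (rr m)))).eq_of_basis Realizes.zero fun i hi _ => by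
        have := projX i hi
        simp only [LinearMap.comp_apply, LinearMap.sub_apply, LinearMap.id_apply,
          hπX.rowMap_basis hi, LinearMap.zero_apply, this, sub_self])
    (fun n => ((Realizes.id.sub ((rr n).comp (rf n))).comp
      (Realizes.id.sub ((rπY n).comp (rιY n)))).eq_of_basis Realizes.zero fun i hi _ => by
        have := projY i hi
        simp only [LinearMap.comp_apply, LinearMap.sub_apply, LinearMap.id_apply,
          hr.rowMap_basis hi, LinearMap.zero_apply, this, sub_self])
    (fun n m l h h' => by
      have rB := realizes_d (C := B) h'
      have rD := realizes_d (C := D) h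
      refine (realizes_d (C := N) h).eq_of_basis
        ((((((rιX _ _ h).comp (rB.comp (rπX _ _ _))).neg.add
          ((rιX _ _ h).comp ((rf m).comp (rπY m)))).add
          ((rιY n).comp (rD.comp (rπY m)))).add
          ((rιY n).comp (rD.comp ((rr m).comp (rB.comp (rπX _ _ _)))))).sub
          ((rιY n).comp (rD.comp ((rr m).comp ((rf m).comp (rπY m)))))) fun i hi _ => ?_
      simp only [LinearMap.add_apply, LinearMap.sub_apply, LinearMap.neg_apply,
        LinearMap.comp_apply, hιX.rowMap_basis hi, hιY.rowMap_basis hi,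
        N.isMatrix_d.rowMap_basis hi]
      exact hd i hi)
  exact ⟨HomotopyCategory.isoOfHomotopyEquiv e⟩

open CochainComplex in
/-- The mapping cone of a degreewise split monomorphism is the cokernel. -/
theorem isoInHomotopyCategory_mappingCone_of_exact
    {B : MatrixComplex k Q I} {D : MatrixComplex k Q I'} {N : MatrixComplex k Q I''}
    (f : B.toComplex ⟶ D.toComplex) {F : I → I' →₀ Alg k Q} (hf : IsGivenBy f F)
    (hF : IsMatrix B D 0 F) {G : I' → I'' →₀ Alg k Q} (hG : IsMatrix D N 0 G)
    {r : I' → I →₀ Alg k Q} (hr : IsMatrix D B 0 r)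
    (G_comm : ∀ i ∈ D.J, rowMap N.d (G i) = rowMap G (D.d i))
    (F_r : ∀ i ∈ B.J, rowMap r (F i) = B.basis i) (F_G : ∀ i ∈ B.J, rowMap G (F i) = 0)
    (surj : ∀ i ∈ N.J, ∃ y ∈ D.piece (N.deg i), rowMap G y = N.basis i)
    (inj : ∀ n, ∀ y ∈ D.piece n, rowMap G y = 0 → rowMap r y = 0 → y = 0) :
    IsoInHomotopyCategory (mappingCone f) N.toComplex := by
  classical
  have GF : ∀ {n} {x : I →₀ Alg k Q}, x ∈ B.piece n → rowMap G (rowMap F x) = 0 := fun hx =>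
    B.eq_of_eq_basis (S := rowMap G ∘ₗ rowMap F) (T := 0)
      (fun i hi _ => by simpa [hF.rowMap_basis hi] using F_G i hi) hx
  have rF : ∀ {n} {x : I →₀ Alg k Q}, x ∈ B.piece n → rowMap r (rowMap F x) = x := fun hx =>
    B.eq_of_eq_basis (S := rowMap r ∘ₗ rowMap F) (T := LinearMap.id)
      (fun i hi _ => by simpa [hF.rowMap_basis hi] using F_r i hi) hx
  have Gd : ∀ {n} {x : I' →₀ Alg k Q}, x ∈ D.piece n →
      rowMap N.d (rowMap G x) = rowMap G (rowMap D.d x) := fun hx =>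
    D.eq_of_eq_basis (S := rowMap N.d ∘ₗ rowMap G) (T := rowMap G ∘ₗ rowMap D.d)
      (fun i hi _ => by
        simpa [hG.rowMap_basis hi, D.isMatrix_d.rowMap_basis hi] using G_comm i hi) hx
  choose! y hy hGy using surj
  -- A section of G: the lift `y i` is corrected by the image of F so that it lies in the kernel of
  -- r, and multiplied by the idempotent so that it is a possible image of a generator.
  let s : I'' → I' →₀ Alg k Q := fun i => vert k Q (N.v i) • (y i - rowMap F (rowMap r (y i)))
  have hs : IsMatrix N D 0 s := fun i hi => by
    refine ⟨Submodule.smul_mem _ _ (Submodule.sub_mem _ ?_ ?_), ?_⟩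
    · simpa using hy i hi
    · exact hF.rowMap_mem rfl (hr.rowMap_mem (add_zero _) (hy i hi))
    · simp only [s]
      rw [smul_smul, vert_mul_self]
  have Gs : ∀ i ∈ N.J, rowMap G (s i) = N.basis i := fun i hi => by
    have h1 := GF (hr.rowMap_mem (add_zero _) (hy i hi))
    simp only [s, map_smul, map_sub, h1, sub_zero, hGy i hi]
    exact (N.basis_mem_cell hi).2
  have rs : ∀ i ∈ N.J, rowMap r (s i) = 0 := fun i hi => by
    have h1 := rF (hr.rowMap_mem (add_zero _) (hy i hi))
    simp only [s, map_smul, map_sub, h1, sub_self, smul_zero]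
  have Gs' : ∀ {n} {x : I'' →₀ Alg k Q}, x ∈ N.piece n → rowMap G (rowMap s x) = x := fun hx =>
    N.eq_of_eq_basis (S := rowMap G ∘ₗ rowMap s) (T := LinearMap.id)
      (fun i hi _ => by simpa [hs.rowMap_basis hi] using Gs i hi) hx
  have rs' : ∀ {n} {x : I'' →₀ Alg k Q}, x ∈ N.piece n → rowMap r (rowMap s x) = 0 := fun hx =>
    N.eq_of_eq_basis (S := rowMap r ∘ₗ rowMap s) (T := 0)
      (fun i hi _ => by simpa [hs.rowMap_basis hi] using rs i hi) hx
  refine isoInHomotopyCategory_mappingCone_of_elimination f hf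
    (ιX := fun _ => 0) (fun _ _ => zero_mem _) (πX := fun _ => 0) (fun _ _ => zero_mem _)
    hs hG hr ?_ ?_ ?_ ?_ ?_ ?_ ?_ ?_ ?_
  · intro i hi
    simp [Gs i hi]
  · simp
  · intro i _
    simp [rowMap, Finsupp.linearCombination_apply]
  · exact rs
  · intro i _
    simp [rowMap, Finsupp.linearCombination_apply]
  · simp
  · intro i hi
    simp [hF.rowMap_basis hi, F_r i hi]
  · intro i hi
    have hri := hr i hi
    rw [add_zero] at hri
    have hz : D.basis i - rowMap F (r i) ∈ D.piece (D.deg i) :=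
      Submodule.sub_mem _ (D.basis_mem_cell hi).1 (hF.rowMap_mem (add_zero _) hri.1)
    have hGz := hG.rowMap_mem (add_zero _) hz
    have hsGz := hs.rowMap_mem (add_zero _) hGz
    -- For z = e_i - F(r e_i), both s(G z) and z are killed by r and have the same image under G, so
    -- joint injectivity of G and r identifies them.
    refine sub_eq_zero.mp (inj (D.deg i) _ (Submodule.sub_mem _ hsGz hz) ?_ ?_)
    · rw [map_sub, Gs' hGz, sub_self]
    · rw [map_sub, rs' hGz, zero_sub, map_sub, rF hri.1, hr.rowMap_basis hi, sub_self, neg_zero]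
  · intro i hi
    have hsi := hs i hi
    rw [add_zero] at hsi
    have h1 := D.isMatrix_d.rowMap_mem rfl hsi.1
    rw [GF (hr.rowMap_mem (add_zero _) h1), ← Gd hsi.1, Gs i hi, N.isMatrix_d.rowMap_basis hi]
    simp [rowMap, Finsupp.linearCombination_apply]

end MatrixComplex

end Gentle

/-! ### Strands at the vertices of a gentle quiver -/

namespace Gentle

open BoundQuiver

variable {V E : Type u}

namespace BoundQuiver

variable {Q : BoundQuiver V E}

theorem isPath_append {p q : List E} (hp : p ≠ []) (hq : q ≠ []) :
    Q.IsPath (p ++ q) ↔ Q.IsPath p ∧ Q.IsPath q ∧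
      ∀ b ∈ p.getLast?, ∀ a ∈ q.head?, Q.src b = Q.tgt a ∧ ¬ Q.rel b a := by
  simp only [IsPath, List.isChain_append, ne_eq, List.append_eq_nil_iff, hp, hq, not_false_eq_true,
    true_and, and_self]

theorem IsPath.left {p q : List E} (h : Q.IsPath (p ++ q)) (hp : p ≠ []) : Q.IsPath p :=
  ⟨hp, (List.isChain_append.mp h.2).1⟩

theorem IsPath.right {p q : List E} (h : Q.IsPath (p ++ q)) (hq : q ≠ []) : Q.IsPath q :=
  ⟨hq, (List.isChain_append.mp h.2).2.1⟩

/-- The vertex of a half-edge: `(a, true)` is the initial half of the arrow `a`, and `(a, false)` is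
its final half. -/
def pt (Q : BoundQuiver V E) (h : E × Bool) : V := if h.2 then Q.src h.1 else Q.tgt h.1

/-- Two half-edges are the two sides of a nonzero path of length two. -/
def Turn (Q : BoundQuiver V E) : E × Bool → E × Bool → Prop
  | (b, true), (a, false) => Q.src b = Q.tgt a ∧ ¬ Q.rel b a
  | (a, false), (b, true) => Q.src b = Q.tgt a ∧ ¬ Q.rel b a
  | _, _ => False

/-- Two half-edges are equal or are the two sides of a nonzero path of length two. -/
def SameStrand (Q : BoundQuiver V E) (h h' : E × Bool) : Prop := h = h' ∨ Q.Turn h h'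

theorem SameStrand.symm {h h' : E × Bool} (H : Q.SameStrand h h') : Q.SameStrand h' h := by
  obtain H | H := H
  · exact Or.inl H.symm
  · right
    obtain ⟨a, _ | _⟩ := h <;> obtain ⟨b, _ | _⟩ := h' <;> exact H

/-- In a gentle quiver a half-edge has at most one partner with which it forms a nonzero path of
length two, so two turns in succession lead back to the start. A strand at a vertex therefore
consists of at most two half-edges. -/
theorem IsGentle.sameStrand_trans (hQ : Q.IsGentle) {h h' h'' : E × Bool}
    (H : Q.SameStrand h h') (H' : Q.SameStrand h' h'') : Q.SameStrand h h'' := by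
  obtain rfl | H := H
  · exact H'
  obtain rfl | H' := H'
  · exact Or.inr H
  left
  obtain ⟨a, _ | _⟩ := h <;> obtain ⟨b, _ | _⟩ := h' <;> obtain ⟨c, _ | _⟩ := h'' <;>
    simp only [Turn] at H H'
  · rw [hQ.nonrel_right b a c H.1 H'.1 H.2 H'.2]
  · rw [hQ.nonrel_left b a c H.1 H'.1 H.2 H'.2]

end BoundQuiver

namespace Letter

variable {Q : BoundQuiver V E} {x x' y y' : Letter E} {t u v w : V}

@[simp] theorem inv_inv (x : Letter E) : x.inv.inv = x := by simp [inv]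

@[simp] theorem inv_path (x : Letter E) : x.inv.path = x.path := rfl

@[simp] theorem inv_direct (x : Letter E) : x.inv.direct = !x.direct := rfl

theorem elt_inv (x : Letter E) : x.inv.elt = x.elt⁻¹ := by
  cases h : x.direct <;> simp [elt, h]

theorem Joins.inv (h : x.Joins Q u v) : x.inv.Joins Q v u := by
  cases hd : x.direct <;> simpa [Joins, hd] using h

theorem Joins.isPath (h : x.Joins Q u v) : Q.IsPath x.path := by
  unfold Joins at h
  split_ifs at h <;> exact h.1

theorem Joins.path_ne_nil (h : x.Joins Q u v) : x.path ≠ [] := h.isPath.1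

/-- The half-edge at the left end of a letter. -/
def leftEnd (x : Letter E) : Option (E × Bool) :=
  if x.direct then x.path.head?.map (·, false) else x.path.getLast?.map (·, true)

theorem Joins.exists_leftEnd (h : x.Joins Q u v) : ∃ a ∈ x.leftEnd, Q.pt a = u := by
  have hne := h.path_ne_nil
  unfold Joins at h
  split_ifs at h with hd
  · exact ⟨(x.path.head hne, false), by simp [leftEnd, hd, List.head?_eq_some_head hne],
      h.2.2 _ (List.head?_eq_some_head hne)⟩
  · exact ⟨(x.path.getLast hne, true), by simp [leftEnd, hd, List.getLast?_eq_some_getLast hne],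
      h.2.1 _ (List.getLast?_eq_some_getLast hne)⟩

/-- The left ends of two letters are on the same strand of the quiver at a vertex. -/
def SameLeft (Q : BoundQuiver V E) (x y : Letter E) : Prop :=
  ∃ a ∈ x.leftEnd, ∃ b ∈ y.leftEnd, Q.SameStrand a b

/-- The right ends of two letters are on the same strand of the quiver at a vertex. -/
def SameRight (Q : BoundQuiver V E) (x y : Letter E) : Prop := SameLeft Q x.inv y.inv

theorem SameLeft.symm (h : SameLeft Q x y) : SameLeft Q y x := by
  obtain ⟨a, ha, b, hb, hab⟩ := h
  exact ⟨b, hb, a, ha, hab.symm⟩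

theorem SameLeft.trans (hQ : Q.IsGentle) (h : SameLeft Q x y) (h' : SameLeft Q y y') :
    SameLeft Q x y' := by
  obtain ⟨a, ha, b, hb, hab⟩ := h
  obtain ⟨b', hb', c, hc, hbc⟩ := h'
  obtain rfl : b = b' := Option.mem_unique hb hb'
  exact ⟨a, ha, c, hc, hQ.sameStrand_trans hab hbc⟩

theorem Joins.sameLeft (h : x.Joins Q u v) : SameLeft Q x x := by
  obtain ⟨a, ha, -⟩ := h.exists_leftEnd
  exact ⟨a, ha, a, ha, Or.inl rfl⟩

theorem Joins.sameRight (h : x.Joins Q u v) : SameRight Q x x := h.inv.sameLeft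

/-- The letters `x` and `y` are separate letters of a word if the two half-edges where they meet are on
different strands. -/
theorem break_iff (hx : x.Joins Q t u) (hy : y.Joins Q u v) :
    x.Break Q y ↔ ¬ SameLeft Q x.inv y := by
  obtain ⟨a, ha, ha'⟩ := hx.inv.exists_leftEnd
  obtain ⟨b, hb, hb'⟩ := hy.exists_leftEnd
  have h1 : SameLeft Q x.inv y ↔ Q.SameStrand a b := by
    refine ⟨?_, fun h => ⟨a, ha, b, hb, h⟩⟩
    rintro ⟨a', h1, b', h2, h⟩
    rwa [Option.mem_unique ha h1, Option.mem_unique hb h2]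
  rw [h1]
  have h2 : Q.pt a = Q.pt b := ha'.trans hb'.symm
  obtain ⟨p, dx⟩ := x
  obtain ⟨q, dy⟩ := y
  cases dx <;> cases dy <;> simp [leftEnd, inv] at ha hb <;> obtain ⟨a', ha, rfl⟩ := ha <;>
    obtain ⟨b', hb, rfl⟩ := hb <;> simp [pt] at h2 <;>
    simp [Break, SameStrand, Turn, ha, hb, h2]

/-- By `break_iff` a break is the failure of a transitive relation between half-edges, so it is
inherited by letters whose ends are on the same strands. The break conditions of the new words and
the vanishing of products of paths are derived from this. -/
theorem Break.of_same (hQ : Q.IsGentle) (hx : x.Joins Q t u) (hy : y.Joins Q u v)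
    {t' u' v' : V} (hx' : x'.Joins Q t' u') (hy' : y'.Joins Q u' v') (h : x'.Break Q y')
    (hxx : SameRight Q x x') (hyy : SameLeft Q y y') : x.Break Q y := by
  rw [break_iff hx hy]
  rw [break_iff hx' hy'] at h
  exact fun H => h ((hxx.symm.trans hQ H).trans hQ hyy)

theorem Break.inv (hx : x.Joins Q t u) (hy : y.Joins Q u v) (h : x.Break Q y) :
    y.inv.Break Q x.inv := by
  rw [break_iff hx hy] at h
  rw [break_iff hy.inv hx.inv, inv_inv]
  exact fun H => h H.symm

variable (k : Type u) [Field k] [Fintype V]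

theorem Break.mul_eq_zero_of_direct (h : x.Break Q y) (hx : x.direct = true)
    (hy : y.direct = true) : pathElt k Q x.path * pathElt k Q y.path = 0 := by
  simp only [Break, hx, hy] at h
  exact pathElt_mul_pathElt k Q h

theorem Break.mul_eq_zero_of_inverse (h : x.Break Q y) (hx : x.direct = false)
    (hy : y.direct = false) : pathElt k Q y.path * pathElt k Q x.path = 0 := by
  simp only [Break, hx, hy] at h
  exact pathElt_mul_pathElt k Q h

end Letter

theorem pathElt_append (k : Type u) [Field k] [Fintype V] (Q : BoundQuiver V E) (p q : List E) :
    pathElt k Q (p ++ q) = pathElt k Q p * pathElt k Q q := by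
  simp [pathElt]

/-! ### Ends of an overlap and merged letters -/

theorem EndCondition.inv {Q : BoundQuiver V E} {x y : Letter E} {P : Prop} {f : List E}
    (h : EndCondition Q x.path (x.direct = false) P y.path (y.direct = false) f) :
    EndCondition Q x.inv.path (x.inv.direct = true) P y.inv.path (y.inv.direct = true) f := by
  simpa using h

namespace EndCondition

variable {Q : BoundQuiver V E} {x y z : Letter E} {P P' : Prop} {f g : List E} {u v w t : V}

/-- The component `f` of a graph map as an inverse letter. -/
theorem joins_f (h : EndCondition Q x.path (x.direct = true) P y.path (y.direct = true) f)
    (hf : f ≠ []) (hx : x.Joins Q u w) (hy : y.Joins Q v w) : Letter.Joins Q ⟨f, false⟩ v u := by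
  have hxn := hx.path_ne_nil
  have hyn := hy.path_ne_nil
  have hxp := hx.isPath
  have hyp := hy.isPath
  obtain ⟨-, -, h1, h2, h3⟩ | ⟨-, -, h1, h2, h3⟩ | ⟨h, -⟩ := h
  · simp only [Letter.Joins, h1, h2, if_true] at hx hy
    rw [h3] at hxp
    refine ⟨hxp.left hf, fun a ha => ?_, fun a ha => hx.2.2 a (by
      simp [h3, List.head?_append, show f.head? = some a from ha])⟩
    rw [isPath_append hf hyn] at hxp
    have h4 := List.head?_eq_some_head hyn
    rw [(hxp.2.2 a ha _ h4).1, hy.2.2 _ h4]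
  · simp only [Letter.Joins, h1, h2] at hx hy
    rw [h3] at hyp
    refine ⟨hyp.right hf, fun a ha => hy.2.1 a ?_, fun a ha => ?_⟩
    · have ha : f.getLast? = some a := ha
      simp [h3, List.getLast?_append, ha]
    · rw [isPath_append hxn hf] at hyp
      have h4 := List.getLast?_eq_some_getLast hxn
      rw [← (hyp.2.2 _ h4 a ha).1, hx.2.1 _ h4]
  · exact absurd h hf

/-- At the end of an overlap, the adjacent letters are on the same strand. -/
theorem sameRight (h : EndCondition Q x.path (x.direct = true) P y.path (y.direct = true) f)
    (hP : P) (hx : x.Joins Q u w) (hy : y.Joins Q v w) : Letter.SameRight Q y x := by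
  have hxn := hx.path_ne_nil
  have hyn := hy.path_ne_nil
  obtain ⟨a, ha, -⟩ := hx.inv.exists_leftEnd
  obtain ⟨b, hb, -⟩ := hy.inv.exists_leftEnd
  refine ⟨b, hb, a, ha, ?_⟩
  obtain ⟨hf, -, h1, h2, h3⟩ | ⟨hf, -, h1, h2, h3⟩ | ⟨hf, h1, h2⟩ := h
  · left
    simp only [Letter.leftEnd, Letter.inv_direct, Letter.inv_path, h1, h2, h3,
      List.getLast?_append, List.getLast?_eq_some_getLast hyn] at ha hb
    simp at ha hb
    rw [← ha, ← hb]
  · left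
    simp only [Bool.not_eq_true] at h1 h2
    simp only [Letter.leftEnd, Letter.inv_direct, Letter.inv_path, h1, h2, h3,
      List.head?_append, List.head?_eq_some_head hxn] at ha hb
    simp at ha hb
    rw [← ha, ← hb]
  · right
    obtain ⟨h2, h3⟩ := h2 hP
    simp only [Bool.not_eq_true] at h1
    simp only [Letter.leftEnd, Letter.inv_direct, Letter.inv_path, h1, h2,
      List.head?_eq_some_head hxn, List.getLast?_eq_some_getLast hyn] at ha hb
    simp at ha hb
    rw [← ha, ← hb]
    exact ((isPath_append hyn hxn).mp h3).2.2 _ (List.getLast?_eq_some_getLast hyn) _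
      (List.head?_eq_some_head hxn)

/-- The right end of the inverse letter `f` is on the strand of the left end of `x`, up to
inversion. -/
theorem sameRight_f (h : EndCondition Q x.path (x.direct = true) P y.path (y.direct = true) f)
    (hf : f ≠ []) (hx : x.Joins Q u w) (hy : y.Joins Q v w) :
    Letter.SameRight Q ⟨f, false⟩ x.inv := by
  have hxn := hx.path_ne_nil
  have hyn := hy.path_ne_nil
  obtain ⟨a, ha, -⟩ := hx.exists_leftEnd
  refine ⟨(f.head hf, false), by simp [Letter.leftEnd, List.head?_eq_some_head hf], a,
    by simpa using ha, ?_⟩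
  obtain ⟨-, -, h1, h2, h3⟩ | ⟨-, -, h1, h2, h3⟩ | ⟨hf', h1, h2⟩ := h
  · left
    simp [Letter.leftEnd, h1, h3, List.head?_append, List.head?_eq_some_head hf] at ha
    exact ha
  · right
    have hp := hy.isPath
    rw [h3, isPath_append hxn hf] at hp
    simp [Letter.leftEnd, h1, List.getLast?_eq_some_getLast hxn] at ha
    rw [← ha]
    exact hp.2.2 _ (List.getLast?_eq_some_getLast hxn) _ (List.head?_eq_some_head hf)
  · exact absurd hf' hf

/-- If the path of x is f followed in the word by that of y, then the last arrow of f and the first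
arrow of y form a turn; if y has path x f, then f and y have the same last arrow. So f may replace y
in a break at the far end of y. -/
theorem sameLeft_f (h : EndCondition Q x.path (x.direct = true) P y.path (y.direct = true) f)
    (hf : f ≠ []) (hx : x.Joins Q u w) (hy : y.Joins Q v w) :
    Letter.SameLeft Q ⟨f, false⟩ y := by
  have hxn := hx.path_ne_nil
  have hyn := hy.path_ne_nil
  obtain ⟨a, ha, -⟩ := hy.exists_leftEnd
  refine ⟨(f.getLast hf, true), by simp [Letter.leftEnd, List.getLast?_eq_some_getLast hf], a, ha, ?_⟩
  obtain ⟨-, -, h1, h2, h3⟩ | ⟨-, -, h1, h2, h3⟩ | ⟨hf', h1, h2⟩ := h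
  · right
    have hp := hx.isPath
    rw [h3, isPath_append hf hyn] at hp
    simp [Letter.leftEnd, h2, List.head?_eq_some_head hyn] at ha
    rw [← ha]
    exact hp.2.2 _ (List.getLast?_eq_some_getLast hf) _ (List.head?_eq_some_head hyn)
  · left
    simp [Letter.leftEnd, h2, h3, List.getLast?_append, List.getLast?_eq_some_getLast hf] at ha
    exact ha
  · exact absurd hf' hf

end EndCondition

namespace Letter

/-- The product of the letter `y` and the inverse of the letter `x`, where `y` and `x` are adjacent
to the left end of an overlap with component `f`. -/
def merge (x y : Letter E) (f : List E) : Letter E :=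
  if f = [] then ⟨y.path ++ x.path, true⟩ else ⟨f, false⟩

/-- The product of `y`, the inverse of `x` and `z`, where both ends of `x` are ends of an
overlap, with components `f` and `g`. -/
def merge₂ (y z : Letter E) (f g : List E) : Letter E :=
  if g ≠ [] ∧ y.direct = true then ⟨y.path ++ g, true⟩ else ⟨z.path ++ f, false⟩

end Letter

namespace EndCondition

variable {Q : BoundQuiver V E} {x y z : Letter E} {P P' : Prop} {f g : List E} {u v w t : V}

theorem merge_joins (h : EndCondition Q x.path (x.direct = true) P y.path (y.direct = true) f)
    (hP : P) (hx : x.Joins Q u w) (hy : y.Joins Q v w) : (Letter.merge x y f).Joins Q v u := by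
  unfold Letter.merge
  split_ifs with hf
  · have hxn := hx.path_ne_nil
    have hyn := hy.path_ne_nil
    obtain ⟨hf', -⟩ | ⟨hf', -⟩ | ⟨-, h1, h2⟩ := h
    · exact absurd hf hf'
    · exact absurd hf hf'
    obtain ⟨h2, h3⟩ := h2 hP
    simp only [Letter.Joins, h1, h2, if_true] at hx hy
    refine ⟨h3, fun a ha => hx.2.1 a ?_, fun a ha => hy.2.2 a ?_⟩
    · simpa [List.getLast?_append, List.getLast?_eq_some_getLast hxn] using ha
    · simpa [List.head?_append, List.head?_eq_some_head hyn] using ha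
  · exact h.joins_f hf hx hy

/-- For empty f, y is direct and x is inverse, so y x⁻¹ is a product of two direct paths. Otherwise
x and y have the same direction, one path contains the other, and cancelling the common part leaves
f⁻¹. -/
theorem merge_elt (h : EndCondition Q x.path (x.direct = true) P y.path (y.direct = true) f)
    (hP : P) : (Letter.merge x y f).elt = y.elt * x.elt⁻¹ := by
  unfold Letter.merge
  obtain ⟨hf, -, h1, h2, h3⟩ | ⟨hf, -, h1, h2, h3⟩ | ⟨hf, h1, h2⟩ := h
  · simp [Letter.elt, hf, h1, h2, h3]
  · simp [Letter.elt, hf, h1, h2, h3]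
  · simp [Letter.elt, hf, h1, (h2 hP).1]

theorem merge_sameLeft (h : EndCondition Q x.path (x.direct = true) P y.path (y.direct = true) f)
    (hP : P) (hx : x.Joins Q u w) (hy : y.Joins Q v w) :
    Letter.SameLeft Q (Letter.merge x y f) y := by
  unfold Letter.merge
  split_ifs with hf
  · obtain ⟨hf', -⟩ | ⟨hf', -⟩ | ⟨-, h1, h2⟩ := h
    · exact absurd hf hf'
    · exact absurd hf hf'
    have hyn := hy.path_ne_nil
    refine ⟨(y.path.head hyn, false), ?_, (y.path.head hyn, false), ?_, Or.inl rfl⟩ <;>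
      simp [Letter.leftEnd, (h2 hP).1, List.head?_append, List.head?_eq_some_head hyn]
  · exact h.sameLeft_f hf hx hy

theorem merge_sameRight (h : EndCondition Q x.path (x.direct = true) P y.path (y.direct = true) f)
    (hx : x.Joins Q u w) (hy : y.Joins Q v w) :
    Letter.SameRight Q (Letter.merge x y f) x.inv := by
  unfold Letter.merge
  split_ifs with hf
  · obtain ⟨hf', -⟩ | ⟨hf', -⟩ | ⟨-, h1, h2⟩ := h
    · exact absurd hf hf'
    · exact absurd hf hf'
    have hxn := hx.path_ne_nil
    refine ⟨(x.path.getLast hxn, true), ?_, (x.path.getLast hxn, true), ?_, Or.inl rfl⟩ <;>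
      simp [Letter.leftEnd, h1, List.getLast?_append, List.getLast?_eq_some_getLast hxn]
  · exact h.sameRight_f hf hx hy

/-- The only letter x outside the overlap points towards one end of the overlap and away from the
other. Where it points towards the end, the component is nonempty and the letter of τ is a segment
of x; at the other end two of the three cases of the end condition remain. This gives four cases,
and in each of them f or g is nonempty. -/
theorem merge₂_cases
    (hL : EndCondition Q x.path (x.direct = true) P y.path (y.direct = true) f) (hP : P)
    (hR : EndCondition Q x.path (x.direct = false) P' z.path (z.direct = false) g) (hP' : P') :
    (g ≠ [] ∧ y.direct = true ∧ Letter.merge₂ y z f g = ⟨y.path ++ g, true⟩ ∧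
      ((z.direct = true ∧ x.direct = true ∧ f ≠ [] ∧ x.path = f ++ y.path ∧ z.path = x.path ++ g) ∨
       (z.direct = false ∧ x.direct = false ∧ f = [] ∧ x.path = g ++ z.path ∧
        Q.IsPath (y.path ++ x.path)))) ∨
    (f ≠ [] ∧ z.direct = false ∧ Letter.merge₂ y z f g = ⟨z.path ++ f, false⟩ ∧
      ((y.direct = false ∧ x.direct = false ∧ g ≠ [] ∧ x.path = g ++ z.path ∧
        y.path = x.path ++ f) ∨
       (y.direct = true ∧ x.direct = true ∧ g = [] ∧ x.path = f ++ y.path ∧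
        Q.IsPath (z.path ++ x.path)))) := by
  unfold Letter.merge₂
  obtain ⟨hf, -, h1, h2, h3⟩ | ⟨hf, -, h1, h2, h3⟩ | ⟨hf, h1, h2⟩ := hL <;>
    obtain ⟨hg, -, k1, k2, k3⟩ | ⟨hg, -, k1, k2, k3⟩ | ⟨hg, k1, k2⟩ := hR <;>
    simp_all

theorem merge₂_joins
    (hL : EndCondition Q x.path (x.direct = true) P y.path (y.direct = true) f) (hP : P)
    (hR : EndCondition Q x.path (x.direct = false) P' z.path (z.direct = false) g) (hP' : P')
    (hx : x.Joins Q u w) (hy : y.Joins Q v w) (hz : z.Joins Q u t) :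
    (Letter.merge₂ y z f g).Joins Q v t := by
  have hxn := hx.path_ne_nil
  have hyn := hy.path_ne_nil
  have hzn := hz.path_ne_nil
  have hxp := hx.isPath
  have hyp := hy.isPath
  have hzp := hz.isPath
  have hfj := hL.joins_f (hx := hx) (hy := hy)
  have hgj := hR.inv.joins_f (hx := hx.inv) (hy := hz.inv)
  obtain ⟨hg, h1, h2, h3⟩ | ⟨hf, h1, h2, h3⟩ := merge₂_cases hL hP hR hP'
  · rw [h2]
    have hgj := hgj hg
    simp only [Letter.Joins, h1, if_true] at hy hgj ⊢
    refine ⟨?_, fun a ha => hgj.2.1 a ?_, fun a ha => hy.2.2 a ?_⟩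
    -- y g is a path because it is the right part of the path f y g of z, or the left part of the
    -- path y x = y g z.
    · obtain ⟨-, -, hf, h4, h5⟩ | ⟨-, -, -, h4, h5⟩ := h3
      · rw [h5, h4, List.append_assoc] at hzp
        exact hzp.right (by simp [hg])
      · rw [h4, ← List.append_assoc] at h5
        exact h5.left (by simp [hg])
    · simpa [List.getLast?_append, List.getLast?_eq_some_getLast hg] using ha
    · simpa [List.head?_append, List.head?_eq_some_head hyn] using ha
  · rw [h2]
    have hfj := hfj hf
    simp only [Letter.Joins, h1, Bool.false_eq_true, if_false] at hz hfj ⊢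
    refine ⟨?_, fun a ha => hfj.2.1 a ?_, fun a ha => hz.2.2 a ?_⟩
    · obtain ⟨-, -, hf, h4, h5⟩ | ⟨-, -, -, h4, h5⟩ := h3
      · rw [h5, h4, List.append_assoc] at hyp
        exact hyp.right (by simp [hzn])
      · rw [h4, ← List.append_assoc] at h5
        exact h5.left (by simp [hf])
    · simpa [List.getLast?_append, List.getLast?_eq_some_getLast hf] using ha
    · simpa [List.head?_append, List.head?_eq_some_head hzn] using ha

theorem merge₂_elt
    (hL : EndCondition Q x.path (x.direct = true) P y.path (y.direct = true) f) (hP : P)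
    (hR : EndCondition Q x.path (x.direct = false) P' z.path (z.direct = false) g) (hP' : P') :
    (Letter.merge₂ y z f g).elt = y.elt * x.elt⁻¹ * z.elt := by
  obtain ⟨hg, h1, h2, h3⟩ | ⟨hf, h1, h2, h3⟩ := merge₂_cases hL hP hR hP'
  · rw [h2]
    obtain ⟨h6, h7, hf, h4, h5⟩ | ⟨h6, h7, -, h4, h5⟩ := h3
    · simp [Letter.elt, h1, h6, h7, h4, h5]
    · simp [Letter.elt, h1, h6, h7, h4, mul_assoc]
  · rw [h2]
    obtain ⟨h6, h7, hf, h4, h5⟩ | ⟨h6, h7, -, h4, h5⟩ := h3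
    · simp [Letter.elt, h1, h6, h7, h4, h5, mul_assoc]
    · simp [Letter.elt, h1, h6, h7, h4]

theorem merge₂_sameLeft (hQ : Q.IsGentle)
    (hL : EndCondition Q x.path (x.direct = true) P y.path (y.direct = true) f) (hP : P)
    (hR : EndCondition Q x.path (x.direct = false) P' z.path (z.direct = false) g) (hP' : P')
    (hx : x.Joins Q u w) (hy : y.Joins Q v w) :
    Letter.SameLeft Q (Letter.merge₂ y z f g) y := by
  have hyn := hy.path_ne_nil
  obtain ⟨hg, h1, h2, h3⟩ | ⟨hf, h1, h2, h3⟩ := merge₂_cases hL hP hR hP'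
  · rw [h2]
    refine ⟨(y.path.head hyn, false), ?_, (y.path.head hyn, false), ?_, Or.inl rfl⟩ <;>
      simp [Letter.leftEnd, h1, List.head?_append, List.head?_eq_some_head hyn]
  · rw [h2]
    refine Letter.SameLeft.trans hQ ?_ (hL.sameLeft_f hf hx hy)
    refine ⟨(f.getLast hf, true), ?_, (f.getLast hf, true), ?_, Or.inl rfl⟩ <;>
      simp [Letter.leftEnd, List.getLast?_append, List.getLast?_eq_some_getLast hf]

theorem merge₂_sameRight (hQ : Q.IsGentle)
    (hL : EndCondition Q x.path (x.direct = true) P y.path (y.direct = true) f) (hP : P)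
    (hR : EndCondition Q x.path (x.direct = false) P' z.path (z.direct = false) g) (hP' : P')
    (hx : x.Joins Q u w) (hz : z.Joins Q u t) :
    Letter.SameRight Q (Letter.merge₂ y z f g) z := by
  have hzn := hz.path_ne_nil
  obtain ⟨hg, h1, h2, h3⟩ | ⟨hf, h1, h2, h3⟩ := merge₂_cases hL hP hR hP'
  · rw [h2]
    refine Letter.SameLeft.trans hQ ?_ (hR.inv.sameLeft_f hg hx.inv hz.inv)
    refine ⟨(g.getLast hg, true), ?_, (g.getLast hg, true), ?_, Or.inl rfl⟩ <;>
      simp [Letter.leftEnd, List.getLast?_append, List.getLast?_eq_some_getLast hg]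
  · rw [h2]
    refine ⟨(z.path.head hzn, false), ?_, (z.path.head hzn, false), ?_, Or.inl rfl⟩ <;>
      simp [Letter.leftEnd, h1, List.head?_append, List.head?_eq_some_head hzn]

end EndCondition

end Gentle

/-! ### Graph maps between string complexes that agree on one side -/

namespace Gentle

open BoundQuiver MatrixComplex

variable {V E : Type u}

namespace HWord

variable {Q : BoundQuiver V E} (k : Type u) [Field k] [Fintype V] {I I' : Type}

open Classical in
/-- The component of the differential along the letter number `t`, if it is direct. -/
def stepRight (W : HWord Q) (π : ℤ → I) (t : ℤ) : I →₀ Alg k Q :=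
  if t ∈ W.J ∧ t + 1 ∈ W.J ∧ (W.letter t).direct = true then
    Finsupp.single (π (t + 1)) (pathElt k Q (W.letter t).path) else 0

open Classical in
/-- The component of the differential along the letter number `t - 1`, if it is inverse. -/
def stepLeft (W : HWord Q) (π : ℤ → I) (t : ℤ) : I →₀ Alg k Q :=
  if t - 1 ∈ W.J ∧ t ∈ W.J ∧ (W.letter (t - 1)).direct = false then
    Finsupp.single (π (t - 1)) (pathElt k Q (W.letter (t - 1)).path) else 0

variable {k}

theorem row_eq (W : HWord Q) (π : ℤ → I) (scal : ℤ → k) (t : ℤ) :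
    W.row k π scal t = scal t • W.stepRight k π t + W.stepLeft k π t := by
  unfold row stepRight stepLeft
  congr 1
  split_ifs
  · simp
  · simp

theorem rowMap_stepRight (W : HWord Q) (π : ℤ → I) (G : I → I' →₀ Alg k Q) {t : ℤ}
    (h : t ∈ W.J) (h' : t + 1 ∈ W.J) (hd : (W.letter t).direct = true) :
    rowMap G (W.stepRight k π t) = pathElt k Q (W.letter t).path • G (π (t + 1)) := by
  simp [stepRight, h, h', hd, rowMap]

theorem rowMap_stepLeft (W : HWord Q) (π : ℤ → I) (G : I → I' →₀ Alg k Q) {t : ℤ}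
    (h : t - 1 ∈ W.J) (h' : t ∈ W.J) (hd : (W.letter (t - 1)).direct = false) :
    rowMap G (W.stepLeft k π t) = pathElt k Q (W.letter (t - 1)).path • G (π (t - 1)) := by
  simp [stepLeft, h, h', hd, rowMap]

theorem stepRight_eq_zero (W : HWord Q) (π : ℤ → I) {t : ℤ}
    (h : t ∈ W.J → t + 1 ∈ W.J → (W.letter t).direct = false) : W.stepRight k π t = 0 := by
  unfold stepRight
  rw [if_neg]
  rintro ⟨h1, h2, h3⟩
  simp [h h1 h2] at h3

theorem stepLeft_eq_zero (W : HWord Q) (π : ℤ → I) {t : ℤ}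
    (h : t - 1 ∈ W.J → t ∈ W.J → (W.letter (t - 1)).direct = true) : W.stepLeft k π t = 0 := by
  unfold stepLeft
  rw [if_neg]
  rintro ⟨h1, h2, h3⟩
  simp [h h1 h2] at h3

/-- Where two words have the same letter and G sends the neighbouring generator to a generator, G
carries one component of the differential to the other. This handles all positions at which nothing
changes. -/
theorem rowMap_stepRight_congr {W W' : HWord Q} {π : ℤ → I} {π' : ℤ → I'} {t t' : ℤ}
    {G : I → I' →₀ Alg k Q}
    (h : t ∈ W.J ↔ t' ∈ W'.J) (h' : t + 1 ∈ W.J ↔ t' + 1 ∈ W'.J)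
    (hl : t ∈ W.J → t + 1 ∈ W.J → W.letter t = W'.letter t')
    (hπ : t ∈ W.J → t + 1 ∈ W.J →
      G (π (t + 1)) = Finsupp.single (π' (t' + 1)) (vert k Q (W'.v (t' + 1)))) :
    rowMap G (W.stepRight k π t) = W'.stepRight k π' t' := by
  by_cases h1 : t ∈ W.J ∧ t + 1 ∈ W.J
  · obtain ⟨h1, h2⟩ := h1
    by_cases hd : (W.letter t).direct = true
    · rw [rowMap_stepRight W π G h1 h2 hd, hπ h1 h2, stepRight,
        if_pos ⟨h.mp h1, h'.mp h2, hl h1 h2 ▸ hd⟩, hl h1 h2, Finsupp.smul_single, smul_eq_mul,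
        pathElt_mul_vert k Q (W'.path_of_direct (h.mp h1) (h'.mp h2) (hl h1 h2 ▸ hd))]
    · rw [Bool.not_eq_true] at hd
      rw [stepRight_eq_zero W π (fun _ _ => hd), map_zero,
        stepRight_eq_zero W' π' (fun _ _ => hl h1 h2 ▸ hd)]
  · rw [stepRight_eq_zero W π (by tauto), map_zero,
        stepRight_eq_zero W' π' (by rw [← h, ← h']; tauto)]

theorem rowMap_stepLeft_congr {W W' : HWord Q} {π : ℤ → I} {π' : ℤ → I'} {t t' : ℤ}
    {G : I → I' →₀ Alg k Q}
    (h : t - 1 ∈ W.J ↔ t' - 1 ∈ W'.J) (h' : t ∈ W.J ↔ t' ∈ W'.J)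
    (hl : t - 1 ∈ W.J → t ∈ W.J → W.letter (t - 1) = W'.letter (t' - 1))
    (hπ : t - 1 ∈ W.J → t ∈ W.J →
      G (π (t - 1)) = Finsupp.single (π' (t' - 1)) (vert k Q (W'.v (t' - 1)))) :
    rowMap G (W.stepLeft k π t) = W'.stepLeft k π' t' := by
  by_cases h1 : t - 1 ∈ W.J ∧ t ∈ W.J
  · obtain ⟨h1, h2⟩ := h1
    by_cases hd : (W.letter (t - 1)).direct = false
    · have hd' : (W'.letter (t' - 1)).direct = false := hl h1 h2 ▸ hd
      rw [rowMap_stepLeft W π G h1 h2 hd, hπ h1 h2, stepLeft,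
        if_pos ⟨h.mp h1, h'.mp h2, hd'⟩, hl h1 h2, Finsupp.smul_single, smul_eq_mul,
        pathElt_mul_vert k Q (W'.path_of_inverse (h.mp h1) (h'.mp h2) hd')]
    · rw [Bool.not_eq_false] at hd
      rw [stepLeft_eq_zero W π (fun _ _ => hd), map_zero,
        stepLeft_eq_zero W' π' (fun _ _ => hl h1 h2 ▸ hd)]
  · rw [stepLeft_eq_zero W π (by tauto), map_zero,
        stepLeft_eq_zero W' π' (by rw [← h, ← h']; tauto)]

end HWord

open HWord

namespace HString

variable {Q : BoundQuiver V E}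

section AgreeLeft

variable {W W' : HString Q} {x : ℤ} {f : List E}

/-- The hypotheses on the two words for `graphMapLeft`. -/
structure AgreeLeft (W W' : HString Q) (x : ℤ) (f : List E) : Prop where
  mem : ∀ q ≤ x, q ∈ W.J ↔ q ∈ W'.J
  v_eq : ∀ q ≤ x, q ∈ W.J → W.v q = W'.v q
  deg_eq : ∀ q ≤ x, q ∈ W.J → W.deg q = W'.deg q
  letter_eq : ∀ q < x, q ∈ W.J → W.letter q = W'.letter q
  mem_end : x ∈ W.J
  mem_succ : x + 1 ∈ W.J
  cond : EndCondition Q (W.letter x).path ((W.letter x).direct = false) (x + 1 ∈ W'.J)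
    (W'.letter x).path ((W'.letter x).direct = false) f

theorem AgreeLeft.mem_of_ne (H : AgreeLeft W W' x f) (hf : f ≠ []) : x + 1 ∈ W'.J := by
  obtain ⟨-, h, -⟩ | ⟨-, h, -⟩ | ⟨h, -⟩ := H.cond
  · exact h
  · exact h
  · exact absurd h hf

theorem AgreeLeft.joins (H : AgreeLeft W W' x f) : (W.letter x).Joins Q (W.v x) (W.v (x + 1)) :=
  W.joins x H.mem_end H.mem_succ

theorem AgreeLeft.joins' (H : AgreeLeft W W' x f) (h : x + 1 ∈ W'.J) :
    (W'.letter x).Joins Q (W.v x) (W'.v (x + 1)) := by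
  have := W'.joins x ((H.mem x le_rfl).mp H.mem_end) h
  rwa [← H.v_eq x le_rfl H.mem_end] at this

theorem AgreeLeft.joins_f (H : AgreeLeft W W' x f) (hf : f ≠ []) :
    Letter.Joins Q ⟨f, false⟩ (W'.v (x + 1)) (W.v (x + 1)) :=
  H.cond.inv.joins_f hf H.joins.inv (H.joins' (H.mem_of_ne hf)).inv

theorem AgreeLeft.deg_f (H : AgreeLeft W W' x f) (hf : f ≠ []) : W'.deg (x + 1) = W.deg (x + 1) := by
  have h1 := W.deg_succ x H.mem_end H.mem_succ
  have h2 := W'.deg_succ x ((H.mem x le_rfl).mp H.mem_end) (H.mem_of_ne hf)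
  rw [h1, h2, H.deg_eq x le_rfl H.mem_end]
  obtain ⟨-, -, h3, h4, -⟩ | ⟨-, -, h3, h4, -⟩ | ⟨h, -⟩ := H.cond
  · rw [h3, h4]
  · rw [Bool.not_eq_false] at h3 h4
    rw [h3, h4]
  · exact absurd h hf

end AgreeLeft

section AgreeRight

variable {W W' : HString Q} {x e : ℤ} {f : List E}

/-- The hypotheses on the two words for `graphMapRight`. -/
structure AgreeRight (W W' : HString Q) (x e : ℤ) (f : List E) : Prop where
  mem : ∀ q, x ≤ q → (q ∈ W.J ↔ q + e ∈ W'.J)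
  v_eq : ∀ q, x ≤ q → q ∈ W.J → W.v q = W'.v (q + e)
  deg_eq : ∀ q, x ≤ q → q ∈ W.J → W.deg q = W'.deg (q + e)
  letter_eq : ∀ q, x ≤ q → q + 1 ∈ W.J → W.letter q = W'.letter (q + e)
  mem_end : x ∈ W.J
  mem_pred : x - 1 ∈ W.J
  cond : EndCondition Q (W.letter (x - 1)).path ((W.letter (x - 1)).direct = true)
    (x + e - 1 ∈ W'.J) (W'.letter (x + e - 1)).path ((W'.letter (x + e - 1)).direct = true) f

theorem AgreeRight.mem_of_ne (H : AgreeRight W W' x e f) (hf : f ≠ []) : x + e - 1 ∈ W'.J := by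
  obtain ⟨-, h, -⟩ | ⟨-, h, -⟩ | ⟨h, -⟩ := H.cond
  · exact h
  · exact h
  · exact absurd h hf

theorem AgreeRight.joins (H : AgreeRight W W' x e f) :
    (W.letter (x - 1)).Joins Q (W.v (x - 1)) (W.v x) := by
  simpa using W.joins (x - 1) H.mem_pred (by simpa using H.mem_end)

theorem AgreeRight.joins' (H : AgreeRight W W' x e f) (h : x + e - 1 ∈ W'.J) :
    (W'.letter (x + e - 1)).Joins Q (W'.v (x + e - 1)) (W.v x) := by
  have := W'.joins (x + e - 1) h (by simpa using (H.mem x le_rfl).mp H.mem_end)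
  rw [H.v_eq x le_rfl H.mem_end]
  simpa using this

theorem AgreeRight.joins_f (H : AgreeRight W W' x e f) (hf : f ≠ []) :
    Letter.Joins Q ⟨f, false⟩ (W'.v (x + e - 1)) (W.v (x - 1)) :=
  H.cond.joins_f hf H.joins (H.joins' (H.mem_of_ne hf))

theorem AgreeRight.deg_f (H : AgreeRight W W' x e f) (hf : f ≠ []) :
    W'.deg (x + e - 1) = W.deg (x - 1) := by
  have h1 := W.deg_succ (x - 1) H.mem_pred (by simpa using H.mem_end)
  have h2 := W'.deg_succ (x + e - 1) (H.mem_of_ne hf)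
    (by simpa using (H.mem x le_rfl).mp H.mem_end)
  rw [sub_add_cancel] at h1 h2
  rw [H.deg_eq x le_rfl H.mem_end, h2] at h1
  obtain ⟨-, -, h3, h4, -⟩ | ⟨-, -, h3, h4, -⟩ | ⟨h, -⟩ := H.cond
  · rw [h3, h4, if_pos rfl, if_pos rfl] at h1
    omega
  · rw [if_neg h3, if_neg h4] at h1
    omega
  · exact absurd h hf

end AgreeRight

variable (k : Type u) [Field k] [Fintype V]

theorem d_eq (τ : HString Q) (q : ℤ) :
    (τ.matrixComplex k).d q = τ.stepRight k id q + τ.stepLeft k id q := by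
  change τ.row k id (fun _ => 1) q = _
  rw [row_eq, one_smul]

theorem basis_eq (τ : HString Q) (q : ℤ) :
    (τ.matrixComplex k).basis q = Finsupp.single q (vert k Q (τ.v q)) := rfl

open Classical in
/-- The graph map between string complexes of `W` and `W'` which is the identity up to the position
`x`, and has the component `f` at the position `x + 1`. -/
def graphMapLeft (W' : HString Q) (x : ℤ) (f : List E) (q : ℤ) : ℤ →₀ Alg k Q :=
  if q ≤ x then Finsupp.single q (vert k Q (W'.v q)) else
    if q = x + 1 ∧ f ≠ [] then Finsupp.single q (pathElt k Q f) else 0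

open Classical in
/-- The graph map between string complexes of `W` and `W'` which is a shift by `e` from the position
`x` on, and has the component `f` at the position `x - 1`. -/
def graphMapRight (W' : HString Q) (x e : ℤ) (f : List E) (q : ℤ) : ℤ →₀ Alg k Q :=
  if x ≤ q then Finsupp.single (q + e) (vert k Q (W'.v (q + e))) else
    if q = x - 1 ∧ f ≠ [] then Finsupp.single (q + e) (pathElt k Q f) else 0

section GraphMapLeft

variable {W W' : HString Q} {x : ℤ} {f : List E}

theorem graphMapLeft_of_le {q : ℤ} (h : q ≤ x) :
    graphMapLeft k W' x f q = Finsupp.single q (vert k Q (W'.v q)) := if_pos h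

theorem graphMapLeft_of_gt {q : ℤ} (h : x + 1 < q) : graphMapLeft k W' x f q = 0 := by
  rw [graphMapLeft, if_neg (by omega), if_neg (by omega)]

theorem graphMapLeft_add_one (h : f ≠ []) :
    graphMapLeft k W' x f (x + 1) = Finsupp.single (x + 1) (pathElt k Q f) := by
  rw [graphMapLeft, if_neg (by omega), if_pos ⟨rfl, h⟩]

theorem graphMapLeft_add_one_nil : graphMapLeft k W' x ([] : List E) (x + 1) = 0 := by
  rw [graphMapLeft, if_neg (by omega), if_neg (by simp)]

theorem AgreeLeft.isMatrix (H : AgreeLeft W W' x f) :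
    IsMatrix (W.matrixComplex k) (W'.matrixComplex k) 0 (graphMapLeft k W' x f) := by
  intro q hq
  rcases lt_trichotomy q (x + 1) with h | rfl | h
  · rw [graphMapLeft_of_le k (by omega)]
    have h1 := vert_mul_self k Q (W'.v q)
    refine single_mem_cell ((H.mem q (by omega)).mp hq) ?_ ?_ h1
    · change W'.deg q = W.deg q + 0
      rw [H.deg_eq q (by omega) hq, add_zero]
    · change vert k Q (W.v q) * _ = _
      rw [H.v_eq q (by omega) hq, h1]
  · by_cases hf : f = []
    · subst hf
      rw [graphMapLeft_add_one_nil]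
      exact zero_mem _
    · rw [graphMapLeft_add_one k hf]
      refine single_mem_cell (H.mem_of_ne hf) ?_ (vert_mul_pathElt k Q (H.joins_f hf))
        (pathElt_mul_vert k Q (H.joins_f hf))
      change W'.deg (x + 1) = W.deg (x + 1) + 0
      rw [H.deg_f hf, add_zero]
  · rw [graphMapLeft_of_gt k h]
    exact zero_mem _

/-- To the left of x the differentials coincide. Between x and x + 1 the end condition makes the
square with f commute. The possible extra terms are f times the next letter of W', and the next
letter of W times f; both vanish since f is on the strand of the letter that it replaces, and
consecutive letters of a word break. -/
theorem AgreeLeft.comm (H : AgreeLeft W W' x f) (hQ : Q.IsGentle) {q : ℤ} (hq : q ∈ W.J) :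
    rowMap (W'.matrixComplex k).d (graphMapLeft k W' x f q) =
      rowMap (graphMapLeft k W' x f) ((W.matrixComplex k).d q) := by
  have hbas : ∀ q, q ≤ x → q ∈ W.J → rowMap (W'.matrixComplex k).d (graphMapLeft k W' x f q) =
      W'.stepRight k id q + W'.stepLeft k id q := fun q h hq => by
    rw [graphMapLeft_of_le k h, ← basis_eq, (W'.matrixComplex k).isMatrix_d.rowMap_basis
      ((H.mem q h).mp hq), d_eq]
  have hleft : ∀ q, q ≤ x → q ∈ W.J → rowMap (graphMapLeft k W' x f) (W.stepLeft k id q) =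
      W'.stepLeft k id q := fun q h hq => by
    refine rowMap_stepLeft_congr (H.mem _ (by omega)) (H.mem _ h)
      (fun h1 h2 => H.letter_eq _ (by omega) h1) (fun h1 h2 => graphMapLeft_of_le k ?_)
    simp only [id]; omega
  rw [d_eq, map_add]
  rcases lt_trichotomy q x with h | rfl | h
  · rw [hbas q h.le hq, hleft q h.le hq]
    congr 1
    refine (rowMap_stepRight_congr (H.mem _ h.le) (H.mem _ (by omega))
      (fun h1 h2 => H.letter_eq _ (by omega) h1) (fun h1 h2 => graphMapLeft_of_le k ?_)).symm
    simp only [id]; omega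
  · rw [hbas q le_rfl hq, hleft q le_rfl hq]
    congr 1
    -- Both letters point towards x and contribute nothing at x; or both point away and the letter
    -- of W' is that of W followed by f; or f is empty, so the letter of W is sent to zero while
    -- that of W', if present, points towards x.
    obtain ⟨hf, h1, h2, h3, h4⟩ | ⟨hf, h1, h2, h3, h4⟩ | ⟨hf, h2, h3⟩ := H.cond
    · rw [stepRight_eq_zero _ _ (fun _ _ => h3), stepRight_eq_zero _ _ (fun _ _ => h2), map_zero]
    · rw [Bool.not_eq_false] at h2 h3
      rw [rowMap_stepRight _ _ _ hq H.mem_succ h2, id, graphMapLeft_add_one k hf, stepRight,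
        if_pos ⟨(H.mem q le_rfl).mp hq, h1, h3⟩, h4, pathElt_append, Finsupp.smul_single]
      rfl
    · subst hf
      rw [Bool.not_eq_false] at h2
      rw [rowMap_stepRight _ _ _ hq H.mem_succ h2, id, graphMapLeft_add_one_nil, smul_zero,
        stepRight_eq_zero _ _ (fun _ h => (h3 h).1)]
  · have hR : rowMap (graphMapLeft k W' x f) (W.stepRight k id q) = 0 := by
      by_cases h1 : q + 1 ∈ W.J ∧ (W.letter q).direct = true
      · rw [rowMap_stepRight _ _ _ hq h1.1 h1.2, id, graphMapLeft_of_gt k (by omega), smul_zero]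
      · rw [stepRight_eq_zero _ _ (fun _ h2 => by simpa [h2] using h1), map_zero]
    rw [hR, zero_add]
    obtain rfl | h := eq_or_lt_of_le (show x + 1 ≤ q by omega)
    · have hx' : x + 1 - 1 = x := by omega
      have hid : id (x + 1 - 1) = x := hx'
      by_cases hf : f = []
      · subst hf
        rw [graphMapLeft_add_one_nil, map_zero, stepLeft_eq_zero, map_zero]
        intro _ _
        obtain ⟨h1, -⟩ | ⟨h1, -⟩ | ⟨-, h1, -⟩ := H.cond
        · simp at h1
        · simp at h1
        · simpa [hx'] using h1
      have hm := H.mem_of_ne hf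
      have hx := (H.mem x le_rfl).mp H.mem_end
      rw [graphMapLeft_add_one k hf, rowMap, Finsupp.linearCombination_single, d_eq, smul_add]
      -- At position x + 1 of W', f as a direct letter is on the strand of the letter number x of
      -- W', which breaks against the letter number x + 1.
      have h0 : pathElt k Q f • W'.stepRight k id (x + 1) = 0 := by
        by_cases h1 : x + 1 + 1 ∈ W'.J ∧ (W'.letter (x + 1)).direct = true
        · have hb := W'.break' (x + 1) (by simpa) hm h1.1
          rw [hx'] at hb
          have hb' : Letter.Break Q ⟨f, true⟩ (W'.letter (x + 1)) :=
            Letter.Break.of_same hQ (H.joins_f hf).inv (W'.joins _ hm h1.1)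
              (H.joins' hm) (W'.joins _ hm h1.1) hb
              (H.cond.inv.sameLeft_f hf H.joins.inv (H.joins' hm).inv)
              (W'.joins _ hm h1.1).sameLeft
          rw [stepRight, if_pos ⟨hm, h1⟩, Finsupp.smul_single, smul_eq_mul,
            hb'.mul_eq_zero_of_direct k rfl h1.2, Finsupp.single_zero]
        · rw [stepRight_eq_zero _ _ (fun _ h2 => by simpa [h2] using h1), smul_zero]
      rw [h0, zero_add]
      obtain ⟨-, h1, h2, h3, h4⟩ | ⟨-, h1, h2, h3, h4⟩ | ⟨hf', -⟩ := H.cond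
      · rw [rowMap_stepLeft _ _ _ (by simpa using H.mem_end) hq (by simpa [hx'] using h2), hid,
          graphMapLeft_of_le k le_rfl, stepLeft,
          if_pos ⟨by simpa using hx, hm, by simpa [hx'] using h3⟩]
        simp only [hx', id, Finsupp.smul_single, smul_eq_mul]
        rw [h4, pathElt_append, mul_assoc, pathElt_mul_vert k Q (y := W'.v (x + 1))]
        have := W'.path_of_inverse (t := x + 1) (by simpa using hx) hm (by simpa [hx'] using h3)
        simpa [hx'] using this
      · rw [Bool.not_eq_false] at h2 h3
        rw [stepLeft_eq_zero _ _ (fun _ _ => by simpa [hx'] using h3),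
          stepLeft_eq_zero _ _ (fun _ _ => by simpa [hx'] using h2), smul_zero, map_zero]
      · exact absurd hf' hf
    · rw [graphMapLeft_of_gt k h, map_zero]
      by_cases h1 : q - 1 ∈ W.J ∧ (W.letter (q - 1)).direct = false
      · rw [rowMap_stepLeft _ _ _ h1.1 hq h1.2, id]
        -- Only from x + 2 can W still reach x + 1, where f starts; there f is on the strand of the
        -- letter number x of W, so the product vanishes.
        obtain rfl | h := eq_or_lt_of_le (show x + 2 ≤ q by omega)
        · have hx' : x + 2 - 1 = x + 1 := by omega
          rw [hx'] at h1 ⊢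
          by_cases hf : f = []
          · subst hf
            rw [graphMapLeft_add_one_nil, smul_zero]
          rw [graphMapLeft_add_one k hf, Finsupp.smul_single, smul_eq_mul]
          have hj := W.joins _ H.mem_succ (by rwa [add_assoc])
          have hb := W.break' (x + 1) (by simpa using H.mem_end) H.mem_succ (by rwa [add_assoc])
          rw [add_sub_cancel_right] at hb
          have h2 := H.cond.inv.sameRight_f hf H.joins.inv (H.joins' (H.mem_of_ne hf)).inv
          rw [Letter.inv_inv] at h2
          have hb' : Letter.Break Q ⟨f, false⟩ (W.letter (x + 1)) :=
            Letter.Break.of_same hQ (H.joins_f hf) hj H.joins hj hb h2 hj.sameLeft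
          rw [hb'.mul_eq_zero_of_inverse k rfl h1.2, Finsupp.single_zero]
        · rw [graphMapLeft_of_gt k (by omega), smul_zero]
      · rw [stepLeft_eq_zero _ _ (fun h2 _ => by simpa [h2] using h1), map_zero]

end GraphMapLeft

section GraphMapRight

variable {W W' : HString Q} {x e : ℤ} {f : List E}

theorem graphMapRight_of_ge {q : ℤ} (h : x ≤ q) :
    graphMapRight k W' x e f q = Finsupp.single (q + e) (vert k Q (W'.v (q + e))) := if_pos h

theorem graphMapRight_of_lt {q : ℤ} (h : q < x - 1) : graphMapRight k W' x e f q = 0 := by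
  rw [graphMapRight, if_neg (by omega), if_neg (by omega)]

theorem graphMapRight_sub_one (h : f ≠ []) :
    graphMapRight k W' x e f (x - 1) = Finsupp.single (x + e - 1) (pathElt k Q f) := by
  rw [graphMapRight, if_neg (by omega), if_pos ⟨rfl, h⟩, sub_add_eq_add_sub]

theorem graphMapRight_sub_one_nil : graphMapRight k W' x e ([] : List E) (x - 1) = 0 := by
  rw [graphMapRight, if_neg (by omega), if_neg (by simp)]

theorem AgreeRight.isMatrix (H : AgreeRight W W' x e f) :
    IsMatrix (W.matrixComplex k) (W'.matrixComplex k) 0 (graphMapRight k W' x e f) := by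
  intro q hq
  rcases lt_trichotomy q (x - 1) with h | rfl | h
  · rw [graphMapRight_of_lt k h]
    exact zero_mem _
  · by_cases hf : f = []
    · subst hf
      rw [graphMapRight_sub_one_nil]
      exact zero_mem _
    · rw [graphMapRight_sub_one k hf]
      refine single_mem_cell (H.mem_of_ne hf) ?_ (vert_mul_pathElt k Q (H.joins_f hf))
        (pathElt_mul_vert k Q (H.joins_f hf))
      change W'.deg (x + e - 1) = W.deg (x - 1) + 0
      rw [H.deg_f hf, add_zero]
  · rw [graphMapRight_of_ge k (by omega)]
    have h1 := vert_mul_self k Q (W'.v (q + e))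
    refine single_mem_cell ((H.mem q (by omega)).mp hq) ?_ ?_ h1
    · change W'.deg (q + e) = W.deg q + 0
      rw [H.deg_eq q (by omega) hq, add_zero]
    · change vert k Q (W.v q) * _ = _
      rw [H.v_eq q (by omega) hq, h1]

/-- The mirror image of `AgreeLeft.comm`; the shift e only renumbers the positions of W'. -/
theorem AgreeRight.comm (H : AgreeRight W W' x e f) (hQ : Q.IsGentle) {q : ℤ} (hq : q ∈ W.J) :
    rowMap (W'.matrixComplex k).d (graphMapRight k W' x e f q) =
      rowMap (graphMapRight k W' x e f) ((W.matrixComplex k).d q) := by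
  have hbas : ∀ q, x ≤ q → q ∈ W.J →
      rowMap (W'.matrixComplex k).d (graphMapRight k W' x e f q) =
      W'.stepRight k id (q + e) + W'.stepLeft k id (q + e) := fun q h hq => by
    rw [graphMapRight_of_ge k h, ← basis_eq, (W'.matrixComplex k).isMatrix_d.rowMap_basis
      ((H.mem q h).mp hq), d_eq]
  have hright : ∀ q, x ≤ q → q ∈ W.J →
      rowMap (graphMapRight k W' x e f) (W.stepRight k id q) =
      W'.stepRight k id (q + e) := fun q h hq => by
    have h3 : q + e + 1 = q + 1 + e := by ring
    refine rowMap_stepRight_congr (H.mem _ h) (by rw [h3]; exact H.mem _ (by omega))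
      (fun h1 h2 => H.letter_eq _ (by omega) h2) (fun h1 h2 => ?_)
    rw [h3]
    exact graphMapRight_of_ge k (show x ≤ q + 1 by omega)
  have hxe : x + e ∈ W'.J := (H.mem x le_rfl).mp H.mem_end
  rw [d_eq, map_add]
  rcases lt_trichotomy x q with h | rfl | h
  · rw [hbas q h.le hq, hright q h.le hq]
    congr 1
    have h3 : q + e - 1 = q - 1 + e := by ring
    refine (rowMap_stepLeft_congr (by rw [h3]; exact H.mem _ (by omega)) (H.mem _ h.le)
      (fun h1 h2 => by rw [h3]; exact H.letter_eq _ (by omega) (by simpa using h2))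
      (fun h1 h2 => ?_)).symm
    rw [h3]
    exact graphMapRight_of_ge k (show x ≤ q - 1 by omega)
  · rw [hbas x le_rfl hq, hright x le_rfl hq]
    congr 1
    obtain ⟨hf, h1, h2, h3, h4⟩ | ⟨hf, h1, h2, h3, h4⟩ | ⟨hf, h2, h3⟩ := H.cond
    · rw [stepLeft_eq_zero _ _ (fun _ _ => h3), stepLeft_eq_zero _ _ (fun _ _ => h2), map_zero]
    · rw [Bool.not_eq_true] at h2 h3
      rw [rowMap_stepLeft _ _ _ H.mem_pred hq h2, id, graphMapRight_sub_one k hf, stepLeft,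
        if_pos ⟨h1, hxe, h3⟩, h4, pathElt_append, Finsupp.smul_single]
      rfl
    · subst hf
      rw [Bool.not_eq_true] at h2
      rw [rowMap_stepLeft _ _ _ H.mem_pred hq h2, id, graphMapRight_sub_one_nil, smul_zero,
        stepLeft_eq_zero _ _ (fun h _ => (h3 h).1)]
  · have hL : rowMap (graphMapRight k W' x e f) (W.stepLeft k id q) = 0 := by
      by_cases h1 : q - 1 ∈ W.J ∧ (W.letter (q - 1)).direct = false
      · rw [rowMap_stepLeft _ _ _ h1.1 hq h1.2, id, graphMapRight_of_lt k (by omega), smul_zero]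
      · rw [stepLeft_eq_zero _ _ (fun h2 _ => by simpa [h2] using h1), map_zero]
    rw [hL, add_zero]
    obtain rfl | h := eq_or_lt_of_le (show q ≤ x - 1 by omega)
    · have hx' : x - 1 + 1 = x := by omega
      have hid : id (x - 1 + 1) = x := hx'
      by_cases hf : f = []
      · subst hf
        rw [graphMapRight_sub_one_nil, map_zero, stepRight_eq_zero, map_zero]
        intro _ _
        obtain ⟨h1, -⟩ | ⟨h1, -⟩ | ⟨-, h1, -⟩ := H.cond
        · simp at h1
        · simp at h1
        · simpa using h1
      have hm := H.mem_of_ne hf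
      have hx1 : x + e - 1 + 1 = x + e := by omega
      rw [graphMapRight_sub_one k hf, rowMap, Finsupp.linearCombination_single, d_eq, smul_add]
      have h0 : pathElt k Q f • W'.stepLeft k id (x + e - 1) = 0 := by
        by_cases h1 : x + e - 1 - 1 ∈ W'.J ∧ (W'.letter (x + e - 1 - 1)).direct = false
        · have hb := W'.break' (x + e - 1) h1.1 hm (by rwa [hx1])
          have hj := W'.joins _ h1.1 (by rwa [sub_add_cancel])
          rw [sub_add_cancel] at hj
          have hb' : Letter.Break Q (W'.letter (x + e - 1 - 1)) ⟨f, false⟩ :=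
            Letter.Break.of_same hQ hj (H.joins_f hf) hj (H.joins' hm) hb hj.sameRight
              (H.cond.sameLeft_f hf H.joins (H.joins' hm))
          rw [stepLeft, if_pos ⟨h1.1, hm, h1.2⟩, Finsupp.smul_single, smul_eq_mul,
            hb'.mul_eq_zero_of_inverse k h1.2 rfl, Finsupp.single_zero]
        · rw [stepLeft_eq_zero _ _ (fun h2 _ => by simpa [h2] using h1), smul_zero]
      rw [h0, add_zero]
      obtain ⟨-, h1, h2, h3, h4⟩ | ⟨-, h1, h2, h3, h4⟩ | ⟨hf', -⟩ := H.cond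
      · rw [rowMap_stepRight _ _ _ hq (by simpa using H.mem_end) h2, hid,
          graphMapRight_of_ge k le_rfl, stepRight,
          if_pos ⟨hm, by rwa [hx1], h3⟩]
        simp only [hx1, id, Finsupp.smul_single, smul_eq_mul]
        have := W'.path_of_direct (t := x + e - 1) hm (by rwa [hx1]) h3
        rw [hx1] at this
        rw [h4, pathElt_append, mul_assoc, pathElt_mul_vert k Q this]
      · rw [Bool.not_eq_true] at h2 h3
        rw [stepRight_eq_zero _ _ (fun _ _ => h3), stepRight_eq_zero _ _ (fun _ _ => h2),
          smul_zero, map_zero]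
      · exact absurd hf' hf
    · rw [graphMapRight_of_lt k h, map_zero]
      by_cases h1 : q + 1 ∈ W.J ∧ (W.letter q).direct = true
      · rw [rowMap_stepRight _ _ _ hq h1.1 h1.2, id]
        obtain rfl | h := eq_or_lt_of_le (show q ≤ x - 2 by omega)
        · have hx' : x - 2 + 1 = x - 1 := by omega
          rw [hx'] at h1 ⊢
          by_cases hf : f = []
          · subst hf
            rw [graphMapRight_sub_one_nil, smul_zero]
          rw [graphMapRight_sub_one k hf, Finsupp.smul_single, smul_eq_mul]
          have hj := W.joins _ hq (by rw [hx']; exact H.mem_pred)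
          rw [hx'] at hj
          have h3 : x - 1 - 1 = x - 2 := by omega
          have hb := W.break' (x - 1) (by rwa [h3]) H.mem_pred (by simpa using H.mem_end)
          rw [h3] at hb
          have h2 := H.cond.sameRight_f hf H.joins (H.joins' (H.mem_of_ne hf))
          rw [Letter.SameRight, Letter.inv_inv] at h2
          have hb' : Letter.Break Q (W.letter (x - 2)) ⟨f, true⟩ :=
            Letter.Break.of_same hQ hj (H.joins_f hf).inv hj H.joins hb hj.sameRight
              h2
          rw [hb'.mul_eq_zero_of_direct k h1.2 rfl, Finsupp.single_zero]
        · rw [graphMapRight_of_lt k (by omega), smul_zero]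
      · rw [stepRight_eq_zero _ _ (fun _ h2 => by simpa [h2] using h1), map_zero]

end GraphMapRight

end HString

end Gentle

/-! ### Periodicity of the band, parts of a string, and data of an overlap -/

namespace Gentle

open BoundQuiver MatrixComplex HWord

variable {V E : Type u} {Q : BoundQuiver V E}

namespace HWord

theorem length_segment (W : HWord Q) (p : ℤ) (L : ℕ) : (W.segment p L).length = L := by
  simp [segment]

theorem segment_add (W : HWord Q) (p : ℤ) (a b : ℕ) :
    W.segment p (a + b) = W.segment p a ++ W.segment (p + a) b := by
  simp [segment, List.range_add, add_assoc, Function.comp_def]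

theorem segment_congr {W W' : HWord Q} {p p' : ℤ} {L : ℕ}
    (h : ∀ r : ℕ, r < L → W.letter (p + r) = W'.letter (p' + r)) :
    W.segment p L = W'.segment p' L :=
  List.map_congr_left fun r hr => h r (List.mem_range.mp hr)

end HWord

namespace HBand

variable (σ : HBand Q)

theorem mem_J (t : ℤ) : t ∈ σ.J := by simp [σ.J_eq]

theorem joins_letter (t : ℤ) : (σ.letter t).Joins Q (σ.v t) (σ.v (t + 1)) :=
  σ.joins t (σ.mem_J _) (σ.mem_J _)

theorem joins_letter_sub_one (t : ℤ) : (σ.letter (t - 1)).Joins Q (σ.v (t - 1)) (σ.v t) := by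
  simpa using σ.joins_letter (t - 1)

theorem break_letter (t : ℤ) : (σ.letter (t - 1)).Break Q (σ.letter t) :=
  σ.break' t (σ.mem_J _) (σ.mem_J _) (σ.mem_J _)

theorem deg_add_one (t : ℤ) :
    σ.deg (t + 1) = if (σ.letter t).direct then σ.deg t + 1 else σ.deg t - 1 :=
  σ.deg_succ t (σ.mem_J _) (σ.mem_J _)

theorem deg_sub_one (t : ℤ) :
    σ.deg (t - 1) = if (σ.letter (t - 1)).direct then σ.deg t - 1 else σ.deg t + 1 := by
  have := σ.deg_add_one (t - 1)
  rw [sub_add_cancel] at this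
  split_ifs at this ⊢ <;> omega

/-- The degree changes by one along every letter but has period n. As a consequence, neighbouring
positions of the band are never congruent. -/
theorem two_le_n : 2 ≤ σ.n := by
  by_contra h
  have h1 : σ.n = 1 := by have := σ.n_pos; omega
  have h2 := σ.deg_add 0
  have h3 := σ.deg_add_one 0
  rw [h1, Nat.cast_one] at h2
  rw [h2] at h3
  split_ifs at h3 <;> omega

theorem letter_sub (t : ℤ) : σ.letter (t - σ.n) = σ.letter t := by
  rw [← σ.letter_add (t - σ.n), sub_add_cancel]

theorem v_sub (t : ℤ) : σ.v (t - σ.n) = σ.v t := by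
  rw [← σ.v_add (t - σ.n), sub_add_cancel]

theorem deg_sub (t : ℤ) : σ.deg (t - σ.n) = σ.deg t := by
  rw [← σ.deg_add (t - σ.n), sub_add_cancel]

theorem segment_add_n (s : ℤ) (L : ℕ) : σ.segment (s + σ.n) L = σ.segment s L :=
  segment_congr fun r _ => by rw [add_right_comm, σ.letter_add]

theorem segment_add_mul_n (s : ℤ) (m L : ℕ) :
    σ.segment (s + (m * σ.n : ℕ)) L = σ.segment s L := by
  induction m with
  | zero => simp
  | succ m ih =>
    rw [← ih, ← segment_add_n σ (s + (m * σ.n : ℕ))]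
    congr 1
    push_cast
    ring

theorem power_rotation (s : ℤ) (l : ℕ) : power (σ.rotation s) l = σ.segment s (l * σ.n) := by
  induction l with
  | zero => simp [power, HWord.segment]
  | succ l ih =>
    rw [add_mul, one_mul, Nat.add_comm (l * σ.n), segment_add, segment_add_n, ← ih]
    simp [power, List.replicate_succ, rotation]

theorem length_power_rotation (s : ℤ) (l : ℕ) : (power (σ.rotation s) l).length = l * σ.n := by
  rw [power_rotation, length_segment]

theorem cast_add_n (t : ℤ) : ((t + σ.n : ℤ) : ZMod σ.n) = (t : ZMod σ.n) := by simp

theorem cast_eq_iff {t t' : ℤ} (h : t < t' + σ.n) (h' : t' < t + σ.n) :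
    (t : ZMod σ.n) = (t' : ZMod σ.n) ↔ t = t' := by
  refine ⟨fun H => ?_, fun H => by rw [H]⟩
  rw [ZMod.intCast_eq_intCast_iff_dvd_sub] at H
  have := Int.eq_zero_of_abs_lt_dvd H (by rw [abs_lt]; omega)
  omega

/-- Every class of positions has a representative in a given period. -/
theorem exists_cast_eq (s : ℤ) (i : ZMod σ.n) :
    ∃ t : ℤ, s ≤ t ∧ t < s + σ.n ∧ (t : ZMod σ.n) = i := by
  refine ⟨s + ((i - s : ZMod σ.n).val : ℤ), by omega, ?_, by simp⟩
  have := ZMod.val_lt (i - s : ZMod σ.n)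
  omega

variable (k : Type u) [Field k] [Fintype V] (d : ℤ) (lam : kˣ)

theorem v_cast (t : ℤ) : (σ.matrixComplex k d lam).v (t : ZMod σ.n) = σ.v t :=
  σ.periodic _ σ.v_add t

theorem deg_cast (t : ℤ) : (σ.matrixComplex k d lam).deg (t : ZMod σ.n) = σ.deg t :=
  σ.periodic _ σ.deg_add t

theorem basis_cast (t : ℤ) : (σ.matrixComplex k d lam).basis (t : ZMod σ.n) =
    Finsupp.single (t : ZMod σ.n) (vert k Q (σ.v t)) := by
  rw [basis, v_cast]

theorem d_cast (t : ℤ) : (σ.matrixComplex k d lam).d (t : ZMod σ.n) =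
    σ.scal k d lam t • σ.stepRight k (fun i : ℤ => (i : ZMod σ.n)) t +
      σ.stepLeft k (fun i : ℤ => (i : ZMod σ.n)) t := by
  rw [← row_eq]
  exact σ.periodic _ (σ.row_add k d lam) t

end HBand

namespace HString

/-- The part of a string to the left of the position `p`. -/
def leftPart (τ : HString Q) (p : ℤ) (hp : p ∈ τ.J) : HString Q where
  J := {i | i ≤ p ∧ i ∈ τ.J}
  nonempty := ⟨p, le_rfl, hp⟩
  ordConnected := ⟨fun _ hx _ hy _ hz => ⟨hz.2.trans hy.1, τ.ordConnected.out hx.2 hy.2 hz⟩⟩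
  v := τ.v
  deg := τ.deg
  letter := τ.letter
  joins i hi hi' := τ.joins i hi.2 hi'.2
  deg_succ i hi hi' := τ.deg_succ i hi.2 hi'.2
  break' i hi hi' hi'' := τ.break' i hi.2 hi'.2 hi''.2
  left_tail h := τ.left_tail fun h' => h (h'.mono fun _ hi => hi.2)
  right_tail h := absurd ⟨p, fun _ hi => hi.1⟩ h

/-- The part of a string to the right of the position `p`, renumbered such that it starts at `0`. -/
def rightPart (τ : HString Q) (p : ℤ) (hp : p ∈ τ.J) : HString Q where
  J := {i | 0 ≤ i ∧ p + i ∈ τ.J}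
  nonempty := ⟨0, le_rfl, by simpa using hp⟩
  ordConnected := ⟨fun _ hx _ hy _ hz => ⟨hx.1.trans hz.1,
    τ.ordConnected.out hx.2 hy.2 ⟨by linarith [hz.1], by linarith [hz.2]⟩⟩⟩
  v i := τ.v (p + i)
  deg i := τ.deg (p + i)
  letter i := τ.letter (p + i)
  joins i hi hi' := by
    have := τ.joins (p + i) hi.2 (by rw [add_assoc]; exact hi'.2)
    rwa [add_assoc] at this
  deg_succ i hi hi' := by
    have := τ.deg_succ (p + i) hi.2 (by rw [add_assoc]; exact hi'.2)
    rwa [add_assoc] at this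
  break' i hi hi' hi'' := by
    have := τ.break' (p + i) (by rw [add_sub_assoc]; exact hi.2) hi'.2
      (by rw [add_assoc]; exact hi''.2)
    rwa [add_sub_assoc] at this
  left_tail h := absurd ⟨0, fun _ hi => hi.1⟩ h
  right_tail h := by
    obtain ⟨N, hN⟩ := τ.right_tail fun ⟨b, hb⟩ => h ⟨b - p, fun i hi => by
      have := hb hi.2
      omega⟩
    exact ⟨N - p, fun i hi => hN _ (by omega)⟩

theorem isConcat_parts (τ : HString Q) (p p' : ℤ) (hp : p ∈ τ.J) (w : List (Letter E))
    (hp' : p + w.length = p') (h' : p' ∈ τ.J) (hw : τ.segment p w.length = w) :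
    IsConcat τ.toHWord p (τ.leftPart p hp).toHWord w (τ.rightPart p' h').toHWord where
  mem r hr := τ.ordConnected.out hp h' ⟨by omega, by omega⟩
  middle := hw
  left_mem _ := Iff.rfl
  left_v _ _ := rfl
  left_deg _ _ := rfl
  left_letter _ _ _ := rfl
  right_mem i := by rw [hp']; exact Iff.rfl
  right_v i _ := by rw [hp']; rfl
  right_deg i _ := by rw [hp']; rfl
  right_letter i _ _ := by rw [hp']; rfl

end HString

namespace Overlap

variable {σ : HBand Q} {τ : HString Q} (ov : Overlap σ τ)

theorem mem_of {q : ℤ} (h : ov.p ≤ q) (h' : q ≤ ov.p + ov.L) : q ∈ τ.J := by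
  have := ov.mem (q - ov.p).toNat (by omega)
  rwa [show ov.p + ((q - ov.p).toNat : ℤ) = q by omega] at this

theorem v_of {q : ℤ} (h : ov.p ≤ q) (h' : q ≤ ov.p + ov.L) :
    τ.v q = σ.v (ov.s + (q - ov.p)) := by
  have := ov.v_eq (q - ov.p).toNat (by omega)
  rwa [show ((q - ov.p).toNat : ℤ) = q - ov.p by omega, add_sub_cancel] at this

theorem deg_of {q : ℤ} (h : ov.p ≤ q) (h' : q ≤ ov.p + ov.L) :
    τ.deg q = σ.deg (ov.s + (q - ov.p)) := by
  have := ov.deg_eq (q - ov.p).toNat (by omega)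
  rwa [show ((q - ov.p).toNat : ℤ) = q - ov.p by omega, add_sub_cancel] at this

theorem letter_of {q : ℤ} (h : ov.p ≤ q) (h' : q < ov.p + ov.L) :
    τ.letter q = σ.letter (ov.s + (q - ov.p)) := by
  have := ov.letter_eq (q - ov.p).toNat (by omega)
  rwa [show ((q - ov.p).toNat : ℤ) = q - ov.p by omega, add_sub_cancel] at this

theorem mem_p : ov.p ∈ τ.J := ov.mem_of le_rfl (by omega)

theorem v_p : τ.v ov.p = σ.v ov.s := by
  simpa using ov.v_of le_rfl (by omega)

theorem deg_p : τ.deg ov.p = σ.deg ov.s := by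
  simpa using ov.deg_of le_rfl (by omega)

theorem mem_end : ov.p + ov.L ∈ τ.J := ov.mem_of (by omega) le_rfl

theorem v_end : τ.v (ov.p + ov.L) = σ.v (ov.s + ov.L) := ov.v_eq ov.L le_rfl

theorem deg_end : τ.deg (ov.p + ov.L) = σ.deg (ov.s + ov.L) := ov.deg_eq ov.L le_rfl

theorem joins_left (h : ov.p - 1 ∈ τ.J) :
    (τ.letter (ov.p - 1)).Joins Q (τ.v (ov.p - 1)) (σ.v ov.s) := by
  have := τ.joins (ov.p - 1) h (by simpa using ov.mem_p)
  rwa [sub_add_cancel, ov.v_p] at this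

theorem joins_right (h : ov.p + ov.L + 1 ∈ τ.J) :
    (τ.letter (ov.p + ov.L)).Joins Q (σ.v (ov.s + ov.L)) (τ.v (ov.p + ov.L + 1)) := by
  have := τ.joins (ov.p + ov.L) ov.mem_end h
  rwa [ov.v_end] at this

theorem mem_left_of_ne (h : ov.fL ≠ []) : ov.p - 1 ∈ τ.J := by
  obtain ⟨-, h1, -⟩ | ⟨-, h1, -⟩ | ⟨h1, -⟩ := ov.left_end
  · exact h1
  · exact h1
  · exact absurd h1 h

theorem mem_right_of_ne (h : ov.fR ≠ []) : ov.p + ov.L + 1 ∈ τ.J := by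
  obtain ⟨-, h1, -⟩ | ⟨-, h1, -⟩ | ⟨h1, -⟩ := ov.right_end
  · exact h1
  · exact h1
  · exact absurd h1 h

theorem joins_fL (h : ov.fL ≠ []) :
    Letter.Joins Q ⟨ov.fL, false⟩ (τ.v (ov.p - 1)) (σ.v (ov.s - 1)) :=
  ov.left_end.joins_f h (σ.joins_letter_sub_one _) (ov.joins_left (ov.mem_left_of_ne h))

theorem joins_fR (h : ov.fR ≠ []) :
    Letter.Joins Q ⟨ov.fR, false⟩ (τ.v (ov.p + ov.L + 1)) (σ.v (ov.s + ov.L + 1)) :=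
  ov.right_end.inv.joins_f h (σ.joins_letter _).inv (ov.joins_right (ov.mem_right_of_ne h)).inv

theorem deg_fL (h : ov.fL ≠ []) : τ.deg (ov.p - 1) = σ.deg (ov.s - 1) := by
  have h1 := τ.deg_succ (ov.p - 1) (ov.mem_left_of_ne h) (by simpa using ov.mem_p)
  have h2 := σ.deg_add_one (ov.s - 1)
  rw [sub_add_cancel] at h1 h2
  rw [ov.deg_p, h2] at h1
  obtain ⟨-, -, h3, h4, -⟩ | ⟨-, -, h3, h4, -⟩ | ⟨h', -⟩ := ov.left_end
  · rw [h3, h4, if_pos rfl, if_pos rfl] at h1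
    omega
  · rw [if_neg h3, if_neg h4] at h1
    omega
  · exact absurd h' h

theorem deg_fR (h : ov.fR ≠ []) : τ.deg (ov.p + ov.L + 1) = σ.deg (ov.s + ov.L + 1) := by
  have h1 := τ.deg_succ (ov.p + ov.L) ov.mem_end (ov.mem_right_of_ne h)
  have h2 := σ.deg_add_one (ov.s + ov.L)
  rw [h1, h2, ov.deg_end]
  obtain ⟨-, -, h3, h4, -⟩ | ⟨-, -, h3, h4, -⟩ | ⟨h', -⟩ := ov.right_end
  · rw [h3, h4]
  · rw [Bool.not_eq_false] at h3 h4
    rw [h3, h4]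
  · exact absurd h' h

theorem segment_p : τ.segment ov.p ov.L = ov.word :=
  segment_congr fun r hr => ov.letter_eq r hr

theorem length_word : ov.word.length = ov.L := length_segment _ _ _

/-- A sublist of full length is the whole list, so a proper subword is strictly shorter. Only this
inequality of lengths is needed later from properness. -/
theorem L_lt_of_isInfix {l : ℕ} {r : ℤ} (h : ov.word <:+: power (σ.rotation r) l)
    (h' : ov.word ≠ power (σ.rotation r) l) : ov.L < l * σ.n := by
  have h1 := h.length_le
  rw [ov.length_word, σ.length_power_rotation] at h1
  refine lt_of_le_of_ne h1 fun h2 => h' (h.eq_of_length ?_)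
  rw [ov.length_word, σ.length_power_rotation, h2]

section GraphRow

variable {k : Type u} [Field k] [Fintype V]

open Classical in
/-- The components `f_L` and `f_R` of the graph map. -/
def endRow (c : ℤ → kˣ) (i : ZMod σ.n) : ℤ →₀ Alg k Q :=
  (if ov.fL ≠ [] ∧ ((ov.s - 1 : ℤ) : ZMod σ.n) = i then
    (c (ov.s - 1) : k) • Finsupp.single (ov.p - 1) (pathElt k Q ov.fL) else 0) +
  (if ov.fR ≠ [] ∧ ((ov.s + ov.L + 1 : ℤ) : ZMod σ.n) = i then
    (c (ov.s + ov.L + 1) : k) • Finsupp.single (ov.p + ov.L + 1) (pathElt k Q ov.fR) else 0)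

open Classical in
theorem graphRow_eq (c : ℤ → kˣ) (i : ZMod σ.n) : ov.graphRow c i =
    (∑ r ∈ Finset.range (ov.L + 1), if ((ov.s + r : ℤ) : ZMod σ.n) = i then
      (c (ov.s + r) : k) • (τ.matrixComplex k).basis (ov.p + r) else 0) + ov.endRow c i := by
  rw [graphRow, endRow, ← add_assoc]
  simp only [Finsupp.smul_single]
  congr 2
  refine Finset.sum_congr rfl fun r hr => ?_
  rw [HString.basis_eq, Finsupp.smul_single,
    ov.v_eq r (Nat.lt_succ_iff.mp (Finset.mem_range.mp hr))]

theorem isMatrix_graphRow (d : ℤ) (lam : kˣ) (c : ℤ → kˣ) :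
    IsMatrix (σ.matrixComplex k d lam) (τ.matrixComplex k) 0 (ov.graphRow c) := by
  classical
  intro i _
  rw [graphRow_eq, endRow, add_zero]
  refine add_mem (sum_mem fun r hr => ?_) (add_mem ?_ ?_)
  · split_ifs with h
    · subst h
      have hr' : r ≤ ov.L := Nat.lt_succ_iff.mp (Finset.mem_range.mp hr)
      refine smul_mem_cell _ ?_
      rw [HBand.v_cast, HBand.deg_cast, ← ov.v_eq r hr', ← ov.deg_eq r hr']
      exact (τ.matrixComplex k).basis_mem_cell (ov.mem r hr')
    · exact zero_mem _
  · split_ifs with h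
    · obtain ⟨h1, rfl⟩ := h
      have hj := ov.joins_fL h1
      refine smul_mem_cell _ ?_
      rw [HBand.v_cast, HBand.deg_cast]
      exact single_mem_cell (ov.mem_left_of_ne h1) (ov.deg_fL h1) (vert_mul_pathElt k Q hj)
        (pathElt_mul_vert k Q hj)
    · exact zero_mem _
  · split_ifs with h
    · obtain ⟨h1, rfl⟩ := h
      have hj := ov.joins_fR h1
      refine smul_mem_cell _ ?_
      rw [HBand.v_cast, HBand.deg_cast]
      exact single_mem_cell (ov.mem_right_of_ne h1) (ov.deg_fR h1) (vert_mul_pathElt k Q hj)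
        (pathElt_mul_vert k Q hj)
    · exact zero_mem _

end GraphRow

end Overlap

end Gentle

/-! ### Long overlaps: the string with one period removed -/

namespace Gentle

open BoundQuiver MatrixComplex HWord

variable {V E : Type u} {Q : BoundQuiver V E}

open Classical in
/-- The word which is obtained from `τ` by removing the part between the positions `x` and `x + n`,
which have the same vertex and degree. -/
def HString.cut (τ : HString Q) (x n : ℤ) (hn : 0 ≤ n) (hx : x ∈ τ.J) (hx' : x + n ∈ τ.J)
    (hv : τ.v x = τ.v (x + n)) (hdeg : τ.deg x = τ.deg (x + n))
    (hb : x - 1 ∈ τ.J → x + n + 1 ∈ τ.J → (τ.letter (x - 1)).Break Q (τ.letter (x + n))) :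
    HString Q where
  J := {i | if i < x then i ∈ τ.J else i + n ∈ τ.J}
  nonempty := ⟨x, by simpa using hx'⟩
  ordConnected := ⟨by
    intro a ha b hb i hi
    simp only [Set.mem_ofPred_eq] at ha hb ⊢
    have h1 := hi.1
    have h2 := hi.2
    split_ifs with h
    · rw [if_pos (by omega)] at ha
      exact τ.ordConnected.out ha hx ⟨h1, h.le⟩
    · rw [if_neg (by omega)] at hb
      exact τ.ordConnected.out hx' hb ⟨by omega, by omega⟩⟩
  v i := if i < x then τ.v i else τ.v (i + n)
  deg i := if i < x then τ.deg i else τ.deg (i + n)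
  letter i := if i < x then τ.letter i else τ.letter (i + n)
  joins i hi hi' := by
    simp only [Set.mem_ofPred_eq] at hi hi'
    rcases lt_trichotomy (i + 1) x with h | h | h
    · rw [if_pos (by omega)] at hi hi'
      rw [if_pos (by omega), if_pos (by omega), if_pos (by omega)]
      exact τ.joins i hi hi'
    · rw [if_pos (by omega)] at hi
      rw [if_pos (by omega), if_pos (by omega), if_neg (by omega), h, ← hv, ← h]
      exact τ.joins i hi (h ▸ hx)
    · rw [if_neg (by omega)] at hi hi'
      rw [if_neg (by omega), if_neg (by omega), if_neg (by omega), add_right_comm]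
      exact τ.joins (i + n) hi (by rwa [add_right_comm])
  deg_succ i hi hi' := by
    simp only [Set.mem_ofPred_eq] at hi hi'
    rcases lt_trichotomy (i + 1) x with h | h | h
    · rw [if_pos (by omega)] at hi hi'
      simp only [h, show i < x by omega, if_true]
      exact τ.deg_succ i hi hi'
    · rw [if_pos (by omega)] at hi
      simp only [h, show i < x by omega, if_true, lt_irrefl, if_false]
      rw [← hdeg, ← h]
      exact τ.deg_succ i hi (h ▸ hx)
    · rw [if_neg (by omega)] at hi hi'
      simp only [not_lt.mpr h.le, show ¬ i < x by omega, if_false]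
      rw [add_right_comm]
      exact τ.deg_succ (i + n) hi (by rwa [add_right_comm])
  break' i hi hi' hi'' := by
    simp only [Set.mem_ofPred_eq] at hi hi' hi''
    rcases lt_trichotomy i x with h | h | h
    · rw [if_pos (by omega)] at hi hi'
      rw [if_pos (by omega), if_pos (by omega)]
      refine τ.break' i hi hi' ?_
      split_ifs at hi'' with h1
      · exact hi''
      · rwa [show i + 1 = x by omega]
    · rw [if_pos (by omega)] at hi
      rw [if_neg (by omega)] at hi''
      rw [if_pos (by omega), if_neg (by omega)]
      subst h
      exact hb hi (by rwa [add_right_comm])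
    · rw [if_neg (by omega)] at hi hi' hi''
      rw [if_neg (by omega), if_neg (by omega), sub_add_eq_add_sub]
      exact τ.break' (i + n) (by rwa [← sub_add_eq_add_sub]) hi' (by rwa [add_right_comm])
  left_tail h := by
    obtain ⟨N, hN⟩ := τ.left_tail fun ⟨b, hb⟩ => h ⟨min b x, fun i hi => by
      simp only [Set.mem_ofPred_eq] at hi
      split_ifs at hi with h1
      · exact (min_le_left _ _).trans (hb hi)
      · exact (min_le_right _ _).trans (not_lt.mp h1)⟩
    refine ⟨min N x, fun i hi => ?_⟩
    rw [if_pos (by omega)]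
    exact hN i (by omega)
  right_tail h := by
    obtain ⟨N, hN⟩ := τ.right_tail fun ⟨b, hb⟩ => h ⟨max (b - n) x, fun i hi => by
      simp only [Set.mem_ofPred_eq] at hi
      split_ifs at hi with h1
      · exact h1.le.trans (le_max_right _ _)
      · have := hb hi
        exact le_trans (by omega) (le_max_left _ _)⟩
    refine ⟨max N x, fun i hi => ?_⟩
    rw [if_neg (by omega)]
    exact hN _ (by omega)

section Cut

variable {τ : HString Q} {x n : ℤ} {hn : 0 ≤ n} {hx : x ∈ τ.J} {hx' : x + n ∈ τ.J}
  {hv : τ.v x = τ.v (x + n)} {hdeg : τ.deg x = τ.deg (x + n)}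
  {hb : x - 1 ∈ τ.J → x + n + 1 ∈ τ.J → (τ.letter (x - 1)).Break Q (τ.letter (x + n))} {i : ℤ}

theorem HString.mem_cut_of_lt (h : i < x) : i ∈ (τ.cut x n hn hx hx' hv hdeg hb).J ↔ i ∈ τ.J := by
  simp [HString.cut, h]

theorem HString.mem_cut_of_ge (h : x ≤ i) :
    i ∈ (τ.cut x n hn hx hx' hv hdeg hb).J ↔ i + n ∈ τ.J := by
  simp [HString.cut, not_lt.mpr h]

theorem HString.v_cut_of_lt (h : i < x) : (τ.cut x n hn hx hx' hv hdeg hb).v i = τ.v i := if_pos h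

theorem HString.v_cut_of_ge (h : x ≤ i) : (τ.cut x n hn hx hx' hv hdeg hb).v i = τ.v (i + n) :=
  if_neg (not_lt.mpr h)

theorem HString.deg_cut_of_lt (h : i < x) :
    (τ.cut x n hn hx hx' hv hdeg hb).deg i = τ.deg i := if_pos h

theorem HString.deg_cut_of_ge (h : x ≤ i) :
    (τ.cut x n hn hx hx' hv hdeg hb).deg i = τ.deg (i + n) := if_neg (not_lt.mpr h)

theorem HString.letter_cut_of_lt (h : i < x) :
    (τ.cut x n hn hx hx' hv hdeg hb).letter i = τ.letter i := if_pos h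

theorem HString.letter_cut_of_ge (h : x ≤ i) :
    (τ.cut x n hn hx hx' hv hdeg hb).letter i = τ.letter (i + n) := if_neg (not_lt.mpr h)

end Cut

namespace Overlap

variable {σ : HBand Q} {τ : HString Q} (ov : Overlap σ τ)

/-- If L > n, the letter before the cut equals, by periodicity, the last letter of the overlap, and
the break is one of τ. If L = n, the whole overlap disappears and τ_L meets τ_R; these are on the
strands of the letters s - 1 and s of the band, which are consecutive there. -/
theorem break_cut (hQ : Q.IsGentle) (hL : σ.n ≤ ov.L) (h1 : ov.p + ov.L - σ.n - 1 ∈ τ.J)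
    (h2 : ov.p + ov.L + 1 ∈ τ.J) :
    (τ.letter (ov.p + ov.L - σ.n - 1)).Break Q (τ.letter (ov.p + ov.L)) := by
  have hn := σ.two_le_n
  rcases hL.eq_or_lt with h | h
  · have hp : ov.p + ov.L - σ.n = ov.p := by omega
    rw [hp] at h1 ⊢
    have hjL := ov.joins_left h1
    have hjR := ov.joins_right h2
    have hs : σ.v (ov.s + ov.L) = σ.v ov.s := by rw [← h, σ.v_add]
    have hl : σ.letter (ov.s + ov.L) = σ.letter ov.s := by rw [← h, σ.letter_add]
    rw [hs] at hjR
    have e1 := ov.left_end.sameRight h1 (σ.joins_letter_sub_one _) hjL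
    have e2 := ov.right_end.inv.sameRight h2 (σ.joins_letter _).inv (ov.joins_right h2).inv
    rw [Letter.SameRight, Letter.inv_inv, Letter.inv_inv, hl] at e2
    exact Letter.Break.of_same hQ hjL hjR (σ.joins_letter_sub_one _) (σ.joins_letter _)
      (σ.break_letter ov.s) e1 e2
  · have h3 : τ.letter (ov.p + ov.L - σ.n - 1) = τ.letter (ov.p + ov.L - 1) := by
      rw [ov.letter_of (by omega) (by omega), ov.letter_of (by omega) (by omega),
        ← σ.letter_add]
      congr 1
      ring
    rw [h3]
    exact τ.break' _ (ov.mem_of (by omega) (by omega)) ov.mem_end h2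

/-- The string which is obtained from `τ` by removing one period of the band from the overlap. -/
def cutString (hQ : Q.IsGentle) (hL : σ.n ≤ ov.L) : HString Q :=
  τ.cut (ov.p + ov.L - σ.n) σ.n (by omega) (ov.mem_of (by omega) (by omega))
    (by rw [sub_add_cancel]; exact ov.mem_end)
    (by
      rw [sub_add_cancel, ov.v_of (by omega) (by omega), ov.v_end, ← σ.v_sub (ov.s + ov.L)]
      congr 1; ring)
    (by
      rw [sub_add_cancel, ov.deg_of (by omega) (by omega), ov.deg_end, ← σ.deg_sub (ov.s + ov.L)]
      congr 1; ring)
    (by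
      intro h1 h2
      rw [sub_add_cancel] at h2 ⊢
      exact ov.break_cut hQ hL h1 h2)

section CutString

variable (hQ : Q.IsGentle) (hL : σ.n ≤ ov.L)

/-- By periodicity of the overlap it is irrelevant which of its periods is removed: the new string
agrees with τ up to p + L - n, and with τ shifted by n already from p on. The following lemmas give
both descriptions, which are valid together for p ≤ i ≤ p + L - n. -/
theorem mem_cutString_le {i : ℤ} (h : i ≤ ov.p + ov.L - σ.n) :
    i ∈ (ov.cutString hQ hL).J ↔ i ∈ τ.J := by
  rcases h.eq_or_lt with h | h
  · have hn := σ.two_le_n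
    rw [cutString, HString.mem_cut_of_ge h.ge, h, sub_add_cancel]
    simp only [ov.mem_end, ov.mem_of (q := ov.p + ov.L - σ.n) (by omega) (by omega)]
  · exact HString.mem_cut_of_lt h

theorem v_cutString_le {i : ℤ} (h : i ≤ ov.p + ov.L - σ.n) :
    (ov.cutString hQ hL).v i = τ.v i := by
  rcases h.eq_or_lt with h | h
  · rw [cutString, HString.v_cut_of_ge h.ge, h, sub_add_cancel, ov.v_end,
      ov.v_of (by omega) (by omega), ← σ.v_sub (ov.s + ov.L)]
    congr 1; ring
  · exact HString.v_cut_of_lt h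

theorem deg_cutString_le {i : ℤ} (h : i ≤ ov.p + ov.L - σ.n) :
    (ov.cutString hQ hL).deg i = τ.deg i := by
  rcases h.eq_or_lt with h | h
  · rw [cutString, HString.deg_cut_of_ge h.ge, h, sub_add_cancel, ov.deg_end,
      ov.deg_of (by omega) (by omega), ← σ.deg_sub (ov.s + ov.L)]
    congr 1; ring
  · exact HString.deg_cut_of_lt h

theorem mem_cutString_ge {i : ℤ} (h : ov.p ≤ i) :
    i ∈ (ov.cutString hQ hL).J ↔ i + σ.n ∈ τ.J := by
  rcases lt_or_ge i (ov.p + ov.L - σ.n) with h' | h'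
  · rw [cutString, HString.mem_cut_of_lt h']
    simp only [ov.mem_of (q := i) (by omega) (by omega),
      ov.mem_of (q := i + σ.n) (by omega) (by omega)]
  · exact HString.mem_cut_of_ge h'

theorem v_cutString_ge {i : ℤ} (h : ov.p ≤ i) :
    (ov.cutString hQ hL).v i = τ.v (i + σ.n) := by
  rcases lt_or_ge i (ov.p + ov.L - σ.n) with h' | h'
  · rw [cutString, HString.v_cut_of_lt h', ov.v_of (by omega) (by omega),
      ov.v_of (by omega) (by omega), ← σ.v_add]
    congr 1; ring
  · exact HString.v_cut_of_ge h'

theorem deg_cutString_ge {i : ℤ} (h : ov.p ≤ i) :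
    (ov.cutString hQ hL).deg i = τ.deg (i + σ.n) := by
  rcases lt_or_ge i (ov.p + ov.L - σ.n) with h' | h'
  · rw [cutString, HString.deg_cut_of_lt h', ov.deg_of (by omega) (by omega),
      ov.deg_of (by omega) (by omega), ← σ.deg_add]
    congr 1; ring
  · exact HString.deg_cut_of_ge h'

theorem letter_cutString_lt {i : ℤ} (h : i < ov.p + ov.L - σ.n) :
    (ov.cutString hQ hL).letter i = τ.letter i := HString.letter_cut_of_lt h

theorem letter_cutString_ge {i : ℤ} (h : ov.p ≤ i) :
    (ov.cutString hQ hL).letter i = τ.letter (i + σ.n) := by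
  rcases lt_or_ge i (ov.p + ov.L - σ.n) with h' | h'
  · rw [cutString, HString.letter_cut_of_lt h', ov.letter_of (by omega) (by omega),
      ov.letter_of (by omega) (by omega), ← σ.letter_add]
    congr 1; ring
  · exact HString.letter_cut_of_ge h'

/-- After the position p + L - n, τ still follows the band while the new string has τ_R. One period
later this is the right end of the overlap, hence the component f_R. -/
theorem agreeLeft : HString.AgreeLeft τ (ov.cutString hQ hL) (ov.p + ov.L - σ.n) ov.fR where
  mem q h := (ov.mem_cutString_le hQ hL h).symm
  v_eq q h _ := (ov.v_cutString_le hQ hL h).symm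
  deg_eq q h _ := (ov.deg_cutString_le hQ hL h).symm
  letter_eq q h _ := (ov.letter_cutString_lt hQ hL h).symm
  mem_end := ov.mem_of (by omega) (by omega)
  mem_succ := ov.mem_of (by omega) (by have := σ.two_le_n; omega)
  cond := by
    have hn := σ.two_le_n
    rw [ov.mem_cutString_ge hQ hL (by omega), ov.letter_cutString_ge hQ hL (by omega),
      ov.letter_of (by omega) (by omega)]
    have h1 : σ.letter (ov.s + (ov.p + ov.L - σ.n - ov.p)) = σ.letter (ov.s + ov.L) := by
      rw [← σ.letter_add]
      congr 1; ring
    have h2 : ov.p + ov.L - σ.n + 1 + σ.n = ov.p + ov.L + 1 := by ring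
    rw [h1, h2, sub_add_cancel]
    exact ov.right_end

/-- Before the position p + n, τ follows the band while the shifted new string has τ_L. One period
earlier this is the left end of the overlap, hence the component f_L. -/
theorem agreeRight :
    HString.AgreeRight τ (ov.cutString hQ hL) (ov.p + σ.n) (-σ.n) ov.fL where
  mem q h := by rw [ov.mem_cutString_ge hQ hL (by omega), neg_add_cancel_right]
  v_eq q h _ := by rw [ov.v_cutString_ge hQ hL (by omega), neg_add_cancel_right]
  deg_eq q h _ := by rw [ov.deg_cutString_ge hQ hL (by omega), neg_add_cancel_right]
  letter_eq q h _ := by rw [ov.letter_cutString_ge hQ hL (by omega), neg_add_cancel_right]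
  mem_end := ov.mem_of (by omega) (by omega)
  mem_pred := ov.mem_of (by have := σ.two_le_n; omega) (by omega)
  cond := by
    have hn := σ.two_le_n
    have h2 : ov.p + σ.n + -σ.n - 1 = ov.p - 1 := by ring
    rw [h2, ov.mem_cutString_le hQ hL (by omega), ov.letter_cutString_lt hQ hL (by omega),
      ov.letter_of (by omega) (by omega)]
    have h1 : σ.letter (ov.s + (ov.p + σ.n - 1 - ov.p)) = σ.letter (ov.s - 1) := by
      rw [← σ.letter_add (ov.s - 1)]
      congr 1; ring
    rw [h1]
    exact ov.left_end

theorem isConcat_cutString (l : ℕ) (hl : 1 ≤ l) (hl' : l * σ.n ≤ ov.L) (p' : ℤ)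
    (hp' : ov.p + ov.L = p') (h' : p' ∈ τ.J) :
    IsConcat (ov.cutString hQ hL).toHWord ov.p (τ.leftPart ov.p ov.mem_p).toHWord
      (power (σ.rotation ov.s) (l - 1) ++ σ.segment ov.s (ov.L - l * σ.n))
      (τ.rightPart p' h').toHWord := by
  subst hp'
  have hn := σ.two_le_n
  -- The middle of the new word consists of the first L - n letters of ρ, whichever power l is split
  -- off.
  have hlen : (power (σ.rotation ov.s) (l - 1) ++ σ.segment ov.s (ov.L - l * σ.n)) =
      σ.segment ov.s (ov.L - σ.n) := by
    obtain ⟨m, rfl⟩ : ∃ m, l = m + 1 := ⟨l - 1, by omega⟩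
    have h1 : ov.L - σ.n = m * σ.n + (ov.L - (m + 1) * σ.n) := by
      rw [add_mul, one_mul] at hl' ⊢
      omega
    rw [h1, segment_add, add_tsub_cancel_right, HBand.power_rotation]
    rw [HBand.segment_add_mul_n]
  rw [hlen]
  have h0 : (σ.segment ov.s (ov.L - σ.n)).length = ov.L - σ.n := length_segment _ _ _
  have h1 : ov.p + ((ov.L - σ.n : ℕ) : ℤ) = ov.p + ov.L - σ.n := by omega
  constructor
  · intro r hr
    rw [h0] at hr
    rw [ov.mem_cutString_le hQ hL (by omega)]
    exact ov.mem r (by omega)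
  · rw [h0]
    refine segment_congr fun r hr => ?_
    rw [ov.letter_cutString_lt hQ hL (by omega)]
    exact ov.letter_eq r (by omega)
  · intro i
    change i ≤ ov.p ∧ i ∈ τ.J ↔ _
    refine and_congr_right fun h => ?_
    rw [ov.mem_cutString_le hQ hL (by omega)]
  · intro i hi
    exact ov.v_cutString_le hQ hL (by have : i ≤ ov.p := hi.1; omega)
  · intro i hi
    exact ov.deg_cutString_le hQ hL (by have : i ≤ ov.p := hi.1; omega)
  · intro i hi hi'
    exact ov.letter_cutString_lt hQ hL (by have : i + 1 ≤ ov.p := hi'.1; omega)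
  · intro i
    change 0 ≤ i ∧ ov.p + ov.L + i ∈ τ.J ↔ _
    refine and_congr_right fun h => ?_
    rw [h0, h1, ov.mem_cutString_ge hQ hL (by omega)]
    have : ov.p + ov.L - σ.n + i + σ.n = ov.p + ov.L + i := by ring
    rw [this]
  · intro i hi
    have : 0 ≤ i := hi.1
    rw [h0, h1, ov.v_cutString_ge hQ hL (by omega)]
    change _ = τ.v (ov.p + ov.L + i)
    congr 1; ring
  · intro i hi
    have : 0 ≤ i := hi.1
    rw [h0, h1, ov.deg_cutString_ge hQ hL (by omega)]
    change _ = τ.deg (ov.p + ov.L + i)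
    congr 1; ring
  · intro i hi _
    have : 0 ≤ i := hi.1
    rw [h0, h1, ov.letter_cutString_ge hQ hL (by omega)]
    change _ = τ.letter (ov.p + ov.L + i)
    congr 1; ring

end CutString

end Overlap

end Gentle

/-! ### Long overlaps: the cokernel of the graph map -/

namespace Gentle

open BoundQuiver MatrixComplex HWord

variable {V E : Type u} {Q : BoundQuiver V E}

namespace HBand

variable {σ : HBand Q} {k : Type u} [Field k]

theorem scal_add (d : ℤ) (lam : kˣ) (t : ℤ) : σ.scal k d lam (t + σ.n) = σ.scal k d lam t := by
  simp [scal]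

end HBand

namespace Overlap

variable {σ : HBand Q} {τ : HString Q} (ov : Overlap σ τ) {k : Type u} [Field k]

theorem IsBalanced.of_direct {d : ℤ} {lam : kˣ} {c : ℤ → kˣ} (hc : IsBalanced σ d lam c) {t : ℤ}
    (ht : (σ.letter t).direct = true) : (c t : k) = σ.scal k d lam t * c (t + 1) := by
  have := hc t
  rwa [if_pos ht] at this

theorem IsBalanced.of_inverse {d : ℤ} {lam : kˣ} {c : ℤ → kˣ} (hc : IsBalanced σ d lam c) {t : ℤ}
    (ht : (σ.letter t).direct = false) : c (t + 1) = c t := by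
  have := hc t
  rwa [if_neg (by simp [ht])] at this

/-- The scalars of a graph map are multiplied by a constant factor along a period of the band. -/
theorem IsBalanced.exists_monodromy {d : ℤ} {lam : kˣ} {c : ℤ → kˣ} (hc : IsBalanced σ d lam c) :
    ∃ κ : kˣ, ∀ t, c (t + σ.n) = κ * c t := by
  -- The quotient of c (t + 1) by c t depends only on the letter t and on its scalar, so it has
  -- period n; hence c (t + n) / c t is constant.
  have h1 : ∀ t, c (t + 1 + σ.n) * c t = c (t + σ.n) * c (t + 1) := by
    intro t
    rw [add_right_comm]
    by_cases hd : (σ.letter t).direct = true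
    · have e1 := hc.of_direct hd
      have e2 := hc.of_direct (t := t + σ.n) (by rwa [σ.letter_add])
      ext
      push_cast
      rw [e1, e2, σ.scal_add]
      ring
    · rw [Bool.not_eq_true] at hd
      rw [hc.of_inverse hd, hc.of_inverse (t := t + σ.n) (by rwa [σ.letter_add])]
  have h2 : ∀ t, c (t + 1 + σ.n) * (c (t + 1))⁻¹ = c (t + σ.n) * (c t)⁻¹ := by
    intro t
    rw [mul_inv_eq_iff_eq_mul, mul_assoc, mul_comm (c t)⁻¹, ← mul_assoc, ← h1, mul_inv_cancel_right]
  have h3 : ∀ t, c (t + σ.n) * (c t)⁻¹ = c (0 + σ.n) * (c 0)⁻¹ := by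
    intro t
    induction t using Int.induction_on with
    | zero => rfl
    | succ i ih => rw [h2, ih]
    | pred i ih =>
      rw [← ih, ← h2 (-i - 1), sub_add_cancel]
  exact ⟨c (0 + σ.n) * (c 0)⁻¹, fun t => by rw [← h3 t, inv_mul_cancel_right]⟩

variable [Fintype V]

open Classical in
/-- The inverse of the graph map on one copy of the band in the overlap. -/
def retraction (c : ℤ → kˣ) (N : ℤ) (q : ℤ) : ZMod σ.n →₀ Alg k Q :=
  if ov.p ≤ q ∧ q < ov.p + N then
    ((c (ov.s + (q - ov.p)))⁻¹ : kˣ) • Finsupp.single ((ov.s + (q - ov.p) : ℤ) : ZMod σ.n)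
      (vert k Q (σ.v (ov.s + (q - ov.p)))) else 0

theorem isMatrix_retraction (d : ℤ) (lam : kˣ) (c : ℤ → kˣ) {N : ℤ} (hN : N ≤ ov.L + 1) :
    IsMatrix (τ.matrixComplex k) (σ.matrixComplex k d lam) 0 (ov.retraction c N) := by
  intro q _
  unfold retraction
  split_ifs with h
  · rw [Units.smul_def]
    refine smul_mem_cell _ ?_
    change _ ∈ cell _ (τ.v q) (τ.deg q + 0)
    rw [ov.v_of h.1 (by omega), ov.deg_of h.1 (by omega), add_zero]
    refine single_mem_cell (Set.mem_univ _) (HBand.deg_cast _ _ _ _ _) (vert_mul_self k Q _) ?_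
    rw [HBand.v_cast, vert_mul_self]
  · exact zero_mem _

theorem retraction_of_lt (c : ℤ → kˣ) (N : ℤ) {q : ℤ} (h : q < ov.p) :
    ov.retraction c N q = 0 := if_neg (by omega)

theorem retraction_of_ge (c : ℤ → kˣ) (N : ℤ) {q : ℤ} (h : ov.p + N ≤ q) :
    ov.retraction c N q = 0 := if_neg (by omega)

/-- The retraction is a left inverse of the graph map on a class of positions which has exactly one
representative in the window. -/
theorem rowMap_retraction_graphRow (d : ℤ) (lam : kˣ) (c : ℤ → kˣ) {N : ℕ} (hN : N ≤ σ.n)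
    (hN' : N ≤ ov.L + 1) {r : ℕ} (hr : r < N) :
    rowMap (ov.retraction c N) (ov.graphRow c ((ov.s + r : ℤ) : ZMod σ.n)) =
      (σ.matrixComplex k d lam).basis ((ov.s + r : ℤ) : ZMod σ.n) := by
  classical
  have hret := ov.isMatrix_retraction d lam c (k := k) (N := N) (by omega)
  have hend : rowMap (ov.retraction c N) (ov.endRow c ((ov.s + r : ℤ) : ZMod σ.n)) = 0 := by
    rw [endRow, map_add]
    have h1 : ov.retraction (k := k) c N (ov.p - 1) = 0 := retraction_of_lt _ _ _ (by omega)
    have h2 : ov.retraction (k := k) c N (ov.p + ov.L + 1) = 0 := retraction_of_ge _ _ _ (by omega)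
    split_ifs <;> simp [rowMap, h1, h2]
  rw [graphRow_eq, map_add, hend, add_zero, map_sum, Finset.sum_eq_single r]
  · rw [if_pos rfl, LinearMap.map_smul_of_tower,
      hret.rowMap_basis (ov.mem r (by omega)), retraction,
      if_pos ⟨by omega, by omega⟩, add_sub_cancel_left, Units.smul_def, smul_smul, HBand.basis_cast]
    simp
  · intro r' _ hne
    -- A window of N ≤ n positions contains no second representative of the class, so any other r'
    -- in the class lies beyond it, where the retraction is zero.
    split_ifs with h
    · have h1 : N ≤ r' := by
        by_contra h1
        rw [σ.cast_eq_iff (by omega) (by omega)] at h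
        omega
      rw [LinearMap.map_smul_of_tower, rowMap_basis_eq_smul, retraction_of_ge _ _ _ (by omega),
        smul_zero, smul_zero]
    · exact map_zero _
  · intro h
    exact absurd (Finset.mem_range.mpr (by omega)) h

section Cokernel

variable (hQ : Q.IsGentle) (hL : σ.n ≤ ov.L)

/-- The two graph maps from `P_τ` to the string complex without one period, whose difference is the
cokernel of the graph map from the band. -/
def cokerRow (κ : kˣ) (q : ℤ) : ℤ →₀ Alg k Q :=
  HString.graphMapRight k (ov.cutString hQ hL) (ov.p + σ.n) (-σ.n) ov.fL q -
    (κ : k) • HString.graphMapLeft k (ov.cutString hQ hL) (ov.p + ov.L - σ.n) ov.fR q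

theorem isMatrix_cokerRow (κ : kˣ) :
    IsMatrix (τ.matrixComplex k) ((ov.cutString hQ hL).matrixComplex k) 0
      (ov.cokerRow hQ hL κ) := fun q hq =>
  sub_mem ((ov.agreeRight hQ hL).isMatrix k q hq)
    (smul_mem_cell _ ((ov.agreeLeft hQ hL).isMatrix k q hq))

theorem rowMap_sub_smul {I I' : Type} (F G : I → I' →₀ Alg k Q) (a : k) (x : I →₀ Alg k Q) :
    rowMap (fun i => F i - a • G i) x = rowMap F x - a • rowMap G x := by
  simp only [rowMap, Finsupp.linearCombination_apply, Finsupp.sum, Finset.smul_sum, smul_sub,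
    Finset.sum_sub_distrib]
  congr 1
  exact Finset.sum_congr rfl fun i _ => smul_comm _ _ _

theorem cokerRow_comm (κ : kˣ) {q : ℤ} (hq : q ∈ τ.J) :
    rowMap ((ov.cutString hQ hL).matrixComplex k).d (ov.cokerRow hQ hL κ q) =
      rowMap (ov.cokerRow hQ hL κ) ((τ.matrixComplex k).d q) := by
  unfold cokerRow
  rw [rowMap_sub_smul, map_sub, LinearMap.map_smul_of_tower,
    (ov.agreeRight hQ hL).comm k hQ hq, (ov.agreeLeft hQ hL).comm k hQ hq]

theorem cokerRow_of_lt (κ : kˣ) {q : ℤ} (h : q < ov.p) : ov.cokerRow hQ hL κ q =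
    - (κ : k) • ((ov.cutString hQ hL).matrixComplex k).basis q := by
  have := σ.two_le_n
  rw [cokerRow, HString.graphMapRight_of_lt k (by omega), HString.graphMapLeft_of_le k (by omega),
    zero_sub, HString.basis_eq, neg_smul]

theorem cokerRow_of_ge (κ : kˣ) {q : ℤ} (h : ov.p + σ.n ≤ q) : ov.cokerRow hQ hL κ q =
    ((ov.cutString hQ hL).matrixComplex k).basis (q - σ.n) -
    (κ : k) • HString.graphMapLeft k (ov.cutString hQ hL) (ov.p + ov.L - σ.n) ov.fR q := by
  rw [cokerRow, HString.graphMapRight_of_ge k h, HString.basis_eq, ← sub_eq_add_neg]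

theorem graphMapLeft_apply_of_ne {W' : HString Q} {x : ℤ} {f : List E} {q j : ℤ} (h : j ≠ q) :
    HString.graphMapLeft k W' x f q j = 0 := by
  unfold HString.graphMapLeft
  split_ifs <;> simp [h]

/-- The shift moves the copy of a band position at r + n to r with coefficient c (s + r + n) = κ c
(s + r), which is what κ times the identity gives at r. The surplus at the two ends is the component
f_L of the shift and the component f_R of the identity; these cancel against the images of the
components f_L and f_R of the graph map itself. -/
theorem rowMap_cokerRow_graphRow {c : ℤ → kˣ} {κ : kˣ}
    (hκ : ∀ t, c (t + σ.n) = κ * c t) (i : ZMod σ.n) :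
    rowMap (ov.cokerRow hQ hL κ) (ov.graphRow (k := k) c i) = 0 := by
  classical
  have hn := σ.two_le_n
  have hG := ov.isMatrix_cokerRow (k := k) hQ hL κ
  obtain ⟨M, hM⟩ : ∃ M, ov.L = σ.n + M := ⟨ov.L - σ.n, by omega⟩
  set C := ov.cutString hQ hL with hC
  set gR := HString.graphMapRight k C (ov.p + σ.n) (-σ.n) ov.fL with hgR
  set gL := HString.graphMapLeft k C (ov.p + ov.L - σ.n) ov.fR with hgL
  have hsum : rowMap (ov.cokerRow hQ hL κ) (∑ r ∈ Finset.range (ov.L + 1),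
      if ((ov.s + r : ℤ) : ZMod σ.n) = i then
        (c (ov.s + r) : k) • (τ.matrixComplex k).basis (ov.p + r) else 0) =
      (∑ r ∈ Finset.range (ov.L + 1), if ((ov.s + r : ℤ) : ZMod σ.n) = i then
        (c (ov.s + r) : k) • gR (ov.p + r) else 0) -
      (κ : k) • (∑ r ∈ Finset.range (ov.L + 1), if ((ov.s + r : ℤ) : ZMod σ.n) = i then
        (c (ov.s + r) : k) • gL (ov.p + r) else 0) := by
    rw [map_sum, Finset.smul_sum, ← Finset.sum_sub_distrib]
    refine Finset.sum_congr rfl fun r hr => ?_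
    split_ifs
    · rw [LinearMap.map_smul_of_tower, hG.rowMap_basis
        (ov.mem r (Nat.lt_succ_iff.mp (Finset.mem_range.mp hr))), cokerRow, smul_sub,
        smul_comm (κ : k)]
    · simp
  have hR : (∑ r ∈ Finset.range (ov.L + 1), if ((ov.s + r : ℤ) : ZMod σ.n) = i then
        (c (ov.s + r) : k) • gR (ov.p + r) else 0) =
      (if ((ov.s - 1 : ℤ) : ZMod σ.n) = i then
        (κ * c (ov.s - 1) : k) • gR (ov.p + σ.n - 1) else 0) +
      ∑ r ∈ Finset.range (M + 1), if ((ov.s + r : ℤ) : ZMod σ.n) = i then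
        (κ * c (ov.s + r) : k) • (C.matrixComplex k).basis (ov.p + r) else 0 := by
    -- The shift kills the first n - 1 positions of the overlap, has the component f_L at the next
    -- one, and moves the last M + 1 positions back by n.
    obtain ⟨N, hN⟩ : ∃ N, σ.n = N + 1 := ⟨σ.n - 1, by omega⟩
    rw [show ov.L + 1 = N + 1 + (M + 1) by omega, Finset.sum_range_add, Finset.sum_range_succ,
      Finset.sum_eq_zero, zero_add]
    · congr 1
      · have e1 : ov.s + N = ov.s - 1 + σ.n := by omega
        have e2 : ov.p + N = ov.p + σ.n - 1 := by omega
        rw [e1, e2, σ.cast_add_n, hκ, Units.val_mul]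
      · refine Finset.sum_congr rfl fun r hr => ?_
        have e1 : ov.s + (N + 1 + r : ℕ) = ov.s + r + σ.n := by omega
        rw [e1, σ.cast_add_n, hκ, Units.val_mul]
        rw [hgR, HString.graphMapRight_of_ge k (by omega), HString.basis_eq]
        have e2 : ov.p + (N + 1 + r : ℕ) + -(σ.n : ℤ) = ov.p + r := by omega
        rw [e2]
    · intro r hr
      have := Finset.mem_range.mp hr
      rw [hgR, HString.graphMapRight_of_lt k (by omega)]
      simp
  have hLsum : (∑ r ∈ Finset.range (ov.L + 1), if ((ov.s + r : ℤ) : ZMod σ.n) = i then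
        (c (ov.s + r) : k) • gL (ov.p + r) else 0) =
      (∑ r ∈ Finset.range (M + 1), if ((ov.s + r : ℤ) : ZMod σ.n) = i then
        (c (ov.s + r) : k) • (C.matrixComplex k).basis (ov.p + r) else 0) +
      (if ((ov.s + M + 1 : ℤ) : ZMod σ.n) = i then
        (c (ov.s + M + 1) : k) • gL (ov.p + ov.L - σ.n + 1) else 0) := by
    -- Here the first M + 1 positions are kept, the next one carries f_R, and the last n - 1
    -- positions are killed.
    obtain ⟨N, hN⟩ : ∃ N, σ.n = N + 1 := ⟨σ.n - 1, by omega⟩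
    rw [show ov.L + 1 = M + 1 + 1 + N by omega, Finset.sum_range_add, Finset.sum_range_succ,
      (Finset.sum_eq_zero (s := Finset.range N)), add_zero]
    · congr 1
      · refine Finset.sum_congr rfl fun r hr => ?_
        have := Finset.mem_range.mp hr
        rw [hgL, HString.graphMapLeft_of_le k (by omega), HString.basis_eq]
      · have e1 : ov.s + (M + 1 : ℕ) = ov.s + M + 1 := by omega
        have e2 : ov.p + (M + 1 : ℕ) = ov.p + ov.L - σ.n + 1 := by omega
        rw [e1, e2]
    · intro r hr
      rw [hgL, HString.graphMapLeft_of_gt k (by omega)]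
      simp
  have hendL : rowMap (ov.cokerRow hQ hL κ)
      (if ov.fL ≠ [] ∧ ((ov.s - 1 : ℤ) : ZMod σ.n) = i then
        (c (ov.s - 1) : k) • Finsupp.single (ov.p - 1) (pathElt k Q ov.fL) else 0) =
      -(if ((ov.s - 1 : ℤ) : ZMod σ.n) = i then
        (κ * c (ov.s - 1) : k) • gR (ov.p + σ.n - 1) else 0) := by
    by_cases hf : ov.fL = []
    · rw [hgR, hf, HString.graphMapRight_sub_one_nil]
      simp
    · by_cases hi : ((ov.s - 1 : ℤ) : ZMod σ.n) = i
      · rw [if_pos ⟨hf, hi⟩, if_pos hi, LinearMap.map_smul_of_tower, rowMap,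
          Finsupp.linearCombination_single, cokerRow_of_lt _ _ _ _ (by omega), hgR,
          HString.graphMapRight_sub_one k hf, HString.basis_eq, smul_comm (pathElt k Q ov.fL),
          Finsupp.smul_single, smul_eq_mul, ov.v_cutString_le hQ hL (by omega),
          pathElt_mul_vert k Q (ov.joins_fL hf), neg_smul, smul_neg, smul_smul, mul_comm (κ : k)]
        congr 4
        ring
      · rw [if_neg (by tauto), if_neg hi, map_zero, neg_zero]
  have hendR : rowMap (ov.cokerRow hQ hL κ)
      (if ov.fR ≠ [] ∧ ((ov.s + ov.L + 1 : ℤ) : ZMod σ.n) = i then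
        (c (ov.s + ov.L + 1) : k) • Finsupp.single (ov.p + ov.L + 1) (pathElt k Q ov.fR) else 0) =
      (κ : k) • (if ((ov.s + M + 1 : ℤ) : ZMod σ.n) = i then
        (c (ov.s + M + 1) : k) • gL (ov.p + ov.L - σ.n + 1) else 0) := by
    have e1 : ov.s + ov.L + 1 = ov.s + M + 1 + σ.n := by omega
    rw [e1, σ.cast_add_n, hκ]
    by_cases hf : ov.fR = []
    · rw [hgL, hf, HString.graphMapLeft_add_one_nil]
      simp
    · by_cases hi : ((ov.s + M + 1 : ℤ) : ZMod σ.n) = i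
      · rw [if_pos ⟨hf, hi⟩, if_pos hi, LinearMap.map_smul_of_tower, rowMap,
          Finsupp.linearCombination_single, cokerRow_of_ge _ _ _ _ (by omega), hgL,
          HString.graphMapLeft_of_gt k (by omega),
          HString.graphMapLeft_add_one k hf, HString.basis_eq, smul_zero, sub_zero,
          Finsupp.smul_single, smul_eq_mul, ov.v_cutString_ge hQ hL (by omega), sub_add_cancel,
          pathElt_mul_vert k Q (ov.joins_fR hf), Units.val_mul, mul_smul]
        congr 4
        ring
      · rw [if_neg (by tauto), if_neg hi, map_zero, smul_zero]
  rw [graphRow_eq, map_add, hsum, hR, hLsum, endRow, map_add, hendL, hendR, smul_add]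
  have h1 : (κ : k) • (∑ r ∈ Finset.range (M + 1), if ((ov.s + r : ℤ) : ZMod σ.n) = i then
        (c (ov.s + r) : k) • (C.matrixComplex k).basis (ov.p + r) else 0) =
      ∑ r ∈ Finset.range (M + 1), if ((ov.s + r : ℤ) : ZMod σ.n) = i then
        (κ * c (ov.s + r) : k) • (C.matrixComplex k).basis (ov.p + r) else 0 := by
    rw [Finset.smul_sum]
    refine Finset.sum_congr rfl fun r _ => ?_
    rw [smul_ite, smul_smul, smul_zero]
  rw [h1]
  abel

/-- The retraction reads off the coordinates in the window p ≤ q < p + n. To the right of it the map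
is triangular: the coordinate of the image at q - n is y q plus terms at positions already known to
vanish, so one inducts to the right. To the left of p the map is multiplication by -κ. -/
theorem cokerRow_injective {c : ℤ → kˣ} {κ : kˣ} {m : ℤ} {y : ℤ →₀ Alg k Q}
    (hy : y ∈ (τ.matrixComplex k).piece m) (hG : rowMap (ov.cokerRow hQ hL κ) y = 0)
    (hr : rowMap (ov.retraction c σ.n) y = 0) : y = 0 := by
  classical
  have hv : ∀ q, y q * vert k Q (τ.v q) = y q := fun q => (hy q).1
  have h1 : ∀ q, ov.p ≤ q → q < ov.p + σ.n → y q = 0 := by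
    intro q hq hq'
    have h2 := DFunLike.congr_fun hr ((ov.s + (q - ov.p) : ℤ) : ZMod σ.n)
    rw [rowMap, Finsupp.linearCombination_apply, Finsupp.sum, Finsupp.finsetSum_apply,
      Finset.sum_eq_single q] at h2
    · rw [retraction, if_pos ⟨hq, hq'⟩, ← ov.v_of hq (by omega), Units.smul_def, smul_comm,
        Finsupp.smul_single, smul_eq_mul, hv] at h2
      simpa using h2
    · intro q' _ hne
      unfold retraction
      split_ifs with h3
      · have h4 : ((ov.s + (q' - ov.p) : ℤ) : ZMod σ.n) ≠ ((ov.s + (q - ov.p) : ℤ) : ZMod σ.n) := by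
          rw [Ne, σ.cast_eq_iff (by omega) (by omega)]
          omega
        rw [Units.smul_def, smul_comm, Finsupp.smul_single, Finsupp.smul_apply,
          Finsupp.single_eq_of_ne h4.symm, smul_zero]
      · simp
    · intro h3
      simp [Finsupp.notMem_support_iff.mp h3]
  have h2 : ∀ q, ov.p + σ.n ≤ q → y q = 0 := by
    intro q
    induction hm : (q - (ov.p + σ.n)).toNat using Nat.strong_induction_on generalizing q with
    | _ m ih =>
    intro hq
    have hlow : ∀ q', ov.p ≤ q' → q' < q → y q' = 0 := by
      intro q' h3 h4
      rcases lt_or_ge q' (ov.p + σ.n) with h5 | h5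
      · exact h1 q' h3 h5
      · exact ih _ (by omega) q' rfl h5
    have hn := σ.two_le_n
    have h3 := DFunLike.congr_fun hG (q - σ.n)
    rw [rowMap, Finsupp.linearCombination_apply, Finsupp.sum, Finsupp.finsetSum_apply,
      Finset.sum_eq_single q] at h3
    · rw [cokerRow_of_ge _ _ _ _ hq, smul_sub, Finsupp.sub_apply, smul_comm, Finsupp.smul_apply,
        Finsupp.smul_apply, Finsupp.smul_apply,
        graphMapLeft_apply_of_ne (by omega), HString.basis_eq, ov.v_cutString_ge hQ hL (by omega),
        sub_add_cancel, Finsupp.single_eq_same, smul_eq_mul, hv] at h3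
      simpa using h3
    · intro q' h4 hne
      have h5 := Finsupp.mem_support_iff.mp h4
      -- The surviving positions are to the left of p, and then map to themselves, or to the right
      -- of q; neither kind contributes to the coordinate q - n.
      have h6 : q' < ov.p ∨ q < q' := by
        by_contra h6
        exact h5 (hlow q' (by omega) (by omega))
      rcases h6 with h6 | h6
      · rw [cokerRow_of_lt _ _ _ _ h6, HString.basis_eq]
        simp [show q - (σ.n : ℤ) ≠ q' by omega]
      · rw [cokerRow_of_ge _ _ _ _ (by omega), HString.basis_eq]
        simp [graphMapLeft_apply_of_ne (k := k) (Q := Q) (show q - (σ.n : ℤ) ≠ q' by omega),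
          show q ≠ q' by omega]
    · intro h3
      simp [Finsupp.notMem_support_iff.mp h3]
  ext q
  rcases lt_or_ge q ov.p with hq | hq
  · have h3 := DFunLike.congr_fun hG q
    rw [rowMap, Finsupp.linearCombination_apply, Finsupp.sum, Finsupp.finsetSum_apply,
      Finset.sum_eq_single q] at h3
    · rw [cokerRow_of_lt _ _ _ _ hq, smul_comm, HString.basis_eq, Finsupp.smul_single,
        ov.v_cutString_le hQ hL (by omega), smul_eq_mul, hv] at h3
      simpa using h3
    · intro q' h4 hne
      have h5 := Finsupp.mem_support_iff.mp h4
      have h6 : q' < ov.p := by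
        by_contra h6
        rcases lt_or_ge q' (ov.p + σ.n) with h7 | h7
        · exact h5 (h1 q' (by omega) h7)
        · exact h5 (h2 q' h7)
      rw [cokerRow_of_lt _ _ _ _ h6, HString.basis_eq]
      simp [hne.symm]
    · intro h3
      simp [Finsupp.notMem_support_iff.mp h3]
  · rcases lt_or_ge q (ov.p + σ.n) with h7 | h7
    · exact h1 q hq h7
    · exact h2 q h7

/-- For i < p the generator is the image of -κ⁻¹ times the generator i of P_τ. For i ≥ p the
generator i + n of P_τ maps to the generator i minus κ times a term further to the right, which is
lifted inductively. -/
theorem cokerRow_surjective (κ : kˣ) {i : ℤ} (hi : i ∈ (ov.cutString hQ hL).J) :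
    ∃ y ∈ (τ.matrixComplex k).piece ((ov.cutString hQ hL).deg i),
      rowMap (ov.cokerRow hQ hL κ) y = ((ov.cutString hQ hL).matrixComplex k).basis i := by
  have hn := σ.two_le_n
  have hG := ov.isMatrix_cokerRow (k := k) hQ hL κ
  rcases lt_or_ge i ov.p with h | h
  · have h1 := (ov.mem_cutString_le hQ hL (by omega)).mp hi
    have h2 := smul_mem_cell (-(κ⁻¹ : kˣ) : k) ((τ.matrixComplex k).basis_mem_cell h1)
    refine ⟨(-(κ⁻¹ : kˣ) : k) • (τ.matrixComplex k).basis i, ?_, ?_⟩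
    rotate_left
    · rw [LinearMap.map_smul_of_tower, hG.rowMap_basis h1, cokerRow_of_lt _ _ _ _ h, smul_smul]
      simp
    · rw [ov.deg_cutString_le hQ hL (by omega)]
      exact h2.1
  -- The error term is nonzero only for i + n ≤ p + L - n + 1; in this range the truncated
  -- difference strictly decreases when i is replaced by i + n.
  · induction hm : (ov.p + ov.L + 1 - i).toNat using Nat.strong_induction_on generalizing i with
    | _ m ih =>
    have h1 := (ov.mem_cutString_ge hQ hL h).mp hi
    have hdeg := ov.deg_cutString_ge hQ hL h
    have hbas : (τ.matrixComplex k).basis (i + σ.n) ∈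
        (τ.matrixComplex k).piece ((ov.cutString hQ hL).deg i) := by
      rw [hdeg]
      exact ((τ.matrixComplex k).basis_mem_cell h1).1
    have hGb := hG.rowMap_basis h1
    rw [cokerRow_of_ge _ _ _ _ (by omega), add_sub_cancel_right] at hGb
    obtain ⟨a, z, hz, hz'⟩ : ∃ (a : Alg k Q) (z : ℤ →₀ Alg k Q),
        z ∈ (τ.matrixComplex k).piece ((ov.cutString hQ hL).deg i) ∧
        rowMap (ov.cokerRow hQ hL κ) (a • z) = HString.graphMapLeft k (ov.cutString hQ hL)
          (ov.p + ov.L - σ.n) ov.fR (i + σ.n) := by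
      rcases lt_trichotomy (i + σ.n) (ov.p + ov.L - σ.n + 1) with h2 | h2 | h2
      · have h3 := (ov.mem_cutString_le hQ hL (i := i + σ.n) (by omega)).mpr h1
        obtain ⟨z, hz, hz'⟩ := ih _ (by omega) h3 (by omega) rfl
        rw [ov.deg_cutString_le hQ hL (by omega), ← hdeg] at hz
        refine ⟨1, z, hz, ?_⟩
        rw [one_smul, hz', HString.graphMapLeft_of_le k (by omega), HString.basis_eq]
      · by_cases hf : ov.fR = []
        · refine ⟨0, 0, zero_mem _, ?_⟩
          rw [h2, hf, HString.graphMapLeft_add_one_nil, smul_zero, map_zero]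
        · have h3 := (ov.agreeLeft hQ hL).mem_of_ne hf
          rw [← h2] at h3
          obtain ⟨z, hz, hz'⟩ := ih _ (by omega) h3 (by omega) rfl
          have h4 := (ov.agreeLeft hQ hL).deg_f hf
          rw [← h2] at h4
          rw [h4, ← hdeg] at hz
          refine ⟨pathElt k Q ov.fR, z, hz, ?_⟩
          rw [map_smul, hz', h2, HString.graphMapLeft_add_one k hf, HString.basis_eq,
            Finsupp.smul_single, smul_eq_mul,
            pathElt_mul_vert k Q ((ov.agreeLeft hQ hL).joins_f hf)]
      · refine ⟨0, 0, zero_mem _, ?_⟩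
        rw [HString.graphMapLeft_of_gt k h2, smul_zero, map_zero]
    refine ⟨(τ.matrixComplex k).basis (i + σ.n) + (algebraMap k (Alg k Q) κ * a) • z,
      Submodule.add_mem _ hbas (Submodule.smul_mem _ _ hz), ?_⟩
    rw [map_add, hGb, mul_smul, map_smul, hz', algebraMap_smul, sub_add_cancel]

/-- The cone of the graph map of an overlap which contains a full period of the band. -/
theorem iso_cutString {d : ℤ} {lam : kˣ} (f : σ.complex k d lam ⟶ τ.complex k)
    (hf : ov.IsGraphMap f) : IsoInHomotopyCategory (CochainComplex.mappingCone f)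
      ((ov.cutString hQ hL).complex k) := by
  obtain ⟨c, hc, hfc⟩ := hf
  obtain ⟨κ, hκ⟩ := hc.exists_monodromy
  refine isoInHomotopyCategory_mappingCone_of_exact (B := σ.matrixComplex k d lam)
    (D := τ.matrixComplex k) (N := (ov.cutString hQ hL).matrixComplex k) f hfc
    (ov.isMatrix_graphRow d lam c) (ov.isMatrix_cokerRow hQ hL κ)
    (ov.isMatrix_retraction d lam c (N := σ.n) (by omega))
    (fun q hq => ov.cokerRow_comm hQ hL κ hq) (fun i _ => ?_)
    (fun i _ => ov.rowMap_cokerRow_graphRow hQ hL hκ i)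
    (fun i hi => ov.cokerRow_surjective hQ hL κ hi)
    (fun n y hy h1 h2 => ov.cokerRow_injective hQ hL hy h1 h2)
  obtain ⟨t, h1, h2, rfl⟩ := σ.exists_cast_eq ov.s i
  obtain ⟨r, rfl⟩ : ∃ r : ℕ, t = ov.s + r := ⟨(t - ov.s).toNat, by omega⟩
  exact ov.rowMap_retraction_graphRow d lam c le_rfl (by omega) (by omega)

end Cokernel

end Overlap

end Gentle

/-! ### Short overlaps: the string with the rest of the band inserted -/

namespace Gentle

open BoundQuiver MatrixComplex HWord

variable {V E : Type u} {Q : BoundQuiver V E}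

namespace Overlap

variable {σ : HBand Q} {τ : HString Q} (ov : Overlap σ τ)

/-- The number of letters of the band outside the overlap. -/
def gap : ℤ := σ.n - ov.L

/-- The positions of the string which replaces the overlap by the rest of the band. -/
def surgeryJ : Set ℤ :=
  {i | (i < ov.p ∧ i ∈ τ.J) ∨ (ov.p ≤ i ∧ i + 1 < ov.p + ov.gap) ∨
    (ov.p + ov.gap ≤ i + 1 ∧ i + (ov.L + 2 - ov.gap) ∈ τ.J)}

/-- A function on the positions of the replaced string, which is given by functions on the positions of
`τ` and of `σ`. -/
def piecewise {α : Type*} (f g : ℤ → α) (i : ℤ) : α :=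
  if i < ov.p then f i else if i + 1 < ov.p + ov.gap then g (ov.s - 1 - (i - ov.p)) else
    f (i + (ov.L + 2 - ov.gap))

/-- The letters of the replaced string. -/
def surgeryLetter (i : ℤ) : Letter E :=
  if i + 1 < ov.p then τ.letter i
  else if i + 1 = ov.p then
    if ov.gap = 1 then
      Letter.merge₂ (τ.letter (ov.p - 1)) (τ.letter (ov.p + ov.L)) ov.fL ov.fR
    else Letter.merge (σ.letter (ov.s - 1)) (τ.letter (ov.p - 1)) ov.fL
  else if i + 2 < ov.p + ov.gap then (σ.letter (ov.s - 1 - (i - ov.p) - 1)).inv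
  else if i + 2 = ov.p + ov.gap then
    (Letter.merge (σ.letter (ov.s + ov.L)).inv (τ.letter (ov.p + ov.L)).inv ov.fR).inv
  else τ.letter (i + (ov.L + 2 - ov.gap))

/-- A letter which starts at the position `i` of the replaced string, up to strands. -/
def leftRef (i : ℤ) : Letter E :=
  if i < ov.p then τ.letter i
  else if i + 1 < ov.p + ov.gap then (σ.letter (ov.s - 1 - (i - ov.p) - 1)).inv
  else τ.letter (i + (ov.L + 2 - ov.gap))

/-- A letter which ends at the position `i` of the replaced string, up to strands. -/
def rightRef (i : ℤ) : Letter E :=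
  if i < ov.p then τ.letter (i - 1)
  else if i + 1 < ov.p + ov.gap then (σ.letter (ov.s - 1 - (i - ov.p))).inv
  else τ.letter (i + (ov.L + 2 - ov.gap) - 1)

section Piecewise

variable {ov} {α : Type*} {f g : ℤ → α} {i : ℤ}

theorem piecewise_left (h : i < ov.p) : ov.piecewise f g i = f i := if_pos h

/-- The rest of the band is run through backwards, from the position s - 1 next to the left end of
the overlap down to s + 1 - gap. -/
theorem piecewise_mid (h : ov.p ≤ i) (h' : i + 1 < ov.p + ov.gap) :
    ov.piecewise f g i = g (ov.s - 1 - (i - ov.p)) := by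
  rw [piecewise, if_neg (by omega), if_pos h']

/-- The shift sends p + gap - 1, the first position after the inserted part, to p + L + 1, the first
position of τ after the overlap. -/
theorem piecewise_right (h : 0 < ov.gap) (h' : ov.p + ov.gap ≤ i + 1) :
    ov.piecewise f g i = f (i + (ov.L + 2 - ov.gap)) := by
  rw [piecewise, if_neg (by omega), if_neg (by omega)]

theorem mem_surgeryJ_left (h0 : 0 < ov.gap) (h : i < ov.p) : i ∈ ov.surgeryJ ↔ i ∈ τ.J := by
  simp only [surgeryJ, Set.mem_ofPred_eq, h, true_and, show ¬ ov.p ≤ i by omega, false_and,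
    show ¬ ov.p + ov.gap ≤ i + 1 by omega, or_false]

theorem mem_surgeryJ_mid (h : ov.p ≤ i) (h' : i + 1 < ov.p + ov.gap) : i ∈ ov.surgeryJ :=
  Or.inr (Or.inl ⟨h, h'⟩)

theorem mem_surgeryJ_right (h0 : 0 < ov.gap) (h : ov.p + ov.gap ≤ i + 1) :
    i ∈ ov.surgeryJ ↔ i + (ov.L + 2 - ov.gap) ∈ τ.J := by
  simp only [surgeryJ, Set.mem_ofPred_eq, h, true_and, show ¬ i < ov.p by omega, false_and,
    show ¬ i + 1 < ov.p + ov.gap by omega, and_false, false_or]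

theorem surgeryLetter_left (h : i + 1 < ov.p) : ov.surgeryLetter i = τ.letter i := if_pos h

theorem surgeryLetter_merge₂ (h : i + 1 = ov.p) (h' : ov.gap = 1) : ov.surgeryLetter i =
    Letter.merge₂ (τ.letter (ov.p - 1)) (τ.letter (ov.p + ov.L)) ov.fL ov.fR := by
  rw [surgeryLetter, if_neg (by omega), if_pos h, if_pos h']

theorem surgeryLetter_mergeL (h : i + 1 = ov.p) (h' : 1 < ov.gap) : ov.surgeryLetter i =
    Letter.merge (σ.letter (ov.s - 1)) (τ.letter (ov.p - 1)) ov.fL := by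
  rw [surgeryLetter, if_neg (by omega), if_pos h, if_neg (by omega)]

theorem surgeryLetter_mid (h : ov.p ≤ i) (h' : i + 2 < ov.p + ov.gap) :
    ov.surgeryLetter i = (σ.letter (ov.s - 1 - (i - ov.p) - 1)).inv := by
  rw [surgeryLetter, if_neg (by omega), if_neg (by omega), if_pos h']

theorem surgeryLetter_mergeR (h : i + 2 = ov.p + ov.gap) (h' : 1 < ov.gap) :
    ov.surgeryLetter i =
    (Letter.merge (σ.letter (ov.s + ov.L)).inv (τ.letter (ov.p + ov.L)).inv ov.fR).inv := by
  rw [surgeryLetter, if_neg (by omega), if_neg (by omega), if_neg (by omega), if_pos h]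

theorem surgeryLetter_right (h0 : 0 < ov.gap) (h : ov.p + ov.gap ≤ i + 1) :
    ov.surgeryLetter i = τ.letter (i + (ov.L + 2 - ov.gap)) := by
  rw [surgeryLetter, if_neg (by omega), if_neg (by omega), if_neg (by omega), if_neg (by omega)]

end Piecewise

/-- The band position following the right end of the overlap is, one period earlier, the last
inserted position. -/
theorem v_gap : σ.v (ov.s + 1 - ov.gap) = σ.v (ov.s + ov.L + 1) := by
  rw [← σ.v_sub (ov.s + ov.L + 1)]
  congr 1
  unfold gap
  ring

theorem deg_gap : σ.deg (ov.s + 1 - ov.gap) = σ.deg (ov.s + ov.L + 1) := by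
  rw [← σ.deg_sub (ov.s + ov.L + 1)]
  congr 1
  unfold gap
  ring

theorem letter_gap : σ.letter (ov.s - ov.gap) = σ.letter (ov.s + ov.L) := by
  rw [← σ.letter_sub (ov.s + ov.L)]
  congr 1
  unfold gap
  ring

/-- If the band has only one letter outside the overlap, then this letter is adjacent to both ends. -/
theorem letter_of_gap_eq_one (h : ov.gap = 1) : σ.letter (ov.s + ov.L) = σ.letter (ov.s - 1) := by
  rw [← letter_gap, h]

theorem v_of_gap_eq_one (h : ov.gap = 1) : σ.v (ov.s + ov.L) = σ.v (ov.s - 1) := by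
  rw [← σ.v_sub (ov.s + ov.L)]
  unfold gap at h
  congr 1
  omega

theorem deg_of_gap_eq_one (h : ov.gap = 1) : σ.deg (ov.s + ov.L) = σ.deg (ov.s - 1) := by
  rw [← σ.deg_sub (ov.s + ov.L)]
  unfold gap at h
  congr 1
  omega

theorem right_end_of_gap_eq_one (h : ov.gap = 1) :
    EndCondition Q (σ.letter (ov.s - 1)).path ((σ.letter (ov.s - 1)).direct = false)
      (ov.p + ov.L + 1 ∈ τ.J) (τ.letter (ov.p + ov.L)).path
      ((τ.letter (ov.p + ov.L)).direct = false) ov.fR := by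
  rw [← ov.letter_of_gap_eq_one h]
  exact ov.right_end

theorem deg_left (h : ov.p - 1 ∈ τ.J) : τ.deg (ov.p - 1) =
    if (τ.letter (ov.p - 1)).direct then σ.deg ov.s - 1 else σ.deg ov.s + 1 := by
  have := τ.deg_succ (ov.p - 1) h (by simpa using ov.mem_p)
  rw [sub_add_cancel, ov.deg_p] at this
  split_ifs at this ⊢ <;> omega

theorem deg_right (h : ov.p + ov.L + 1 ∈ τ.J) : τ.deg (ov.p + ov.L + 1) =
    if (τ.letter (ov.p + ov.L)).direct then σ.deg (ov.s + ov.L) + 1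
    else σ.deg (ov.s + ov.L) - 1 := by
  rw [← ov.deg_end]
  exact τ.deg_succ _ ov.mem_end h

theorem joins_surgeryLetter (h0 : 0 < ov.gap) {i : ℤ} (hi : i ∈ ov.surgeryJ)
    (hi' : i + 1 ∈ ov.surgeryJ) :
    (ov.surgeryLetter i).Joins Q (ov.piecewise τ.v σ.v i) (ov.piecewise τ.v σ.v (i + 1)) := by
  rcases lt_trichotomy (i + 1) ov.p with h | h | h
  · rw [mem_surgeryJ_left h0 (by omega)] at hi hi'
    rw [surgeryLetter_left h, piecewise_left (by omega), piecewise_left h]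
    exact τ.joins i hi hi'
  · obtain rfl : i = ov.p - 1 := by omega
    rw [mem_surgeryJ_left h0 (by omega)] at hi
    rw [piecewise_left (by omega), sub_add_cancel]
    rw [sub_add_cancel] at hi'
    rcases (show ov.gap = 1 ∨ 1 < ov.gap by omega) with h1 | h1
    · rw [mem_surgeryJ_right h0 (by omega)] at hi'
      rw [surgeryLetter_merge₂ h h1, piecewise_right h0 (by omega)]
      have e : ov.p + (ov.L + 2 - ov.gap) = ov.p + ov.L + 1 := by omega
      rw [e] at hi' ⊢
      have hR := ov.joins_right hi'
      rw [ov.v_of_gap_eq_one h1] at hR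
      exact ov.left_end.merge₂_joins hi (ov.right_end_of_gap_eq_one h1) hi'
        (σ.joins_letter_sub_one _) (ov.joins_left hi) hR
    · rw [surgeryLetter_mergeL h h1, piecewise_mid le_rfl (by omega), sub_self, sub_zero]
      exact ov.left_end.merge_joins hi (σ.joins_letter_sub_one _) (ov.joins_left hi)
  · rcases lt_trichotomy (i + 2) (ov.p + ov.gap) with h1 | h1 | h1
    · rw [surgeryLetter_mid (by omega) h1, piecewise_mid (by omega) (by omega),
        piecewise_mid (by omega) (by omega)]
      have e : ov.s - 1 - (i + 1 - ov.p) = ov.s - 1 - (i - ov.p) - 1 := by ring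
      rw [e]
      exact (σ.joins_letter_sub_one _).inv
    · rw [mem_surgeryJ_right h0 (by omega)] at hi'
      rw [surgeryLetter_mergeR h1 (by omega), piecewise_mid (by omega) (by omega),
        piecewise_right h0 (by omega)]
      have e : i + 1 + (ov.L + 2 - ov.gap) = ov.p + ov.L + 1 := by omega
      have e' : ov.s - 1 - (i - ov.p) = ov.s + 1 - ov.gap := by omega
      rw [e] at hi' ⊢
      rw [e', v_gap]
      exact (ov.right_end.inv.merge_joins hi' (σ.joins_letter _).inv (ov.joins_right hi').inv).inv
    · rw [mem_surgeryJ_right h0 (by omega)] at hi hi'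
      rw [surgeryLetter_right h0 (by omega), piecewise_right h0 (by omega),
        piecewise_right h0 (by omega), add_right_comm]
      exact τ.joins _ hi (by rwa [add_right_comm])

/-- Band positions carry their degree lowered by one, as in the cone. This makes the merged letters
homogeneous: for nonempty f_L the positions p - 1 of τ and s - 1 of σ have equal degree, and the
inverse letter f_L joins degrees that differ by one. -/
theorem deg_surgeryLetter (h0 : 0 < ov.gap) {i : ℤ} (hi : i ∈ ov.surgeryJ)
    (hi' : i + 1 ∈ ov.surgeryJ) :
    ov.piecewise τ.deg (fun t => σ.deg t - 1) (i + 1) =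
      if (ov.surgeryLetter i).direct then ov.piecewise τ.deg (fun t => σ.deg t - 1) i + 1
      else ov.piecewise τ.deg (fun t => σ.deg t - 1) i - 1 := by
  rcases lt_trichotomy (i + 1) ov.p with h | h | h
  · rw [mem_surgeryJ_left h0 (by omega)] at hi hi'
    rw [surgeryLetter_left h, piecewise_left (by omega), piecewise_left (by omega)]
    exact τ.deg_succ i hi hi'
  · obtain rfl : i = ov.p - 1 := by omega
    rw [mem_surgeryJ_left h0 (by omega)] at hi
    have hL := ov.deg_left hi
    have hσ := σ.deg_sub_one ov.s
    rw [sub_add_cancel, piecewise_left (i := ov.p - 1) (by omega)]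
    rw [sub_add_cancel] at hi'
    rcases (show ov.gap = 1 ∨ 1 < ov.gap by omega) with h1 | h1
    · rw [mem_surgeryJ_right h0 (by omega)] at hi'
      rw [surgeryLetter_merge₂ h h1, piecewise_right h0 (by omega)]
      have e : ov.p + (ov.L + 2 - ov.gap) = ov.p + ov.L + 1 := by omega
      rw [e] at hi' ⊢
      have hR := ov.deg_right hi'
      rw [ov.deg_of_gap_eq_one h1] at hR
      obtain ⟨hg, h2, h3, h4⟩ | ⟨hf, h2, h3, h4⟩ := EndCondition.merge₂_cases ov.left_end hi
        (ov.right_end_of_gap_eq_one h1) hi' <;> rw [h3, hR, hL, hσ] <;>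
      obtain ⟨h5, h6, -⟩ | ⟨h5, h6, -⟩ := h4 <;> simp [h2, h5, h6]
    · rw [surgeryLetter_mergeL h h1, piecewise_mid le_rfl (by omega), sub_self, sub_zero, hL, hσ]
      unfold Letter.merge
      obtain ⟨h2, -, h3, h4, -⟩ | ⟨h2, -, h3, h4, -⟩ | ⟨h2, h3, h4⟩ := ov.left_end
      · simp [h2, h3, h4]
      · simp [h2, h3, h4]
      · simp [h2, h3, (h4 hi).1]
  · rcases lt_trichotomy (i + 2) (ov.p + ov.gap) with h1 | h1 | h1
    · rw [surgeryLetter_mid (by omega) h1, piecewise_mid (by omega) (by omega),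
        piecewise_mid (by omega) (by omega)]
      have e : ov.s - 1 - (i + 1 - ov.p) = ov.s - 1 - (i - ov.p) - 1 := by ring
      rw [e, σ.deg_sub_one (ov.s - 1 - (i - ov.p)), Letter.inv_direct]
      cases (σ.letter (ov.s - 1 - (i - ov.p) - 1)).direct <;> simp
    · rw [mem_surgeryJ_right h0 (by omega)] at hi'
      rw [surgeryLetter_mergeR h1 (by omega), piecewise_right h0 (by omega),
        piecewise_mid (by omega) (by omega)]
      have e : i + 1 + (ov.L + 2 - ov.gap) = ov.p + ov.L + 1 := by omega
      have e' : ov.s - 1 - (i - ov.p) = ov.s + 1 - ov.gap := by omega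
      rw [e] at hi' ⊢
      rw [e', deg_gap, ov.deg_right hi', σ.deg_add_one]
      unfold Letter.merge
      obtain ⟨h2, -, h3, h4, -⟩ | ⟨h2, -, h3, h4, -⟩ | ⟨h2, h3, h4⟩ := ov.right_end
      · simp [h2, h3, h4]
      · simp only [Bool.not_eq_false] at h3 h4
        simp [h2, h3, h4]
      · simp only [Bool.not_eq_false] at h3
        simp [h2, h3, (h4 hi').1]
    · rw [mem_surgeryJ_right h0 (by omega)] at hi hi'
      rw [surgeryLetter_right h0 (by omega), piecewise_right h0 (by omega),
        piecewise_right h0 (by omega), add_right_comm]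
      exact τ.deg_succ _ hi (by rwa [add_right_comm])

theorem sameLeft_surgeryLetter (hQ : Q.IsGentle) (h0 : 0 < ov.gap) {i : ℤ}
    (hi : i ∈ ov.surgeryJ) (hi' : i + 1 ∈ ov.surgeryJ) :
    Letter.SameLeft Q (ov.surgeryLetter i) (ov.leftRef i) := by
  have hj := ov.joins_surgeryLetter h0 hi hi'
  rcases lt_trichotomy (i + 1) ov.p with h | h | h
  · rw [leftRef, if_pos (by omega), ← surgeryLetter_left h]
    exact hj.sameLeft
  · rw [leftRef, if_pos (by omega)]
    obtain rfl : i = ov.p - 1 := by omega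
    rw [mem_surgeryJ_left h0 (by omega)] at hi
    rw [sub_add_cancel] at hi'
    rcases (show ov.gap = 1 ∨ 1 < ov.gap by omega) with h1 | h1
    · rw [mem_surgeryJ_right h0 (by omega)] at hi'
      rw [surgeryLetter_merge₂ h h1]
      have e : ov.p + (ov.L + 2 - ov.gap) = ov.p + ov.L + 1 := by omega
      rw [e] at hi'
      exact ov.left_end.merge₂_sameLeft hQ hi (ov.right_end_of_gap_eq_one h1) hi'
        (σ.joins_letter_sub_one _) (ov.joins_left hi)
    · rw [surgeryLetter_mergeL h h1]
      exact ov.left_end.merge_sameLeft hi (σ.joins_letter_sub_one _) (ov.joins_left hi)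
  · rw [leftRef, if_neg (by omega)]
    rcases lt_trichotomy (i + 2) (ov.p + ov.gap) with h1 | h1 | h1
    · rw [if_pos (by omega), ← surgeryLetter_mid (by omega) h1]
      exact hj.sameLeft
    · rw [mem_surgeryJ_right h0 (by omega)] at hi'
      rw [surgeryLetter_mergeR h1 (by omega), if_pos (by omega)]
      have e : i + 1 + (ov.L + 2 - ov.gap) = ov.p + ov.L + 1 := by omega
      have e' : ov.s - 1 - (i - ov.p) - 1 = ov.s - ov.gap := by omega
      rw [e] at hi'
      rw [e', letter_gap]
      have := ov.right_end.inv.merge_sameRight (σ.joins_letter _).inv (ov.joins_right hi').inv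
      rwa [Letter.SameRight, Letter.inv_inv] at this
    · rw [if_neg (by omega), ← surgeryLetter_right h0 (by omega)]
      exact hj.sameLeft

theorem sameRight_surgeryLetter (hQ : Q.IsGentle) (h0 : 0 < ov.gap) {i : ℤ}
    (hi : i ∈ ov.surgeryJ) (hi' : i + 1 ∈ ov.surgeryJ) :
    Letter.SameRight Q (ov.surgeryLetter i) (ov.rightRef (i + 1)) := by
  have hj := ov.joins_surgeryLetter h0 hi hi'
  rcases lt_trichotomy (i + 1) ov.p with h | h | h
  · rw [rightRef, if_pos (by omega), add_sub_cancel_right, ← surgeryLetter_left h]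
    exact hj.sameRight
  · rw [rightRef, if_neg (by omega)]
    obtain rfl : i = ov.p - 1 := by omega
    rw [mem_surgeryJ_left h0 (by omega)] at hi
    rw [sub_add_cancel] at hi'
    rcases (show ov.gap = 1 ∨ 1 < ov.gap by omega) with h1 | h1
    · rw [mem_surgeryJ_right h0 (by omega)] at hi'
      rw [surgeryLetter_merge₂ h h1, if_neg (by omega)]
      have e : ov.p + (ov.L + 2 - ov.gap) = ov.p + ov.L + 1 := by omega
      have e' : ov.p - 1 + 1 + (ov.L + 2 - ov.gap) - 1 = ov.p + ov.L := by omega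
      rw [e] at hi'
      rw [e']
      have hR := ov.joins_right hi'
      rw [ov.v_of_gap_eq_one h1] at hR
      exact ov.left_end.merge₂_sameRight hQ hi (ov.right_end_of_gap_eq_one h1) hi'
        (σ.joins_letter_sub_one _) hR
    · rw [surgeryLetter_mergeL h h1, if_pos (by omega)]
      have e : ov.s - 1 - (ov.p - 1 + 1 - ov.p) = ov.s - 1 := by ring
      rw [e]
      exact ov.left_end.merge_sameRight (σ.joins_letter_sub_one _) (ov.joins_left hi)
  · rw [rightRef, if_neg (by omega)]
    rcases lt_trichotomy (i + 2) (ov.p + ov.gap) with h1 | h1 | h1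
    · have e : ov.s - 1 - (i + 1 - ov.p) = ov.s - 1 - (i - ov.p) - 1 := by ring
      rw [if_pos (by omega), e, ← surgeryLetter_mid (by omega) h1]
      exact hj.sameRight
    · rw [mem_surgeryJ_right h0 (by omega)] at hi'
      rw [surgeryLetter_mergeR h1 (by omega), if_neg (by omega)]
      have e : i + 1 + (ov.L + 2 - ov.gap) = ov.p + ov.L + 1 := by omega
      rw [e] at hi' ⊢
      rw [add_sub_cancel_right, Letter.SameRight, Letter.inv_inv]
      exact ov.right_end.inv.merge_sameLeft hi' (σ.joins_letter _).inv (ov.joins_right hi').inv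
    · have e : i + 1 + (ov.L + 2 - ov.gap) - 1 = i + (ov.L + 2 - ov.gap) := by ring
      rw [if_neg (by omega), e, ← surgeryLetter_right h0 (by omega)]
      exact hj.sameRight

/-- At every position the two letters of the new string are on the strands of two consecutive
letters of τ or of the inverse band, namely `rightRef` and `leftRef`. At the junctions these are τ_L
and τ_R with their outer neighbours, so the break comes from a word in which it is known. -/
theorem break_surgeryLetter (hQ : Q.IsGentle) (h0 : 0 < ov.gap) {i : ℤ}
    (hi : i - 1 ∈ ov.surgeryJ) (hi' : i ∈ ov.surgeryJ) (hi'' : i + 1 ∈ ov.surgeryJ) :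
    (ov.surgeryLetter (i - 1)).Break Q (ov.surgeryLetter i) := by
  have hj := ov.joins_surgeryLetter h0 hi (by rwa [sub_add_cancel])
  have hj' := ov.joins_surgeryLetter h0 hi' hi''
  have hR := ov.sameRight_surgeryLetter hQ h0 hi (by rwa [sub_add_cancel])
  have hL := ov.sameLeft_surgeryLetter hQ h0 hi' hi''
  rw [sub_add_cancel] at hj hR
  rcases (show i < ov.p ∨ (ov.p ≤ i ∧ i + 1 < ov.p + ov.gap) ∨ ov.p + ov.gap ≤ i + 1 by omega)
    with h | h | h
  · rw [rightRef, if_pos h] at hR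
    rw [leftRef, if_pos h] at hL
    rw [mem_surgeryJ_left h0 (by omega)] at hi hi'
    have hm : i + 1 ∈ τ.J := by
      rcases (show i + 1 < ov.p ∨ i + 1 = ov.p by omega) with h1 | h1
      · rwa [mem_surgeryJ_left h0 h1] at hi''
      · rw [h1]
        exact ov.mem_p
    have hx := τ.joins (i - 1) hi (by rwa [sub_add_cancel])
    rw [sub_add_cancel] at hx
    exact Letter.Break.of_same hQ hj hj' hx (τ.joins i hi' hm) (τ.break' i hi hi' hm) hR hL
  · rw [rightRef, if_neg (by omega), if_pos h.2] at hR
    rw [leftRef, if_neg (by omega), if_pos h.2] at hL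
    exact Letter.Break.of_same hQ hj hj' (σ.joins_letter _).inv (σ.joins_letter_sub_one _).inv
      ((σ.break_letter _).inv (σ.joins_letter_sub_one _) (σ.joins_letter _)) hR hL
  · rw [rightRef, if_neg (by omega), if_neg (by omega)] at hR
    rw [leftRef, if_neg (by omega), if_neg (by omega)] at hL
    rw [mem_surgeryJ_right h0 (by omega)] at hi' hi''
    have hm : i + (ov.L + 2 - ov.gap) - 1 ∈ τ.J := by
      rcases (show ov.p + ov.gap < i + 1 ∨ i + 1 = ov.p + ov.gap by omega) with h1 | h1
      · rw [mem_surgeryJ_right h0 (by omega)] at hi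
        rwa [sub_add_eq_add_sub] at hi
      · rw [show i + (ov.L + 2 - ov.gap) - 1 = ov.p + ov.L by omega]
        exact ov.mem_end
    rw [add_right_comm] at hi''
    have hx := τ.joins _ hm (by rwa [sub_add_cancel])
    rw [sub_add_cancel] at hx
    exact Letter.Break.of_same hQ hj hj' hx (τ.joins _ hi' hi'') (τ.break' _ hm hi' hi'') hR hL

/-- Only gap = 1 needs an argument, as there are no inserted positions. If τ_L is absent, the single
letter of α points away from the left end of the overlap, hence towards its right end; there the end
condition forces τ_R to be present. -/
theorem surgeryJ_nonempty (h0 : 0 < ov.gap) : ov.surgeryJ.Nonempty := by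
  rcases (show ov.gap = 1 ∨ 1 < ov.gap by omega) with h1 | h1
  · by_cases hL : ov.p - 1 ∈ τ.J
    · exact ⟨ov.p - 1, (mem_surgeryJ_left h0 (by omega)).mpr hL⟩
    · refine ⟨ov.p, (mem_surgeryJ_right h0 (by omega)).mpr ?_⟩
      rw [show ov.p + (ov.L + 2 - ov.gap) = ov.p + ov.L + 1 by omega]
      have hR := ov.right_end_of_gap_eq_one h1
      obtain ⟨-, h, -⟩ | ⟨-, h, -⟩ | ⟨-, h2, -⟩ := ov.left_end
      · exact absurd h hL
      · exact absurd h hL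
      · obtain ⟨-, h, -⟩ | ⟨-, h, -⟩ | ⟨-, h3, -⟩ := hR
        · exact h
        · exact h
        · simp_all
  · exact ⟨ov.p, mem_surgeryJ_mid le_rfl (by omega)⟩

/-- The string which is obtained from `τ` by replacing the overlap by the inverse of the rest of the
band. -/
def surgery (hQ : Q.IsGentle) (h0 : 0 < ov.gap) : HString Q where
  J := ov.surgeryJ
  nonempty := ov.surgeryJ_nonempty h0
  ordConnected := ⟨by
    intro a ha b hb i ⟨h1, h2⟩
    rcases (show i < ov.p ∨ (ov.p ≤ i ∧ i + 1 < ov.p + ov.gap) ∨ ov.p + ov.gap ≤ i + 1 by omega)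
      with h | h | h
    · rw [mem_surgeryJ_left h0 (by omega)] at ha ⊢
      exact τ.ordConnected.out ha ov.mem_p ⟨h1, h.le⟩
    · exact mem_surgeryJ_mid h.1 h.2
    · rw [mem_surgeryJ_right h0 (by omega)] at hb ⊢
      exact τ.ordConnected.out ov.mem_end hb ⟨by omega, by omega⟩⟩
  v := ov.piecewise τ.v σ.v
  deg := ov.piecewise τ.deg (fun t => σ.deg t - 1)
  letter := ov.surgeryLetter
  joins _ hi hi' := ov.joins_surgeryLetter h0 hi hi'
  deg_succ _ hi hi' := ov.deg_surgeryLetter h0 hi hi'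
  break' _ hi hi' hi'' := ov.break_surgeryLetter hQ h0 hi hi' hi''
  left_tail h := by
    obtain ⟨N, hN⟩ := τ.left_tail fun ⟨b, hb⟩ => h ⟨min b ov.p, fun i hi => by
      rcases lt_or_ge i ov.p with h1 | h1
      · rw [mem_surgeryJ_left h0 h1] at hi
        exact (min_le_left _ _).trans (hb hi)
      · exact (min_le_right _ _).trans h1⟩
    refine ⟨min N (ov.p - 1), fun i hi => ?_⟩
    rw [surgeryLetter_left (by omega)]
    exact hN i (by omega)
  right_tail h := by
    obtain ⟨N, hN⟩ := τ.right_tail fun ⟨b, hb⟩ =>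
      h ⟨max (b - (ov.L + 2 - ov.gap)) (ov.p + ov.gap), fun i hi => by
      rcases lt_or_ge (i + 1) (ov.p + ov.gap) with h1 | h1
      · exact le_trans (by omega) (le_max_right _ _)
      · rw [mem_surgeryJ_right h0 h1] at hi
        have := hb hi
        exact le_trans (by omega) (le_max_left _ _)⟩
    refine ⟨max (N - (ov.L + 2 - ov.gap)) (ov.p + ov.gap), fun i hi => ?_⟩
    rw [surgeryLetter_right h0 (by omega)]
    exact hN _ (by omega)

end Overlap

end Gentle

/-! ### Short overlaps: the contraction data -/

namespace Gentle

open BoundQuiver MatrixComplex HWord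

variable {V E : Type u} {Q : BoundQuiver V E}

namespace Overlap

variable {σ : HBand Q} {τ : HString Q} (ov : Overlap σ τ)

/-- The representative of a position of the band in the period which ends with the overlap. -/
def rep (j : ZMod σ.n) : ℤ :=
  ov.s + 1 - ov.gap + ((j - ((ov.s + 1 - ov.gap : ℤ) : ZMod σ.n)).val : ℤ)

theorem rep_cast {t : ℤ} (h : ov.s + 1 - ov.gap ≤ t) (h' : t ≤ ov.s + ov.L) :
    ov.rep (t : ZMod σ.n) = t := by
  have h1 : ((ov.rep (t : ZMod σ.n) : ℤ) : ZMod σ.n) = (t : ZMod σ.n) := by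
    unfold rep
    simp
  have h2 := ZMod.val_lt ((t : ZMod σ.n) - ((ov.s + 1 - ov.gap : ℤ) : ZMod σ.n))
  have h3 : ov.rep (t : ZMod σ.n) = ov.s + 1 - ov.gap +
    (((t : ZMod σ.n) - ((ov.s + 1 - ov.gap : ℤ) : ZMod σ.n)).val : ℤ) := rfl
  unfold gap at *
  rwa [σ.cast_eq_iff (by omega) (by omega)] at h1

theorem exists_cast_eq_of_gap (j : ZMod σ.n) :
    ∃ t : ℤ, ov.s + 1 - ov.gap ≤ t ∧ t ≤ ov.s + ov.L ∧ (t : ZMod σ.n) = j := by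
  obtain ⟨t, h1, h2, h3⟩ := σ.exists_cast_eq (ov.s + 1 - ov.gap) j
  exact ⟨t, h1, by unfold gap at h2; omega, h3⟩

variable {k : Type u} [Field k] [Fintype V]

open Classical in
/-- The component `f_L` of the graph map. -/
def leftRow (c : ℤ → kˣ) (j : ZMod σ.n) : ℤ →₀ Alg k Q :=
  if ov.fL ≠ [] ∧ ((ov.s - 1 : ℤ) : ZMod σ.n) = j then
    (c (ov.s - 1) : k) • pathElt k Q ov.fL • (τ.matrixComplex k).basis (ov.p - 1) else 0

open Classical in
/-- The component `f_R` of the graph map. -/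
def rightRow (c : ℤ → kˣ) (j : ZMod σ.n) : ℤ →₀ Alg k Q :=
  if ov.fR ≠ [] ∧ ((ov.s + ov.L + 1 : ℤ) : ZMod σ.n) = j then
    (c (ov.s + ov.L + 1) : k) • pathElt k Q ov.fR • (τ.matrixComplex k).basis (ov.p + ov.L + 1)
  else 0

theorem endRow_eq_add (c : ℤ → kˣ) (j : ZMod σ.n) :
    ov.endRow c j = ov.leftRow c j + ov.rightRow c j := by
  unfold endRow leftRow rightRow
  congr 1
  · split_ifs with h
    · rw [HString.basis_eq, Finsupp.smul_single (pathElt k Q ov.fL), smul_eq_mul,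
        pathElt_mul_vert k Q (ov.joins_fL h.1)]
    · rfl
  · split_ifs with h
    · rw [HString.basis_eq, Finsupp.smul_single (pathElt k Q ov.fR), smul_eq_mul,
        pathElt_mul_vert k Q (ov.joins_fR h.1)]
    · rfl

theorem graphRow_of_gap (c : ℤ → kˣ) {t : ℤ} (h : ov.s + 1 - ov.gap ≤ t) (h' : t < ov.s) :
    ov.graphRow (k := k) c (t : ZMod σ.n) = ov.endRow c (t : ZMod σ.n) := by
  rw [graphRow_eq, Finset.sum_eq_zero, zero_add]
  intro r hr
  have := Finset.mem_range.mp hr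
  unfold gap at h
  rw [if_neg]
  rw [σ.cast_eq_iff (by omega) (by omega)]
  omega

/-- The overlap has at most n positions, so no two of them are congruent and just one identity
starts at each of its classes. -/
theorem graphRow_of_overlap (h0 : 0 < ov.gap) (c : ℤ → kˣ) {q : ℤ} (h : ov.p ≤ q)
    (h' : q ≤ ov.p + ov.L) :
    ov.graphRow (k := k) c ((ov.s + (q - ov.p) : ℤ) : ZMod σ.n) =
      (c (ov.s + (q - ov.p)) : k) • (τ.matrixComplex k).basis q +
        ov.endRow c ((ov.s + (q - ov.p) : ℤ) : ZMod σ.n) := by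
  unfold gap at h0
  rw [graphRow_eq, Finset.sum_eq_single (q - ov.p).toNat]
  · rw [if_pos (by congr 1; omega), show ((q - ov.p).toNat : ℤ) = q - ov.p by omega,
      add_sub_cancel]
  · intro r hr hne
    have := Finset.mem_range.mp hr
    rw [if_neg]
    rw [σ.cast_eq_iff (by omega) (by omega)]
    omega
  · intro hr
    exact absurd (Finset.mem_range.mpr (by omega)) hr

section Maps

variable (c : ℤ → kˣ)

/-- The scalars of the homotopy equivalence at the positions of the band outside the overlap. -/
def gapScalar (t : ℤ) : kˣ := (-1) ^ (ov.s - 1 - t) * c t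

/-- The scalar of the homotopy equivalence to the right of the overlap. -/
def rightScalar : kˣ := c (ov.s + ov.L + 1) * (ov.gapScalar c (ov.s + 1 - ov.gap))⁻¹

open Classical in
/-- The inclusion of the common positions of `τ` and the replaced string into `τ`. -/
def stringIncl (i : ℤ) : ℤ →₀ Alg k Q :=
  if i < ov.p then (τ.matrixComplex k).basis i
  else if i + 1 < ov.p + ov.gap then 0
  else (ov.rightScalar c : k) • (τ.matrixComplex k).basis (i + (ov.L + 2 - ov.gap))

open Classical in
/-- The projection from `τ` to the replaced string. -/
def stringProj (q : ℤ) : ℤ →₀ Alg k Q :=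
  if q < ov.p then Finsupp.single q (vert k Q (τ.v q))
  else if q ≤ ov.p + ov.L then 0
  else (((ov.rightScalar c)⁻¹ : kˣ) : k) •
    Finsupp.single (q - (ov.L + 2 - ov.gap)) (vert k Q (τ.v q))

open Classical in
/-- The inclusion of the common positions of the band and the replaced string into the band. -/
def bandIncl (i : ℤ) : ZMod σ.n →₀ Alg k Q :=
  if ov.p ≤ i ∧ i + 1 < ov.p + ov.gap then
    (((ov.gapScalar c (ov.s - 1 - (i - ov.p)))⁻¹ : kˣ) : k) •
      Finsupp.single ((ov.s - 1 - (i - ov.p) : ℤ) : ZMod σ.n)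
        (vert k Q (σ.v (ov.s - 1 - (i - ov.p))))
  else 0

open Classical in
/-- The projection from the band to the replaced string. -/
def bandProj (j : ZMod σ.n) : ℤ →₀ Alg k Q :=
  if ov.rep j < ov.s then
    (ov.gapScalar c (ov.rep j) : k) • Finsupp.single (ov.p + (ov.s - 1 - ov.rep j))
      (vert k Q (σ.v (ov.rep j)))
  else 0

variable {c}

theorem bandProj_of_gap {t : ℤ} (h : ov.s + 1 - ov.gap ≤ t) (h' : t < ov.s) :
    ov.bandProj c (t : ZMod σ.n) = (ov.gapScalar c t : k) •
      Finsupp.single (ov.p + (ov.s - 1 - t)) (vert k Q (σ.v t)) := by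
  rw [bandProj, ov.rep_cast h (by omega), if_pos h']

theorem bandProj_of_overlap (h0 : 0 < ov.gap) {t : ℤ} (h : ov.s ≤ t) (h' : t ≤ ov.s + ov.L) :
    ov.bandProj (k := k) c (t : ZMod σ.n) = 0 := by
  rw [bandProj, ov.rep_cast (by omega) (by omega), if_neg (by omega)]

theorem bandIncl_of_gap (d : ℤ) (lam : kˣ) {i : ℤ} (h : ov.p ≤ i) (h' : i + 1 < ov.p + ov.gap) :
    ov.bandIncl c i = (((ov.gapScalar c (ov.s - 1 - (i - ov.p)))⁻¹ : kˣ) : k) •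
      (σ.matrixComplex k d lam).basis ((ov.s - 1 - (i - ov.p) : ℤ) : ZMod σ.n) := by
  rw [bandIncl, if_pos ⟨h, h'⟩, HBand.basis_cast]

theorem bandIncl_of_lt {i : ℤ} (h : i < ov.p) : ov.bandIncl (k := k) c i = 0 :=
  if_neg (by omega)

theorem bandIncl_of_ge {i : ℤ} (h : ov.p + ov.gap ≤ i + 1) : ov.bandIncl (k := k) c i = 0 :=
  if_neg (by omega)

theorem stringIncl_of_lt {i : ℤ} (h : i < ov.p) :
    ov.stringIncl c i = (τ.matrixComplex k).basis i := if_pos h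

theorem stringIncl_of_gap {i : ℤ} (h : ov.p ≤ i) (h' : i + 1 < ov.p + ov.gap) :
    ov.stringIncl (k := k) c i = 0 := by
  rw [stringIncl, if_neg (by omega), if_pos h']

theorem stringIncl_of_ge (h0 : 0 < ov.gap) {i : ℤ} (h : ov.p + ov.gap ≤ i + 1) :
    ov.stringIncl c i =
      (ov.rightScalar c : k) • (τ.matrixComplex k).basis (i + (ov.L + 2 - ov.gap)) := by
  rw [stringIncl, if_neg (by omega), if_neg (by omega)]

theorem stringProj_of_lt {q : ℤ} (h : q < ov.p) :
    ov.stringProj c q = Finsupp.single q (vert k Q (τ.v q)) := if_pos h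

theorem stringProj_of_overlap {q : ℤ} (h : ov.p ≤ q) (h' : q ≤ ov.p + ov.L) :
    ov.stringProj (k := k) c q = 0 := by
  rw [stringProj, if_neg (by omega), if_pos h']

theorem stringProj_of_gt {q : ℤ} (h : ov.p + ov.L < q) :
    ov.stringProj c q = (((ov.rightScalar c)⁻¹ : kˣ) : k) •
      Finsupp.single (q - (ov.L + 2 - ov.gap)) (vert k Q (τ.v q)) := by
  rw [stringProj, if_neg (by omega), if_neg (by omega)]

variable (hQ : Q.IsGentle) (h0 : 0 < ov.gap)

theorem surgery_basis_left {i : ℤ} (h : i < ov.p) : ((ov.surgery hQ h0).matrixComplex k).basis i =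
    Finsupp.single i (vert k Q (τ.v i)) := by
  rw [HString.basis_eq]
  change Finsupp.single i (vert k Q (ov.piecewise τ.v σ.v i)) = _
  rw [piecewise_left h]

theorem surgery_basis_mid {i : ℤ} (h : ov.p ≤ i) (h' : i + 1 < ov.p + ov.gap) :
    ((ov.surgery hQ h0).matrixComplex k).basis i =
    Finsupp.single i (vert k Q (σ.v (ov.s - 1 - (i - ov.p)))) := by
  rw [HString.basis_eq]
  change Finsupp.single i (vert k Q (ov.piecewise τ.v σ.v i)) = _
  rw [piecewise_mid h h']

theorem surgery_basis_right {i : ℤ} (h : ov.p + ov.gap ≤ i + 1) :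
    ((ov.surgery hQ h0).matrixComplex k).basis i =
    Finsupp.single i (vert k Q (τ.v (i + (ov.L + 2 - ov.gap)))) := by
  rw [HString.basis_eq]
  change Finsupp.single i (vert k Q (ov.piecewise τ.v σ.v i)) = _
  rw [piecewise_right h0 h]

theorem isMatrix_bandIncl (d : ℤ) (lam : kˣ) :
    IsMatrix ((ov.surgery hQ h0).matrixComplex k) (σ.matrixComplex k d lam) 1
      (ov.bandIncl c) := by
  intro i _
  by_cases h : ov.p ≤ i ∧ i + 1 < ov.p + ov.gap
  · rw [ov.bandIncl_of_gap d lam h.1 h.2]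
    refine smul_mem_cell _ ?_
    change _ ∈ cell _ (ov.piecewise τ.v σ.v i) (ov.piecewise τ.deg (fun t => σ.deg t - 1) i + 1)
    rw [piecewise_mid h.1 h.2, piecewise_mid h.1 h.2, sub_add_cancel, ← HBand.v_cast σ k d lam,
      ← HBand.deg_cast σ k d lam]
    exact basis_mem_cell _ (Set.mem_univ _)
  · rw [bandIncl, if_neg h]
    exact zero_mem _

theorem isMatrix_bandProj (d : ℤ) (lam : kˣ) :
    IsMatrix (σ.matrixComplex k d lam) ((ov.surgery hQ h0).matrixComplex k) (-1)
      (ov.bandProj c) := by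
  intro j _
  obtain ⟨t, h1, h2, rfl⟩ := ov.exists_cast_eq_of_gap j
  rcases lt_or_ge t ov.s with h | h
  · rw [ov.bandProj_of_gap h1 h]
    refine smul_mem_cell _ ?_
    have e : ov.s - 1 - (ov.p + (ov.s - 1 - t) - ov.p) = t := by ring
    have e1 : ov.p + (ov.s - 1 - t) + 1 < ov.p + ov.gap := by omega
    have e2 : ov.p ≤ ov.p + (ov.s - 1 - t) := by omega
    refine single_mem_cell (mem_surgeryJ_mid e2 e1) ?_ ?_ ?_
    · change ov.piecewise τ.deg (fun t => σ.deg t - 1) _ = _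
      rw [piecewise_mid e2 e1, e, HBand.deg_cast, sub_eq_add_neg]
    · rw [HBand.v_cast, vert_mul_self]
    · change vert k Q (σ.v t) * vert k Q (ov.piecewise τ.v σ.v _) = _
      rw [piecewise_mid e2 e1, e, vert_mul_self]
  · rw [ov.bandProj_of_overlap h0 h h2]
    exact zero_mem _

theorem isMatrix_stringIncl :
    IsMatrix ((ov.surgery hQ h0).matrixComplex k) (τ.matrixComplex k) 0 (ov.stringIncl c) := by
  intro i hi
  change i ∈ ov.surgeryJ at hi
  change _ ∈ cell _ (ov.piecewise τ.v σ.v i) (ov.piecewise τ.deg (fun t => σ.deg t - 1) i + 0)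
  rcases lt_or_ge i ov.p with h | h
  · rw [ov.stringIncl_of_lt h, piecewise_left h, piecewise_left h, add_zero]
    rw [mem_surgeryJ_left h0 h] at hi
    exact (τ.matrixComplex k).basis_mem_cell hi
  rcases lt_or_ge (i + 1) (ov.p + ov.gap) with h1 | h1
  · rw [ov.stringIncl_of_gap h h1]
    exact zero_mem _
  · rw [ov.stringIncl_of_ge h0 h1, piecewise_right h0 h1, piecewise_right h0 h1, add_zero]
    rw [mem_surgeryJ_right h0 h1] at hi
    exact smul_mem_cell _ ((τ.matrixComplex k).basis_mem_cell hi)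

theorem isMatrix_stringProj :
    IsMatrix (τ.matrixComplex k) ((ov.surgery hQ h0).matrixComplex k) 0 (ov.stringProj c) := by
  intro q hq
  change q ∈ τ.J at hq
  rcases lt_or_ge q ov.p with h | h
  · rw [ov.stringProj_of_lt h]
    refine single_mem_cell ((mem_surgeryJ_left h0 h).mpr hq) ?_ (vert_mul_self k Q _) ?_
    · change ov.piecewise τ.deg (fun t => σ.deg t - 1) q = τ.deg q + 0
      rw [piecewise_left h, add_zero]
    · change _ * vert k Q (ov.piecewise τ.v σ.v q) = _
      rw [piecewise_left h, vert_mul_self]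
  rcases lt_or_ge (ov.p + ov.L) q with h1 | h1
  · rw [ov.stringProj_of_gt h1]
    have e : q - (ov.L + 2 - ov.gap) + (ov.L + 2 - ov.gap) = q := by ring
    have e1 : ov.p + ov.gap ≤ q - (ov.L + 2 - ov.gap) + 1 := by omega
    refine smul_mem_cell _ (single_mem_cell ((mem_surgeryJ_right h0 e1).mpr (e.symm ▸ hq)) ?_
      (vert_mul_self k Q _) ?_)
    · change ov.piecewise τ.deg (fun t => σ.deg t - 1) _ = τ.deg q + 0
      rw [piecewise_right h0 e1, e, add_zero]
    · change _ * vert k Q (ov.piecewise τ.v σ.v _) = _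
      rw [piecewise_right h0 e1, e, vert_mul_self]
  · rw [ov.stringProj_of_overlap h h1]
    exact zero_mem _

theorem inv_smul_smul_self {M : Type*} [AddCommGroup M] [Module k M] (a : kˣ) (x : M) :
    ((a⁻¹ : kˣ) : k) • (a : k) • x = x := by
  rw [smul_smul, Units.inv_mul, one_smul]

theorem smul_inv_smul_self {M : Type*} [AddCommGroup M] [Module k M] (a : kˣ) (x : M) :
    (a : k) • ((a⁻¹ : kˣ) : k) • x = x := by
  rw [smul_smul, Units.mul_inv, one_smul]

variable (d : ℤ) (lam : kˣ)

theorem incl_proj {i : ℤ} (hi : i ∈ (ov.surgery hQ h0).J) :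
    rowMap (ov.bandProj c) (ov.bandIncl c i) + rowMap (ov.stringProj c) (ov.stringIncl c i) =
      ((ov.surgery hQ h0).matrixComplex k).basis i := by
  change i ∈ ov.surgeryJ at hi
  have hX := ov.isMatrix_bandProj (c := c) hQ h0 0 1
  have hY := ov.isMatrix_stringProj (c := c) hQ h0
  rcases lt_or_ge i ov.p with h | h
  · rw [mem_surgeryJ_left h0 h] at hi
    rw [ov.bandIncl_of_lt h, map_zero, zero_add, ov.stringIncl_of_lt h, hY.rowMap_basis hi,
      ov.stringProj_of_lt h, surgery_basis_left _ _ _ h]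
  rcases lt_or_ge (i + 1) (ov.p + ov.gap) with h1 | h1
  · rw [ov.stringIncl_of_gap h h1, map_zero, add_zero, ov.bandIncl_of_gap 0 1 h h1,
      LinearMap.map_smul_of_tower, hX.rowMap_basis (Set.mem_univ _),
      ov.bandProj_of_gap (by omega) (by omega), inv_smul_smul_self, surgery_basis_mid _ _ _ h h1]
    congr 1
    ring
  · rw [mem_surgeryJ_right h0 h1] at hi
    rw [ov.bandIncl_of_ge h1, map_zero, zero_add, ov.stringIncl_of_ge h0 h1,
      LinearMap.map_smul_of_tower, hY.rowMap_basis hi, ov.stringProj_of_gt (by omega),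
      smul_inv_smul_self, surgery_basis_right _ _ _ h1, add_sub_cancel_right]

theorem rowMap_stringIncl_bandProj (j : ZMod σ.n) :
    rowMap (ov.stringIncl c) (ov.bandProj c j) = 0 := by
  obtain ⟨t, h1, h2, rfl⟩ := ov.exists_cast_eq_of_gap j
  rcases lt_or_ge t ov.s with h | h
  · rw [ov.bandProj_of_gap h1 h, LinearMap.map_smul_of_tower, rowMap,
      Finsupp.linearCombination_single, ov.stringIncl_of_gap (by omega) (by omega), smul_zero,
      smul_zero]
  · rw [bandProj, ov.rep_cast h1 h2, if_neg (by omega), map_zero]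

theorem rowMap_bandIncl_stringProj (q : ℤ) :
    rowMap (ov.bandIncl c) (ov.stringProj c q) = 0 := by
  rcases lt_or_ge q ov.p with h | h
  · rw [ov.stringProj_of_lt h, rowMap, Finsupp.linearCombination_single, ov.bandIncl_of_lt h,
      smul_zero]
  rcases lt_or_ge (ov.p + ov.L) q with h1 | h1
  · rw [ov.stringProj_of_gt h1, LinearMap.map_smul_of_tower, rowMap,
      Finsupp.linearCombination_single, ov.bandIncl_of_ge (by omega), smul_zero, smul_zero]
  · rw [ov.stringProj_of_overlap h h1, map_zero]

theorem rowMap_retraction_stringIncl (i : ℤ) :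
    rowMap (ov.retraction c (ov.L + 1)) (ov.stringIncl c i) = 0 := by
  unfold stringIncl
  split_ifs with h h1
  · rw [rowMap_basis_eq_smul, retraction_of_lt _ _ _ h, smul_zero]
  · exact map_zero _
  · rw [LinearMap.map_smul_of_tower, rowMap_basis_eq_smul, retraction_of_ge _ _ _ (by omega),
      smul_zero, smul_zero]

theorem retraction_of_overlap {q : ℤ} (h : ov.p ≤ q) (h' : q ≤ ov.p + ov.L) :
    ov.retraction c (ov.L + 1) q = (((c (ov.s + (q - ov.p)))⁻¹ : kˣ) : k) •
      (σ.matrixComplex k d lam).basis ((ov.s + (q - ov.p) : ℤ) : ZMod σ.n) := by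
  rw [retraction, if_pos ⟨h, by omega⟩, HBand.basis_cast, Units.smul_def]

theorem rowMap_bandProj_retraction (h0 : 0 < ov.gap) (q : ℤ) :
    rowMap (ov.bandProj c) (ov.retraction (k := k) c (ov.L + 1) q) = 0 := by
  by_cases h : ov.p ≤ q ∧ q ≤ ov.p + ov.L
  · rw [ov.retraction_of_overlap 0 1 h.1 h.2, LinearMap.map_smul_of_tower, rowMap_basis_eq_smul,
      ov.bandProj_of_overlap h0 (by omega) (by omega), smul_zero, smul_zero]
  · rw [retraction, if_neg (by omega), map_zero]

/-- f_L and f_R end at p - 1 and p + L + 1, just outside the window on which the identities are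
inverted. -/
theorem rowMap_retraction_endRow (j : ZMod σ.n) :
    rowMap (ov.retraction (k := k) c (ov.L + 1)) (ov.endRow c j) = 0 := by
  have h1 : ov.retraction (k := k) c (ov.L + 1) (ov.p - 1) = 0 :=
    retraction_of_lt _ _ _ (by omega)
  have h2 : ov.retraction (k := k) c (ov.L + 1) (ov.p + ov.L + 1) = 0 :=
    retraction_of_ge _ _ _ (by omega)
  rw [endRow, map_add]
  split_ifs <;> simp [rowMap, h1, h2]

theorem rowMap_stringIncl_stringProj (h0 : 0 < ov.gap) {q : ℤ} (hq : q ∈ τ.J)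
    (h : q < ov.p ∨ ov.p + ov.L < q) :
    rowMap (ov.stringIncl c) (rowMap (ov.stringProj c) ((τ.matrixComplex k).basis q)) =
      (τ.matrixComplex k).basis q := by
  rw [rowMap_basis_eq_smul]
  have hv : vert k Q (τ.v q) • (τ.matrixComplex k).basis q = (τ.matrixComplex k).basis q :=
    ((τ.matrixComplex k).basis_mem_cell hq).2
  change rowMap _ (vert k Q (τ.v q) • _) = _
  rcases h with h | h
  · rw [ov.stringProj_of_lt h, map_smul, rowMap, Finsupp.linearCombination_single,
      ov.stringIncl_of_lt h, hv, hv]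
  · rw [ov.stringProj_of_gt h, map_smul, LinearMap.map_smul_of_tower, rowMap,
      Finsupp.linearCombination_single, ov.stringIncl_of_ge h0 (by omega), sub_add_cancel,
      smul_comm (vert k Q (τ.v q)) (ov.rightScalar c : k), inv_smul_smul_self, hv, hv]

theorem rowMap_stringIncl_stringProj_endRow (h0 : 0 < ov.gap) (j : ZMod σ.n) :
    rowMap (ov.stringIncl c) (rowMap (ov.stringProj c) (ov.endRow c j)) =
      ov.endRow (k := k) c j := by
  rw [endRow_eq_add, map_add, map_add, leftRow, rightRow]
  congr 1
  · split_ifs with h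
    · rw [LinearMap.map_smul_of_tower, LinearMap.map_smul_of_tower, map_smul, map_smul,
        ov.rowMap_stringIncl_stringProj h0 (ov.mem_left_of_ne h.1) (by omega)]
    · rw [map_zero, map_zero]
  · split_ifs with h
    · rw [LinearMap.map_smul_of_tower, LinearMap.map_smul_of_tower, map_smul, map_smul,
        ov.rowMap_stringIncl_stringProj h0 (ov.mem_right_of_ne h.1) (by omega)]
    · rw [map_zero, map_zero]

/-- The band minus its projection to the complement of the overlap. -/
theorem retraction_graphRow_complement (h0 : 0 < ov.gap) (j : ZMod σ.n) :
    rowMap (ov.retraction c (ov.L + 1)) (rowMap (ov.graphRow c)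
      ((σ.matrixComplex k d lam).basis j - rowMap (ov.bandIncl c) (ov.bandProj c j))) =
      (σ.matrixComplex k d lam).basis j - rowMap (ov.bandIncl c) (ov.bandProj c j) := by
  obtain ⟨t, h1, h2, rfl⟩ := ov.exists_cast_eq_of_gap j
  rcases lt_or_ge t ov.s with h | h
  · have e : rowMap (ov.bandIncl c) (ov.bandProj c (t : ZMod σ.n)) =
        (σ.matrixComplex k d lam).basis (t : ZMod σ.n) := by
      have e1 : ov.s - 1 - (ov.p + (ov.s - 1 - t) - ov.p) = t := by ring
      rw [ov.bandProj_of_gap h1 h, LinearMap.map_smul_of_tower, rowMap,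
        Finsupp.linearCombination_single, ov.bandIncl_of_gap d lam (by omega) (by omega), e1,
        smul_comm (vert k Q (σ.v t)), smul_inv_smul_self]
      have := ((σ.matrixComplex k d lam).basis_mem_cell (Set.mem_univ (t : ZMod σ.n))).2
      rwa [HBand.v_cast] at this
    rw [e, sub_self, map_zero, map_zero]
  · rw [ov.bandProj_of_overlap h0 h h2, map_zero, sub_zero,
      (ov.isMatrix_graphRow d lam c).rowMap_basis (Set.mem_univ _)]
    obtain ⟨r, rfl⟩ : ∃ r : ℕ, t = ov.s + r := ⟨(t - ov.s).toNat, by omega⟩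
    unfold gap at h0
    have := ov.rowMap_retraction_graphRow d lam c (N := ov.L + 1) (by omega) le_rfl
      (r := r) (by omega)
    rwa [Nat.cast_add, Nat.cast_one] at this

/-- For q in the overlap, subtracting F(r e_q) removes the generator and leaves only multiples of
f_L and f_R, which live at positions of τ outside the overlap. -/
theorem stringIncl_stringProj_complement (h0 : 0 < ov.gap) {q : ℤ} (hq : q ∈ τ.J) :
    rowMap (ov.stringIncl c) (rowMap (ov.stringProj c) ((τ.matrixComplex k).basis q -
      rowMap (ov.graphRow c) (ov.retraction c (ov.L + 1) q))) =
      (τ.matrixComplex k).basis q - rowMap (ov.graphRow c) (ov.retraction c (ov.L + 1) q) := by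
  by_cases h : ov.p ≤ q ∧ q ≤ ov.p + ov.L
  · have e : (τ.matrixComplex k).basis q -
        rowMap (ov.graphRow c) (ov.retraction c (ov.L + 1) q) =
        - ((((c (ov.s + (q - ov.p)))⁻¹ : kˣ) : k) •
          ov.endRow c ((ov.s + (q - ov.p) : ℤ) : ZMod σ.n)) := by
      rw [ov.retraction_of_overlap 0 1 h.1 h.2, LinearMap.map_smul_of_tower,
        (ov.isMatrix_graphRow 0 1 c).rowMap_basis (Set.mem_univ _),
        ov.graphRow_of_overlap h0 c h.1 h.2, smul_add, inv_smul_smul_self]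
      abel
    rw [e, map_neg, map_neg, LinearMap.map_smul_of_tower, LinearMap.map_smul_of_tower,
      rowMap_stringIncl_stringProj_endRow _ h0]
  · rw [retraction, if_neg (by omega), map_zero, sub_zero,
      ov.rowMap_stringIncl_stringProj h0 hq (by omega)]

end Maps

end Overlap

end Gentle

/-! ### Short overlaps: the differential on the rest of the band -/

namespace Gentle

open BoundQuiver MatrixComplex HWord

variable {V E : Type u} {Q : BoundQuiver V E}

namespace Overlap

variable {σ : HBand Q} {τ : HString Q} (ov : Overlap σ τ)

section Scalars

variable {ov} {k : Type u} [Field k] {d : ℤ} {lam : kˣ} {c : ℤ → kˣ}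

theorem gapScalar_eq_neg (t : ℤ) :
    ((-1 : kˣ) ^ (ov.s - 1 - t)) = - (-1 : kˣ) ^ (ov.s - 1 - (t + 1)) := by
  have e : ov.s - 1 - t = ov.s - 1 - (t + 1) + 1 := by ring
  rw [e, zpow_add_one, mul_neg_one]

/-- The alternating sign absorbs the minus sign of the band differential in the cone, and the
balance of c absorbs λ. With these scalars all the letters between inserted positions have
coefficient one. -/
theorem gapScalar_of_inverse (hc : IsBalanced σ d lam c) {t : ℤ}
    (ht : (σ.letter t).direct = false) : ov.gapScalar c t = - ov.gapScalar c (t + 1) := by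
  rw [gapScalar, gapScalar, hc.of_inverse ht, gapScalar_eq_neg, neg_mul]

theorem gapScalar_of_direct (hc : IsBalanced σ d lam c) {t : ℤ}
    (ht : (σ.letter t).direct = true) :
    (ov.gapScalar c t : k) = - (σ.scal k d lam t * ov.gapScalar c (t + 1)) := by
  rw [gapScalar, gapScalar, Units.val_mul, hc.of_direct ht, gapScalar_eq_neg]
  push_cast
  ring

theorem gapScalar_sub_one (c : ℤ → kˣ) : ov.gapScalar c (ov.s - 1) = c (ov.s - 1) := by
  simp [gapScalar]

theorem gapScalar_s (c : ℤ → kˣ) : ov.gapScalar c ov.s = - c ov.s := by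
  simp [gapScalar]

/-- The summands to the right of the overlap are rescaled so that f_R has, up to the scalar of its
starting position, coefficient one. -/
theorem rightScalar_mul (c : ℤ → kˣ) :
    ov.rightScalar c * ov.gapScalar c (ov.s + 1 - ov.gap) = c (ov.s + ov.L + 1) :=
  inv_mul_cancel_right _ _

end Scalars

variable (hQ : Q.IsGentle) (h0 : 0 < ov.gap)

theorem surgery_letter (i : ℤ) : (ov.surgery hQ h0).letter i = ov.surgeryLetter i := rfl

theorem mem_surgery (i : ℤ) : i ∈ (ov.surgery hQ h0).J ↔ i ∈ ov.surgeryJ := Iff.rfl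

variable {k : Type u} [Field k] [Fintype V]  {d : ℤ} {lam : kˣ} {c : ℤ → kˣ}

theorem rowMap_stringProj_leftRow_of_eq (hf : ov.fL ≠ []) {t : ℤ}
    (h : ((ov.s - 1 : ℤ) : ZMod σ.n) = (t : ZMod σ.n)) :
    rowMap (ov.stringProj c) (ov.leftRow c (t : ZMod σ.n)) =
      (c (ov.s - 1) : k) • Finsupp.single (ov.p - 1) (pathElt k Q ov.fL) := by
  rw [leftRow, if_pos ⟨hf, h⟩, LinearMap.map_smul_of_tower, map_smul, rowMap_basis_eq_smul,
    ov.stringProj_of_lt (by omega), Finsupp.smul_single, Finsupp.smul_single, smul_eq_mul,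
    smul_eq_mul]
  change _ • Finsupp.single _ (_ * (vert k Q (τ.v (ov.p - 1)) * _)) = _
  rw [vert_mul_self, pathElt_mul_vert k Q (ov.joins_fL hf)]

theorem rowMap_stringProj_rightRow_of_eq (hf : ov.fR ≠ []) {t : ℤ}
    (h : ((ov.s + ov.L + 1 : ℤ) : ZMod σ.n) = (t : ZMod σ.n)) :
    rowMap (ov.stringProj c) (ov.rightRow c (t : ZMod σ.n)) =
      (ov.gapScalar c (ov.s + 1 - ov.gap) : k) •
        Finsupp.single (ov.p + ov.gap - 1) (pathElt k Q ov.fR) := by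
  have e : ov.p + ov.L + 1 - (ov.L + 2 - ov.gap) = ov.p + ov.gap - 1 := by ring
  rw [rightRow, if_pos ⟨hf, h⟩, LinearMap.map_smul_of_tower, map_smul, rowMap_basis_eq_smul,
    ov.stringProj_of_gt (by omega), e]
  change _ • _ • vert k Q (τ.v (ov.p + ov.L + 1)) • _ • _ = _
  rw [smul_comm (vert k Q _) (((ov.rightScalar c)⁻¹ : kˣ) : k), Finsupp.smul_single, smul_eq_mul,
    vert_mul_self, smul_comm (pathElt k Q _) (((ov.rightScalar c)⁻¹ : kˣ) : k),
    Finsupp.smul_single, smul_eq_mul, pathElt_mul_vert k Q (ov.joins_fR hf), smul_smul,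
    ← rightScalar_mul (ov := ov) c, Units.val_mul, mul_right_comm, Units.mul_inv, one_mul]

theorem rowMap_stringProj_leftRow_of_ne {t : ℤ}
    (h : ov.fL ≠ [] → ((ov.s - 1 : ℤ) : ZMod σ.n) ≠ (t : ZMod σ.n)) :
    rowMap (ov.stringProj (k := k) c) (ov.leftRow c (t : ZMod σ.n)) = 0 := by
  rw [leftRow, if_neg (by tauto), map_zero]

theorem rowMap_stringProj_rightRow_of_ne {t : ℤ}
    (h : ov.fR ≠ [] → ((ov.s + ov.L + 1 : ℤ) : ZMod σ.n) ≠ (t : ZMod σ.n)) :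
    rowMap (ov.stringProj (k := k) c) (ov.rightRow c (t : ZMod σ.n)) = 0 := by
  rw [rightRow, if_neg (by tauto), map_zero]

/-- The band is read backwards, so its steps to the right become steps to the left. At t = s - 1 the
step leads into the overlap and is projected to zero; f_L takes its place, in accordance with the
merged letter, which is inverse exactly if f_L is nonempty. -/
theorem step_left_gap (hc : IsBalanced σ d lam c) {t : ℤ} (h : ov.s + 1 - ov.gap ≤ t)
    (h' : t < ov.s) :
    rowMap (ov.stringProj c) (ov.leftRow c (t : ZMod σ.n)) - σ.scal k d lam t •
      rowMap (ov.bandProj c) (σ.stepRight k (fun i : ℤ => (i : ZMod σ.n)) t) =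
    (ov.gapScalar c t : k) • (ov.surgery hQ h0).stepLeft k id (ov.p + (ov.s - 1 - t)) := by
  have hmem : ov.p + (ov.s - 1 - t) ∈ ov.surgeryJ := mem_surgeryJ_mid (by omega) (by omega)
  rcases (show t = ov.s - 1 ∨ t + 1 < ov.s by omega) with h1 | h1
  · have e : ov.p + (ov.s - 1 - t) = ov.p := by omega
    have hz : rowMap (ov.bandProj c) (σ.stepRight k (fun i : ℤ => (i : ZMod σ.n)) t) = 0 := by
      by_cases hd : (σ.letter t).direct = true
      · rw [rowMap_stepRight _ _ _ (σ.mem_J _) (σ.mem_J _) hd, 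
          ov.bandProj_of_overlap h0 (by omega) (by omega), smul_zero]
      · rw [stepRight_eq_zero _ _ fun _ _ => by simpa using hd, map_zero]
    have hl := surgeryLetter_mergeL (ov := ov) (i := ov.p - 1) (by omega) (by omega)
    rw [hz, smul_zero, sub_zero, e]
    by_cases hf : ov.fL = []
    · rw [rowMap_stringProj_leftRow_of_ne _ fun h => absurd hf h, stepLeft_eq_zero, smul_zero]
      intro _ _
      rw [surgery_letter, hl, Letter.merge, if_pos hf]
    · rw [ov.rowMap_stringProj_leftRow_of_eq hf (by rw [h1]), h1, gapScalar_sub_one, stepLeft,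
        if_pos, surgery_letter, hl, Letter.merge, if_neg hf, id]
      refine ⟨(mem_surgeryJ_left h0 (by omega)).mpr (ov.mem_left_of_ne hf), e ▸ hmem, ?_⟩
      rw [surgery_letter, hl, Letter.merge, if_neg hf]
  · have hl := surgeryLetter_mid (ov := ov) (i := ov.p + (ov.s - 1 - t) - 1) (by omega) (by omega)
    have e : ov.s - 1 - (ov.p + (ov.s - 1 - t) - 1 - ov.p) - 1 = t := by ring
    have hn : ((ov.s - 1 : ℤ) : ZMod σ.n) ≠ (t : ZMod σ.n) := by
      unfold gap at h
      rw [Ne, σ.cast_eq_iff (by omega) (by omega)]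
      omega
    rw [e] at hl
    rw [rowMap_stringProj_leftRow_of_ne _ fun _ => hn, zero_sub]
    by_cases hd : (σ.letter t).direct = true
    · have e1 : ov.p + (ov.s - 1 - (t + 1)) = ov.p + (ov.s - 1 - t) - 1 := by ring
      rw [rowMap_stepRight _ _ _ (σ.mem_J _) (σ.mem_J _) hd,
        ov.bandProj_of_gap (by omega) h1, stepLeft,
        if_pos ⟨mem_surgeryJ_mid (by omega) (by omega), hmem, by rw [surgery_letter, hl]; simp [hd]⟩,
        surgery_letter, hl, Letter.inv_path, id, e1, smul_comm (pathElt k Q _), smul_smul,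
        Finsupp.smul_single, smul_eq_mul,
        pathElt_mul_vert k Q (σ.path_of_direct (σ.mem_J _) (σ.mem_J _) hd),
        gapScalar_of_direct hc hd, neg_smul]
    · rw [stepRight_eq_zero _ _ fun _ _ => by simpa using hd, map_zero, smul_zero, neg_zero,
        stepLeft_eq_zero, smul_zero]
      intro _ _
      rw [surgery_letter, hl]
      simpa using hd

/-- The counterpart at the other end: from t = s + 1 - gap the band leads to a position congruent to
s + L, which is in the overlap, and f_R takes the place of this step. -/
theorem step_right_gap (hc : IsBalanced σ d lam c) {t : ℤ} (h : ov.s + 1 - ov.gap ≤ t)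
    (h' : t < ov.s) :
    rowMap (ov.stringProj c) (ov.rightRow c (t : ZMod σ.n)) -
      rowMap (ov.bandProj c) (σ.stepLeft k (fun i : ℤ => (i : ZMod σ.n)) t) =
    (ov.gapScalar c t : k) • (ov.surgery hQ h0).stepRight k id (ov.p + (ov.s - 1 - t)) := by
  have hmem : ov.p + (ov.s - 1 - t) ∈ ov.surgeryJ := mem_surgeryJ_mid (by omega) (by omega)
  rcases (show t = ov.s + 1 - ov.gap ∨ ov.s + 1 - ov.gap < t by omega) with h1 | h1
  · have e : ov.p + (ov.s - 1 - t) + 1 = ov.p + ov.gap - 1 := by omega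
    have e1 : ov.s + ov.L + 1 = t + σ.n := by unfold gap at h1; omega
    have hz : rowMap (ov.bandProj c) (σ.stepLeft k (fun i : ℤ => (i : ZMod σ.n)) t) = 0 := by
      by_cases hd : (σ.letter (t - 1)).direct = false
      · have e2 : t - 1 = ov.s + ov.L - σ.n := by omega
        have e3 : ((t - 1 : ℤ) : ZMod σ.n) = ((ov.s + ov.L : ℤ) : ZMod σ.n) := by
          rw [e2, ← σ.cast_add_n, sub_add_cancel]
        rw [rowMap_stepLeft _ _ _ (σ.mem_J _) (σ.mem_J _) hd, e3,
          ov.bandProj_of_overlap h0 (by omega) (by omega), smul_zero]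
      · rw [stepLeft_eq_zero _ _ fun _ _ => by simpa using hd, map_zero]
    have hl := surgeryLetter_mergeR (ov := ov) (i := ov.p + (ov.s - 1 - t)) (by omega) (by omega)
    rw [hz, sub_zero]
    by_cases hf : ov.fR = []
    · rw [rowMap_stringProj_rightRow_of_ne _ fun h => absurd hf h, stepRight_eq_zero, smul_zero]
      intro _ _
      rw [surgery_letter, hl, Letter.merge, if_pos hf]
      rfl
    · rw [ov.rowMap_stringProj_rightRow_of_eq hf (by rw [e1, σ.cast_add_n]), stepRight,
        if_pos, surgery_letter, hl, Letter.merge, if_neg hf, id, e, h1]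
      · rfl
      · refine ⟨hmem, (mem_surgeryJ_right h0 (by omega)).mpr ?_, ?_⟩
        · rw [e, show ov.p + ov.gap - 1 + (ov.L + 2 - ov.gap) = ov.p + ov.L + 1 by ring]
          exact ov.mem_right_of_ne hf
        · rw [surgery_letter, hl, Letter.merge, if_neg hf]
          rfl
  · have hl := surgeryLetter_mid (ov := ov) (i := ov.p + (ov.s - 1 - t)) (by omega) (by omega)
    have e : ov.s - 1 - (ov.p + (ov.s - 1 - t) - ov.p) - 1 = t - 1 := by ring
    have hn : ((ov.s + ov.L + 1 : ℤ) : ZMod σ.n) ≠ (t : ZMod σ.n) := by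
      have e1 : ov.s + ov.L + 1 = ov.s + 1 - ov.gap + σ.n := by unfold gap; ring
      rw [Ne, e1, σ.cast_add_n, σ.cast_eq_iff (by omega) (by unfold gap at *; omega)]
      omega
    rw [e] at hl
    rw [rowMap_stringProj_rightRow_of_ne _ fun _ => hn, zero_sub]
    by_cases hd : (σ.letter (t - 1)).direct = false
    · have e1 : ov.p + (ov.s - 1 - (t - 1)) = ov.p + (ov.s - 1 - t) + 1 := by ring
      have hy := ov.gapScalar_of_inverse hc hd
      rw [sub_add_cancel] at hy
      rw [rowMap_stepLeft _ _ _ (σ.mem_J _) (σ.mem_J _) hd,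
        ov.bandProj_of_gap (by omega) (by omega), stepRight,
        if_pos ⟨hmem, mem_surgeryJ_mid (by omega) (by omega), by rw [surgery_letter, hl]; simp [hd]⟩,
        surgery_letter, hl, Letter.inv_path, id, e1, smul_comm (pathElt k Q _),
        Finsupp.smul_single, smul_eq_mul,
        pathElt_mul_vert k Q (σ.path_of_inverse (σ.mem_J _) (σ.mem_J _) hd),
        hy, Units.val_neg, neg_smul, neg_neg]
    · rw [stepLeft_eq_zero _ _ fun _ _ => by simpa using hd, map_zero, neg_zero,
        stepRight_eq_zero, smul_zero]
      intro _ _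
      rw [surgery_letter, hl]
      simpa using hd

/-- The part of the differential of the replaced string which goes through the band. -/
def bandStep (d : ℤ) (lam : kˣ) (c : ℤ → kˣ) : (ZMod σ.n →₀ Alg k Q) →ₗ[Alg k Q] (ℤ →₀ Alg k Q) :=
  (rowMap (ov.stringProj c)).comp (rowMap (ov.graphRow c)) -
    (rowMap (ov.bandProj c)).comp (rowMap (σ.matrixComplex k d lam).d)

theorem rowMap_stringProj_graphRow (h0 : 0 < ov.gap) (t : ℤ) (h : ov.s + 1 - ov.gap ≤ t)
    (h' : t ≤ ov.s + ov.L) :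
    rowMap (ov.stringProj (k := k) c) (ov.graphRow c (t : ZMod σ.n)) =
      rowMap (ov.stringProj c) (ov.endRow c (t : ZMod σ.n)) := by
  rcases lt_or_ge t ov.s with h1 | h1
  · rw [ov.graphRow_of_gap c h h1]
  · obtain ⟨q, rfl⟩ : ∃ q, t = ov.s + (q - ov.p) := ⟨t - ov.s + ov.p, by ring⟩
    rw [ov.graphRow_of_overlap h0 c (by omega) (by omega), map_add, LinearMap.map_smul_of_tower,
      rowMap_basis_eq_smul, ov.stringProj_of_overlap (by omega) (by omega), smul_zero, smul_zero,
      zero_add]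

theorem bandStep_basis (h0 : 0 < ov.gap) (t : ℤ) (h : ov.s + 1 - ov.gap ≤ t)
    (h' : t ≤ ov.s + ov.L) :
    ov.bandStep d lam c ((σ.matrixComplex k d lam).basis (t : ZMod σ.n)) =
      (rowMap (ov.stringProj c) (ov.leftRow c (t : ZMod σ.n)) - σ.scal k d lam t •
        rowMap (ov.bandProj c) (σ.stepRight k (fun i : ℤ => (i : ZMod σ.n)) t)) +
      (rowMap (ov.stringProj c) (ov.rightRow c (t : ZMod σ.n)) -
        rowMap (ov.bandProj c) (σ.stepLeft k (fun i : ℤ => (i : ZMod σ.n)) t)) := by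
  rw [bandStep, LinearMap.sub_apply, LinearMap.comp_apply, LinearMap.comp_apply,
    (ov.isMatrix_graphRow d lam c).rowMap_basis (Set.mem_univ _),
    (isMatrix_d _).rowMap_basis (Set.mem_univ _), ov.rowMap_stringProj_graphRow h0 t h h',
    HBand.d_cast, endRow_eq_add, map_add, map_add, LinearMap.map_smul_of_tower]
  abel

end Overlap

end Gentle

/-! ### Short overlaps: zigzags through the two ends of the overlap -/

namespace Gentle

open BoundQuiver MatrixComplex HWord

variable {V E : Type u} {Q : BoundQuiver V E}

namespace Overlap

variable {σ : HBand Q} {τ : HString Q} (ov : Overlap σ τ)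

theorem cast_end : ((ov.s + ov.L + 1 : ℤ) : ZMod σ.n) =
    ((ov.s + 1 - ov.gap : ℤ) : ZMod σ.n) := by
  rw [← σ.cast_add_n (ov.s + 1 - ov.gap)]
  congr 1
  unfold gap
  ring

theorem cast_end' : ((ov.s + ov.L : ℤ) : ZMod σ.n) =
    ((ov.s - ov.gap : ℤ) : ZMod σ.n) := by
  rw [← σ.cast_add_n (ov.s - ov.gap)]
  congr 1
  unfold gap
  ring

variable {k : Type u} [Field k] [Fintype V] {d : ℤ} {lam : kˣ} {c : ℤ → kˣ}

/-- τ_L is on the strand of the letter s - 1 of the band, so it breaks against the letter s just as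
that letter does. -/
theorem pathElt_mul_left (hQ : Q.IsGentle) (hP : ov.p - 1 ∈ τ.J)
    (hd : (τ.letter (ov.p - 1)).direct = true) (hd' : (σ.letter ov.s).direct = true) :
    pathElt k Q (τ.letter (ov.p - 1)).path * pathElt k Q (σ.letter ov.s).path = 0 :=
  Letter.Break.mul_eq_zero_of_direct k
    (Letter.Break.of_same hQ (ov.joins_left hP) (σ.joins_letter _) (σ.joins_letter_sub_one _)
      (σ.joins_letter _) (σ.break_letter _)
      (ov.left_end.sameRight hP (σ.joins_letter_sub_one _) (ov.joins_left hP))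
      (σ.joins_letter _).sameLeft) hd hd'

theorem pathElt_mul_right (hQ : Q.IsGentle) (hP : ov.p + ov.L + 1 ∈ τ.J)
    (hd : (τ.letter (ov.p + ov.L)).direct = false)
    (hd' : (σ.letter (ov.s + ov.L - 1)).direct = false) :
    pathElt k Q (τ.letter (ov.p + ov.L)).path *
      pathElt k Q (σ.letter (ov.s + ov.L - 1)).path = 0 := by
  have h := ov.right_end.inv.sameRight hP (σ.joins_letter _).inv (ov.joins_right hP).inv
  rw [Letter.SameRight, Letter.inv_inv, Letter.inv_inv] at h
  exact Letter.Break.mul_eq_zero_of_inverse k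
    (Letter.Break.of_same hQ (σ.joins_letter_sub_one _) (ov.joins_right hP)
      (σ.joins_letter_sub_one _) (σ.joins_letter _) (σ.break_letter _)
      (σ.joins_letter_sub_one _).sameRight h) hd' hd

/-- A zigzag entering along τ_L cannot continue along the letter s, since that product is zero, nor
along f_L, since s and s - 1 are not congruent. It leaves along the letter s - 1, or along f_R if
that starts at the class of s. -/
theorem smul_bandStep_left (hQ : Q.IsGentle) (h0 : 0 < ov.gap) (hP : ov.p - 1 ∈ τ.J)
    (hd : (τ.letter (ov.p - 1)).direct = true) :
    pathElt k Q (τ.letter (ov.p - 1)).path • ov.bandStep d lam c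
      ((σ.matrixComplex k d lam).basis (ov.s : ZMod σ.n)) =
    pathElt k Q (τ.letter (ov.p - 1)).path •
      (rowMap (ov.stringProj c) (ov.rightRow c (ov.s : ZMod σ.n)) -
        rowMap (ov.bandProj c) (σ.stepLeft k (fun i : ℤ => (i : ZMod σ.n)) ov.s)) := by
  have hn := σ.two_le_n
  rw [bandStep_basis _ h0 _ (by omega) (by omega), smul_add,
    rowMap_stringProj_leftRow_of_ne, zero_sub, smul_neg, add_eq_right, neg_eq_zero, smul_comm]
  · by_cases hd' : (σ.letter ov.s).direct = true
    · rw [rowMap_stepRight _ _ _ (σ.mem_J _) (σ.mem_J _) hd', smul_smul,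
        ov.pathElt_mul_left hQ hP hd hd', zero_smul, smul_zero]
    · rw [stepRight_eq_zero _ _ fun _ _ => by simpa using hd', map_zero, smul_zero, smul_zero]
  · intro _
    rw [Ne, σ.cast_eq_iff (by omega) (by omega)]
    omega

theorem smul_bandStep_right (hQ : Q.IsGentle) (h0 : 0 < ov.gap) (hP : ov.p + ov.L + 1 ∈ τ.J)
    (hd : (τ.letter (ov.p + ov.L)).direct = false) :
    pathElt k Q (τ.letter (ov.p + ov.L)).path • ov.bandStep d lam c
      ((σ.matrixComplex k d lam).basis ((ov.s + ov.L : ℤ) : ZMod σ.n)) =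
    pathElt k Q (τ.letter (ov.p + ov.L)).path •
      (rowMap (ov.stringProj c) (ov.leftRow c ((ov.s + ov.L : ℤ) : ZMod σ.n)) -
        σ.scal k d lam (ov.s + ov.L) • rowMap (ov.bandProj c)
          (σ.stepRight k (fun i : ℤ => (i : ZMod σ.n)) (ov.s + ov.L))) := by
  have hn := σ.two_le_n
  rw [bandStep_basis _ h0 _ (by omega) (by omega), smul_add,
    rowMap_stringProj_rightRow_of_ne, zero_sub, smul_neg, add_eq_left, neg_eq_zero]
  · by_cases hd' : (σ.letter (ov.s + ov.L - 1)).direct = false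
    · rw [rowMap_stepLeft _ _ _ (σ.mem_J _) (σ.mem_J _) hd', smul_smul,
        ov.pathElt_mul_right hQ hP hd hd', zero_smul]
    · rw [stepLeft_eq_zero _ _ fun _ _ => by simpa using hd', map_zero, smul_zero]
  · intro _
    rw [Ne, σ.cast_eq_iff (by omega) (by omega)]
    omega

variable (hQ : Q.IsGentle) (h0 : 0 < ov.gap)

/-- For gap > 1 the surviving zigzag is τ_L followed by the inverse letter s - 1, present if f_L is
empty. For gap = 1 the position s - 1 is itself in the overlap modulo n, and the zigzag is τ_L
followed by f_R. Both are the merged letter whenever that is direct. -/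
theorem step_right_of_left_end (hc : IsBalanced σ d lam c) (hP : ov.p - 1 ∈ τ.J)
    (hd : (τ.letter (ov.p - 1)).direct = true) :
    pathElt k Q (τ.letter (ov.p - 1)).path •
      (rowMap (ov.stringProj c) (ov.rightRow c (ov.s : ZMod σ.n)) -
        rowMap (ov.bandProj c) (σ.stepLeft k (fun i : ℤ => (i : ZMod σ.n)) ov.s)) =
    - ((c ov.s : k) • (ov.surgery hQ h0).stepRight k id (ov.p - 1)) := by
  have hn := σ.two_le_n
  have hg : ov.gap = σ.n - ov.L := rfl
  have hP' : ov.p - 1 ∈ (ov.surgery hQ h0).J := (mem_surgeryJ_left h0 (by omega)).mpr hP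
  rcases (show ov.gap = 1 ∨ 1 < ov.gap by omega) with h1 | h1
  · have hz : rowMap (ov.bandProj c) (σ.stepLeft k (fun i : ℤ => (i : ZMod σ.n)) ov.s) = 0 := by
      by_cases hd : (σ.letter (ov.s - 1)).direct = false
      · rw [rowMap_stepLeft _ _ _ (σ.mem_J _) (σ.mem_J _) hd, ← h1, ← cast_end',
          ov.bandProj_of_overlap h0 (by omega) (by omega), smul_zero]
      · rw [stepLeft_eq_zero _ _ fun _ _ => by simpa using hd, map_zero]
    have hl := surgeryLetter_merge₂ (ov := ov) (i := ov.p - 1) (by omega) (by omega)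
    have hm : ov.p ∈ (ov.surgery hQ h0).J ↔ ov.p + ov.L + 1 ∈ τ.J := by
      rw [mem_surgery, mem_surgeryJ_right h0 (by omega)]
      rw [show ov.p + (ov.L + 2 - ov.gap) = ov.p + ov.L + 1 by omega]
    rw [hz, sub_zero]
    by_cases hf : ov.fR = []
    · rw [rowMap_stringProj_rightRow_of_ne _ fun h => absurd hf h, smul_zero,
        stepRight_eq_zero, smul_zero, neg_zero]
      intro _ _
      rw [surgery_letter, hl, Letter.merge₂, if_neg (by tauto)]
    · rw [ov.rowMap_stringProj_rightRow_of_eq hf (by rw [cast_end, h1, add_sub_cancel_right]), h1,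
        add_sub_cancel_right, gapScalar_s, stepRight, if_pos, surgery_letter, hl, Letter.merge₂,
        if_pos ⟨hf, hd⟩, smul_comm (pathElt k Q _), Finsupp.smul_single, smul_eq_mul,
        ← pathElt_append, add_sub_cancel_right, id, sub_add_cancel, Units.val_neg, neg_smul]
      refine ⟨hP', ?_, ?_⟩
      · rw [sub_add_cancel, hm]
        exact ov.mem_right_of_ne hf
      · rw [surgery_letter, hl, Letter.merge₂, if_pos ⟨hf, hd⟩]
  · have hl := surgeryLetter_mergeL (ov := ov) (i := ov.p - 1) (by omega) (by omega)
    have hm : ov.p - 1 + 1 ∈ (ov.surgery hQ h0).J := mem_surgeryJ_mid (by omega) (by omega)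
    rw [rowMap_stringProj_rightRow_of_ne, zero_sub, smul_neg]
    · congr 1
      by_cases hf : ov.fL = []
      · obtain ⟨hf', -⟩ | ⟨hf', -⟩ | ⟨-, h2, -⟩ := ov.left_end
        · exact absurd hf hf'
        · exact absurd hf hf'
        rw [Bool.not_eq_true] at h2
        have hcc := hc.of_inverse h2
        rw [sub_add_cancel] at hcc
        rw [rowMap_stepLeft _ _ _ (σ.mem_J _) (σ.mem_J _) h2, ov.bandProj_of_gap (by omega)
          (by omega), gapScalar_sub_one, sub_self, add_zero,
          smul_comm (pathElt k Q _) (c (ov.s - 1) : k),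
          smul_comm (pathElt k Q _) (c (ov.s - 1) : k), Finsupp.smul_single, smul_eq_mul,
          pathElt_mul_vert k Q (σ.path_of_inverse (σ.mem_J _) (σ.mem_J _) h2),
          Finsupp.smul_single, smul_eq_mul, ← pathElt_append, hcc, stepRight, if_pos,
          surgery_letter, hl, Letter.merge, if_pos hf, id, sub_add_cancel]
        refine ⟨hP', hm, ?_⟩
        rw [surgery_letter, hl, Letter.merge, if_pos hf]
      · rw [stepRight_eq_zero, smul_zero, stepLeft_eq_zero, map_zero, smul_zero]
        · intro _ _
          obtain ⟨-, -, h2, -⟩ | ⟨-, -, -, h2, -⟩ | ⟨h2, -⟩ := ov.left_end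
          · exact h2
          · exact absurd hd h2
          · exact absurd h2 hf
        · intro _ _
          rw [surgery_letter, hl, Letter.merge, if_neg hf]
    · intro _
      rw [Ne, cast_end, σ.cast_eq_iff (by omega) (by omega)]
      omega

/-- The mirror image at the right end, where the rescaling by `rightScalar` has to match the
coefficients of `f`. -/
theorem step_left_of_right_end (hc : IsBalanced σ d lam c) (hP : ov.p + ov.L + 1 ∈ τ.J)
    (hd : (τ.letter (ov.p + ov.L)).direct = false) :
    (ov.rightScalar c : k) • pathElt k Q (τ.letter (ov.p + ov.L)).path •
      (rowMap (ov.stringProj c) (ov.leftRow c ((ov.s + ov.L : ℤ) : ZMod σ.n)) -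
        σ.scal k d lam (ov.s + ov.L) • rowMap (ov.bandProj c)
          (σ.stepRight k (fun i : ℤ => (i : ZMod σ.n)) (ov.s + ov.L))) =
    - ((c (ov.s + ov.L) : k) • (ov.surgery hQ h0).stepLeft k id (ov.p + ov.gap - 1)) := by
  have hn := σ.two_le_n
  have hg : ov.gap = σ.n - ov.L := rfl
  have hP' : ov.p + ov.gap - 1 ∈ (ov.surgery hQ h0).J := by
    rw [mem_surgery, mem_surgeryJ_right h0 (by omega),
      show ov.p + ov.gap - 1 + (ov.L + 2 - ov.gap) = ov.p + ov.L + 1 by omega]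
    exact hP
  rcases (show ov.gap = 1 ∨ 1 < ov.gap by omega) with h1 | h1
  · have hz : rowMap (ov.bandProj c)
        (σ.stepRight k (fun i : ℤ => (i : ZMod σ.n)) (ov.s + ov.L)) = 0 := by
      by_cases hd : (σ.letter (ov.s + ov.L)).direct = true
      · rw [rowMap_stepRight _ _ _ (σ.mem_J _) (σ.mem_J _) hd, cast_end, h1, add_sub_cancel_right,
          ov.bandProj_of_overlap h0 (by omega) (by omega), smul_zero]
      · rw [stepRight_eq_zero _ _ fun _ _ => by simpa using hd, map_zero]
    have hl := surgeryLetter_merge₂ (ov := ov) (i := ov.p - 1) (by omega) (by omega)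
    rw [h1, add_sub_cancel_right] at hP' ⊢
    rw [hz, smul_zero, sub_zero]
    by_cases hf : ov.fL = []
    · rw [rowMap_stringProj_leftRow_of_ne _ fun h => absurd hf h, smul_zero, smul_zero,
        stepLeft_eq_zero, smul_zero, neg_zero]
      intro h2 _
      rw [mem_surgery, mem_surgeryJ_left h0 (by omega)] at h2
      rw [surgery_letter, hl]
      obtain ⟨-, -, h3, -⟩ | ⟨h3, -⟩ := EndCondition.merge₂_cases ov.left_end h2
        (ov.right_end_of_gap_eq_one h1) hP
      · rw [h3]
      · exact absurd hf h3
    · have h2 := ov.mem_left_of_ne hf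
      have h3 : Letter.merge₂ (τ.letter (ov.p - 1)) (τ.letter (ov.p + ov.L)) ov.fL ov.fR =
          ⟨(τ.letter (ov.p + ov.L)).path ++ ov.fL, false⟩ := by
        obtain ⟨-, -, -, ⟨h3, -⟩ | ⟨-, -, h3, -⟩⟩ | ⟨-, -, h3, -⟩ :=
          EndCondition.merge₂_cases ov.left_end h2 (ov.right_end_of_gap_eq_one h1) hP
        · rw [hd] at h3
          exact absurd h3 (by simp)
        · exact absurd h3 hf
        · exact h3
      obtain ⟨κ, hκ⟩ := hc.exists_monodromy
      have e1 : ov.s + ov.L = ov.s - 1 + σ.n := by unfold gap at h1; omega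
      have e2 : ov.s + ov.L + 1 = ov.s + σ.n := by omega
      -- For gap = 1 the right end lies one period after s - 1, so the right scalar is -κ, with κ
      -- the factor of c along a period.
      have hw : (ov.rightScalar c : k) * c (ov.s - 1) = - c (ov.s + ov.L) := by
        rw [rightScalar, h1, add_sub_cancel_right, gapScalar_s, e2, e1, hκ, hκ]
        push_cast
        field_simp
      rw [ov.rowMap_stringProj_leftRow_of_eq hf (by rw [e1, σ.cast_add_n]),
        smul_comm (pathElt k Q _), smul_smul, hw, Finsupp.smul_single, smul_eq_mul,
        ← pathElt_append, stepLeft, if_pos, surgery_letter, hl, h3, id, neg_smul]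
      refine ⟨(mem_surgeryJ_left h0 (by omega)).mpr h2, hP', ?_⟩
      rw [surgery_letter, hl, h3]
  · have hl := surgeryLetter_mergeR (ov := ov) (i := ov.p + ov.gap - 1 - 1) (by omega) (by omega)
    have hm : ov.p + ov.gap - 1 - 1 ∈ (ov.surgery hQ h0).J :=
      mem_surgeryJ_mid (by omega) (by omega)
    rw [rowMap_stringProj_leftRow_of_ne, zero_sub, smul_neg, smul_neg]
    · congr 1
      by_cases hf : ov.fR = []
      · obtain ⟨hf', -⟩ | ⟨hf', -⟩ | ⟨-, h2, -⟩ := ov.right_end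
        · exact absurd hf hf'
        · exact absurd hf hf'
        rw [Bool.not_eq_false] at h2
        have hw : (ov.rightScalar c : k) * (σ.scal k d lam (ov.s + ov.L) *
            ov.gapScalar c (ov.s + 1 - ov.gap)) = c (ov.s + ov.L) := by
          rw [hc.of_direct h2, ← rightScalar_mul (ov := ov) c, Units.val_mul]
          ring
        have e : ov.p + (ov.s - 1 - (ov.s + 1 - ov.gap)) = ov.p + ov.gap - 1 - 1 := by ring
        rw [rowMap_stepRight _ _ _ (σ.mem_J _) (σ.mem_J _) h2, cast_end,
          ov.bandProj_of_gap le_rfl (by omega), v_gap, e, smul_comm (pathElt k Q _) (ov.gapScalar c _ : k),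
          smul_comm (pathElt k Q _) (σ.scal k d lam _),
          smul_comm (pathElt k Q _) (ov.gapScalar c _ : k), Finsupp.smul_single, smul_eq_mul,
          pathElt_mul_vert k Q (σ.path_of_direct (σ.mem_J _) (σ.mem_J _) h2),
          Finsupp.smul_single, smul_eq_mul, ← pathElt_append, smul_smul, smul_smul, mul_assoc, hw,
          stepLeft, if_pos, surgery_letter, hl, Letter.merge, if_pos hf, id]
        · rfl
        · refine ⟨hm, hP', ?_⟩
          rw [surgery_letter, hl, Letter.merge, if_pos hf]
          rfl
      · rw [stepLeft_eq_zero, smul_zero, stepRight_eq_zero, map_zero, smul_zero, smul_zero,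
          smul_zero]
        · intro _ _
          obtain ⟨-, -, h2, -⟩ | ⟨-, -, -, h2, -⟩ | ⟨h2, -⟩ := ov.right_end
          · exact h2
          · exact absurd hd h2
          · exact absurd h2 hf
        · intro _ _
          rw [surgery_letter, hl, Letter.merge, if_neg hf]
          rfl
    · intro _
      rw [Ne, cast_end', σ.cast_eq_iff (by omega) (by omega)]
      omega

end Overlap

end Gentle

/-! ### Short overlaps: the full differential and the cone -/

namespace Gentle

open BoundQuiver MatrixComplex HWord

variable {V E : Type u} {Q : BoundQuiver V E}

namespace Overlap

variable {σ : HBand Q} {τ : HString Q} (ov : Overlap σ τ) {k : Type u} [Field k] [Fintype V]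
  {d : ℤ} {lam : kˣ} {c : ℤ → kˣ} (hQ : Q.IsGentle) (h0 : 0 < ov.gap)

theorem rowMap_smul {I I' : Type} (a : k) (F : I → I' →₀ Alg k Q) (x : I →₀ Alg k Q) :
    rowMap (fun i => a • F i) x = a • rowMap F x := by
  simp only [rowMap, Finsupp.linearCombination_apply, Finsupp.sum, Finset.smul_sum]
  exact Finset.sum_congr rfl fun i _ => smul_comm _ _ _

theorem rowMap_retraction_stepLeft {i : ℤ} (h : i ≤ ov.p) :
    rowMap (ov.retraction (k := k) c (ov.L + 1)) (τ.stepLeft k id i) = 0 := by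
  by_cases h1 : i - 1 ∈ τ.J ∧ i ∈ τ.J ∧ (τ.letter (i - 1)).direct = false
  · rw [rowMap_stepLeft _ _ _ h1.1 h1.2.1 h1.2.2, id, retraction_of_lt _ _ _ (by omega), smul_zero]
  · rw [stepLeft_eq_zero _ _ fun h2 h3 => by simpa [h2, h3] using h1, map_zero]

theorem rowMap_retraction_stepRight {i : ℤ} (h : ov.p + ov.L ≤ i) :
    rowMap (ov.retraction (k := k) c (ov.L + 1)) (τ.stepRight k id i) = 0 := by
  by_cases h1 : i ∈ τ.J ∧ i + 1 ∈ τ.J ∧ (τ.letter i).direct = true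
  · rw [rowMap_stepRight _ _ _ h1.1 h1.2.1 h1.2.2, id, retraction_of_ge _ _ _ (by omega), smul_zero]
  · rw [stepRight_eq_zero _ _ fun h2 h3 => by simpa [h2, h3] using h1, map_zero]

/-- Only the letter p - 1 is affected. It leads to a cancelled position, so its direct contribution
is zero and the zigzag through the band supplies the merged letter. -/
theorem stepRight_surgery_left (hc : IsBalanced σ d lam c) {i : ℤ} (hi : i ∈ τ.J) (h : i < ov.p) :
    (ov.surgery hQ h0).stepRight k id i =
      rowMap (ov.stringProj c) (τ.stepRight k id i) -
      ov.bandStep d lam c (rowMap (ov.retraction c (ov.L + 1)) (τ.stepRight k id i)) := by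
  rcases (show i + 1 < ov.p ∨ i = ov.p - 1 by omega) with h1 | rfl
  · have hr : rowMap (ov.retraction (k := k) c (ov.L + 1)) (τ.stepRight k id i) = 0 := by
      by_cases h2 : i ∈ τ.J ∧ i + 1 ∈ τ.J ∧ (τ.letter i).direct = true
      · rw [rowMap_stepRight _ _ _ h2.1 h2.2.1 h2.2.2, id, retraction_of_lt _ _ _ h1, smul_zero]
      · rw [stepRight_eq_zero _ _ fun h3 h4 => by simpa [h3, h4] using h2, map_zero]
    rw [hr, map_zero, sub_zero]
    refine (rowMap_stepRight_congr (mem_surgeryJ_left h0 h).symm (mem_surgeryJ_left h0 h1).symm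
      (fun _ _ => (surgeryLetter_left h1).symm) fun _ _ => ?_).symm
    rw [id, ov.stringProj_of_lt h1, ← HString.basis_eq k (ov.surgery hQ h0),
      surgery_basis_left _ _ _ h1]
  · by_cases hd : (τ.letter (ov.p - 1)).direct = true
    · have hp := ov.mem_p
      rw [rowMap_stepRight _ _ _ hi (by rwa [sub_add_cancel]) hd, id, sub_add_cancel,
        ov.stringProj_of_overlap le_rfl (by omega), smul_zero, zero_sub,
        rowMap_stepRight _ _ _ hi (by rwa [sub_add_cancel]) hd, id, sub_add_cancel,
        ov.retraction_of_overlap d lam le_rfl (by omega), sub_self, add_zero, map_smul,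
        LinearMap.map_smul_of_tower, smul_comm, ov.smul_bandStep_left hQ h0 hi hd,
        ov.step_right_of_left_end hQ h0 hc hi hd, smul_neg, inv_smul_smul_self, neg_neg]
    · rw [Bool.not_eq_true] at hd
      rw [stepRight_eq_zero τ.toHWord _ fun _ _ => hd, map_zero, map_zero, map_zero, sub_zero]
      refine stepRight_eq_zero _ _ fun h2 h3 => ?_
      rw [surgery_letter]
      rw [sub_add_cancel, mem_surgery] at h3
      rcases (show ov.gap = 1 ∨ 1 < ov.gap by omega) with h1 | h1
      · rw [surgeryLetter_merge₂ (by omega) h1, Letter.merge₂, if_neg (by simp [hd])]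
      · rw [surgeryLetter_mergeL (by omega) h1, Letter.merge, if_neg]
        intro hf
        obtain ⟨hf', -⟩ | ⟨hf', -⟩ | ⟨-, -, h4⟩ := ov.left_end
        · exact hf' hf
        · exact hf' hf
        · rw [(h4 hi).1] at hd
          simp at hd

theorem stepLeft_surgery_left {i : ℤ} (h : i < ov.p) :
    (ov.surgery hQ h0).stepLeft k id i = rowMap (ov.stringProj c) (τ.stepLeft k id i) := by
  refine (rowMap_stepLeft_congr (mem_surgeryJ_left h0 (by omega)).symm
    (mem_surgeryJ_left h0 h).symm
    (fun _ _ => (surgeryLetter_left (by omega)).symm) fun _ _ => ?_).symm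
  rw [id, ov.stringProj_of_lt (by omega), ← HString.basis_eq k (ov.surgery hQ h0),
    surgery_basis_left _ _ _ (by omega)]

theorem smul_stringProj_right {i : ℤ} (h : ov.p + ov.gap ≤ i + 1) :
    (ov.rightScalar c : k) • ov.stringProj c (i + (ov.L + 2 - ov.gap)) =
      Finsupp.single i (vert k Q ((ov.surgery hQ h0).v i)) := by
  rw [ov.stringProj_of_gt (by omega), smul_inv_smul_self, add_sub_cancel_right,
    ← HString.basis_eq k (ov.surgery hQ h0), surgery_basis_right _ _ _ h]

theorem stepRight_surgery_right {i : ℤ} (h : ov.p + ov.gap ≤ i + 1) :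
    (ov.surgery hQ h0).stepRight k id i = (ov.rightScalar c : k) •
      rowMap (ov.stringProj c) (τ.stepRight k id (i + (ov.L + 2 - ov.gap))) := by
  rw [← rowMap_smul]
  refine (rowMap_stepRight_congr (mem_surgeryJ_right h0 h).symm ?_
    (fun _ _ => (surgeryLetter_right h0 h).symm) fun _ _ => ?_).symm
  · rw [add_right_comm]
    exact (mem_surgeryJ_right h0 (by omega)).symm
  · rw [id, add_right_comm, id]
    exact ov.smul_stringProj_right hQ h0 (by omega)

/-- As at the left end: only the letter of τ following the overlap is replaced by a zigzag, and all
letters further right are just renumbered. -/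
theorem stepLeft_surgery_right (hc : IsBalanced σ d lam c) {i : ℤ}
    (hi : i + (ov.L + 2 - ov.gap) ∈ τ.J) (h : ov.p + ov.gap ≤ i + 1) :
    (ov.surgery hQ h0).stepLeft k id i = (ov.rightScalar c : k) •
      (rowMap (ov.stringProj c) (τ.stepLeft k id (i + (ov.L + 2 - ov.gap))) -
      ov.bandStep d lam c (rowMap (ov.retraction c (ov.L + 1))
        (τ.stepLeft k id (i + (ov.L + 2 - ov.gap))))) := by
  rcases (show ov.p + ov.gap ≤ i ∨ i = ov.p + ov.gap - 1 by omega) with h1 | rfl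
  · have e : i + (ov.L + 2 - ov.gap) - 1 = i - 1 + (ov.L + 2 - ov.gap) := by ring
    have hr : rowMap (ov.retraction (k := k) c (ov.L + 1))
        (τ.stepLeft k id (i + (ov.L + 2 - ov.gap))) = 0 := by
      by_cases h2 : i + (ov.L + 2 - ov.gap) - 1 ∈ τ.J ∧ i + (ov.L + 2 - ov.gap) ∈ τ.J ∧
          (τ.letter (i + (ov.L + 2 - ov.gap) - 1)).direct = false
      · rw [rowMap_stepLeft _ _ _ h2.1 h2.2.1 h2.2.2, id, retraction_of_ge _ _ _ (by omega),
          smul_zero]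
      · rw [stepLeft_eq_zero _ _ fun h3 h4 => by simpa [h3, h4] using h2, map_zero]
    rw [hr, map_zero, sub_zero, ← rowMap_smul]
    refine (rowMap_stepLeft_congr ?_ (mem_surgeryJ_right h0 h).symm ?_ fun _ _ => ?_).symm
    · rw [e]
      exact (mem_surgeryJ_right h0 (by omega)).symm
    · intro _ _
      rw [e]
      exact (surgeryLetter_right h0 (by omega)).symm
    · rw [id, e, id]
      exact ov.smul_stringProj_right hQ h0 (by omega)
  · have e : ov.p + ov.gap - 1 + (ov.L + 2 - ov.gap) = ov.p + ov.L + 1 := by ring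
    have hm := ov.mem_end
    rw [e] at hi ⊢
    by_cases hd : (τ.letter (ov.p + ov.L)).direct = false
    · have e1 : ov.p + ov.L + 1 - 1 = ov.p + ov.L := by ring
      have e2 : ov.s + (ov.p + ov.L - ov.p) = ov.s + ov.L := by ring
      have hd' : (τ.letter (ov.p + ov.L + 1 - 1)).direct = false := by rwa [e1]
      rw [rowMap_stepLeft _ _ _ (by rwa [e1]) hi hd', rowMap_stepLeft _ _ _ (by rwa [e1]) hi hd',
        id, e1, ov.stringProj_of_overlap (by omega) le_rfl, smul_zero, zero_sub,
        ov.retraction_of_overlap d lam (by omega) le_rfl, e2, map_smul,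
        LinearMap.map_smul_of_tower, smul_comm (pathElt k Q _) (((c _)⁻¹ : kˣ) : k),
        ov.smul_bandStep_right hQ h0 hi hd, ← smul_neg, smul_comm (ov.rightScalar c : k),
        smul_neg, ov.step_left_of_right_end hQ h0 hc hi hd, neg_neg, inv_smul_smul_self]
    · rw [Bool.not_eq_false] at hd
      rw [stepLeft_eq_zero τ.toHWord _ fun _ _ => by rwa [add_sub_cancel_right], map_zero, map_zero,
        map_zero, sub_zero, smul_zero]
      refine stepLeft_eq_zero _ _ fun h2 h3 => ?_
      rw [surgery_letter]
      rcases (show ov.gap = 1 ∨ 1 < ov.gap by omega) with h1 | h1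
      · rw [mem_surgery, mem_surgeryJ_left h0 (by omega), h1, add_sub_cancel_right] at h2
        rw [surgeryLetter_merge₂ (by omega) h1]
        obtain ⟨-, -, h4, -⟩ | ⟨-, h4, -⟩ := EndCondition.merge₂_cases ov.left_end h2
          (ov.right_end_of_gap_eq_one h1) hi
        · rw [h4]
        · rw [hd] at h4
          simp at h4
      · rw [surgeryLetter_mergeR (by omega) h1, Letter.merge, if_neg]
        · rfl
        intro hf
        obtain ⟨hf', -⟩ | ⟨hf', -⟩ | ⟨-, -, h4⟩ := ov.right_end
        · exact hf' hf
        · exact hf' hf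
        · rw [(h4 hi).1] at hd
          simp at hd

/-- This is the perturbed differential of Gaussian elimination, grouped by `bandStep`. Inserted
positions contribute only through the band; positions of τ contribute their own differential,
corrected by the zigzags through the cancelled identities. -/
theorem surgery_d (hc : IsBalanced σ d lam c) {i : ℤ} (hi : i ∈ (ov.surgery hQ h0).J) :
    ((ov.surgery hQ h0).matrixComplex k).d i = ov.bandStep d lam c (ov.bandIncl c i) +
      (rowMap (ov.stringProj c) (rowMap (τ.matrixComplex k).d (ov.stringIncl c i)) -
      ov.bandStep d lam c (rowMap (ov.retraction c (ov.L + 1))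
        (rowMap (τ.matrixComplex k).d (ov.stringIncl c i)))) := by
  rw [mem_surgery] at hi
  rw [HString.d_eq]
  rcases lt_or_ge i ov.p with h | h
  · rw [mem_surgeryJ_left h0 h] at hi
    rw [ov.bandIncl_of_lt h, map_zero, zero_add, ov.stringIncl_of_lt h,
      (isMatrix_d _).rowMap_basis hi, HString.d_eq, map_add, map_add,
      ov.rowMap_retraction_stepLeft h.le, add_zero, ov.stepRight_surgery_left hQ h0 hc hi h,
      ov.stepLeft_surgery_left hQ h0 h (c := c)]
    abel
  rcases lt_or_ge (i + 1) (ov.p + ov.gap) with h1 | h1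
  · rw [ov.stringIncl_of_gap h h1, map_zero, map_zero, map_zero, map_zero, sub_zero, add_zero,
      ov.bandIncl_of_gap d lam h h1, LinearMap.map_smul_of_tower,
      bandStep_basis _ h0 _ (by omega) (by omega), ov.step_left_gap hQ h0 hc (by omega) (by omega),
      ov.step_right_gap hQ h0 hc (by omega) (by omega), smul_add, inv_smul_smul_self,
      inv_smul_smul_self, show ov.p + (ov.s - 1 - (ov.s - 1 - (i - ov.p))) = i by ring, add_comm]
  · rw [mem_surgeryJ_right h0 h1] at hi
    rw [ov.bandIncl_of_ge h1, map_zero, zero_add, ov.stringIncl_of_ge h0 h1,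
      LinearMap.map_smul_of_tower, (isMatrix_d _).rowMap_basis hi, HString.d_eq,
      LinearMap.map_smul_of_tower, LinearMap.map_smul_of_tower, LinearMap.map_smul_of_tower,
      map_add, map_add, ov.rowMap_retraction_stepRight (by omega), zero_add, ← smul_sub,
      ov.stepRight_surgery_right hQ h0 h1 (c := c), ov.stepLeft_surgery_right hQ h0 hc hi h1,
      ← smul_add]
    congr 1
    abel

/-- The cone of the graph map of an overlap which is shorter than the band. -/
theorem iso_surgery (f : σ.complex k d lam ⟶ τ.complex k) (hf : ov.IsGraphMap f) :
    IsoInHomotopyCategory (CochainComplex.mappingCone f) ((ov.surgery hQ h0).complex k) := by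
  obtain ⟨c, hc, hfc⟩ := hf
  have hF := ov.isMatrix_graphRow d lam c
  have hB := ov.isMatrix_bandIncl (c := c) hQ h0 d lam
  refine isoInHomotopyCategory_mappingCone_of_elimination (B := σ.matrixComplex k d lam)
    (D := τ.matrixComplex k) (N := (ov.surgery hQ h0).matrixComplex k) f hfc
    hB (ov.isMatrix_bandProj (c := c) hQ h0 d lam)
    (ov.isMatrix_stringIncl (c := c) hQ h0) (ov.isMatrix_stringProj (c := c) hQ h0)
    (ov.isMatrix_retraction d lam c (N := ov.L + 1) le_rfl)
    (fun i hi => ov.incl_proj hQ h0 hi) (fun i _ => ov.rowMap_stringIncl_bandProj i)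
    (fun q _ => ov.rowMap_bandIncl_stringProj q) (fun i _ => ov.rowMap_retraction_stringIncl i)
    (fun q _ => ov.rowMap_bandProj_retraction h0 q) (fun i _ => ?_)
    (fun j _ => ov.retraction_graphRow_complement d lam h0 j)
    (fun q hq => ov.stringIncl_stringProj_complement h0 hq) (fun i hi => ?_)
  -- From a band position outside the overlap `f` has at most the components f_L and f_R, and the
  -- retraction kills them.
  · by_cases h : ov.p ≤ i ∧ i + 1 < ov.p + ov.gap
    · rw [ov.bandIncl_of_gap d lam h.1 h.2, LinearMap.map_smul_of_tower,
        LinearMap.map_smul_of_tower, hF.rowMap_basis (Set.mem_univ _),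
        ov.graphRow_of_gap c (by omega) (by omega), rowMap_retraction_endRow, smul_zero]
    · rw [bandIncl, if_neg h, map_zero, map_zero]
  · rw [ov.surgery_d hQ h0 hc hi]
    simp only [bandStep, LinearMap.sub_apply, LinearMap.comp_apply]
    abel

end Overlap

end Gentle

/-! ### The surgery as a reduced concatenation -/

namespace Gentle

open BoundQuiver MatrixComplex HWord

variable {V E : Type u} {Q : BoundQuiver V E}

theorem length_invList (w : List (Letter E)) : (invList w).length = w.length := by
  simp [invList]

namespace Overlap

variable {σ : HBand Q} {τ : HString Q} (ov : Overlap σ τ)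

/-- The rest of the band. -/
def complement : List (Letter E) := σ.segment (ov.s + ov.L) (σ.n - ov.L)

theorem rotation_eq_append (h : ov.L ≤ σ.n) : σ.rotation ov.s = ov.word ++ ov.complement := by
  rw [HBand.rotation, word, complement, ← segment_add, Nat.add_sub_cancel' h]

theorem length_complement (h0 : 0 < ov.gap) :
    ((invList ov.complement).length : ℤ) = ov.gap := by
  rw [length_invList, complement, length_segment]
  unfold gap at *
  omega

theorem getElem?_complement (h0 : 0 < ov.gap) {r : ℕ} {x : Letter E}
    (hx : (invList ov.complement)[r]? = some x) :
    r < ov.gap ∧ x = (σ.letter (ov.s - 1 - r)).inv := by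
  obtain ⟨hr, hx⟩ := List.getElem?_eq_some_iff.mp hx
  have hl := ov.length_complement h0
  refine ⟨by omega, ?_⟩
  rw [← hx]
  unfold gap at hl h0
  simp only [invList, complement, HWord.segment, List.getElem_reverse, List.getElem_map,
    List.getElem_range, List.length_map, List.length_range]
  rw [← σ.letter_sub]
  congr 2
  omega

/-- The inverse of α has gap letters and gap - 1 inner positions; its letter r ends up as the letter
p + r - 1 of the new string, since the two ends of the overlap are no longer positions. -/
theorem isReducedConcat_surgery (hQ : Q.IsGentle) (h0 : 0 < ov.gap) :
    IsReducedConcat (ov.surgery hQ h0).toHWord ov.p (τ.leftPart ov.p ov.mem_p).toHWord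
      (invList ov.complement) (fun r => σ.v (ov.s - r)) (fun r => σ.deg (ov.s - r) - 1)
      (τ.rightPart (ov.p + ov.L) ov.mem_end).toHWord where
  ne_nil h := by
    have := ov.length_complement h0
    simp [h] at this
    omega
  mem i := by
    rw [ov.length_complement h0, mem_surgery]
    have e : ov.p + ov.L + (i + 2 - ov.p - ov.gap) = i + (ov.L + 2 - ov.gap) := by ring
    change i ∈ ov.surgeryJ ↔ (i < ov.p ∧ i ≤ ov.p ∧ i ∈ τ.J) ∨ _ ∨
      (_ ∧ 0 ≤ i + 2 - ov.p - ov.gap ∧ ov.p + ov.L + (i + 2 - ov.p - ov.gap) ∈ τ.J)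
    rw [e]
    refine ⟨?_, ?_⟩
    · rintro (h | h | h)
      · exact Or.inl ⟨h.1, h.1.le, h.2⟩
      · exact Or.inr (Or.inl h)
      · exact Or.inr (Or.inr ⟨h.1, by omega, h.2⟩)
    · rintro (h | h | h)
      · exact Or.inl ⟨h.1, h.2.2⟩
      · exact Or.inr (Or.inl h)
      · exact Or.inr (Or.inr ⟨h.1, h.2.2⟩)
  left_v i _ h := piecewise_left h
  left_deg i _ h := piecewise_left (g := fun t => σ.deg t - 1) h
  left_letter i _ h := surgeryLetter_left h
  middle_v i _ h h' := by
    rw [ov.length_complement h0] at h'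
    change ov.piecewise τ.v σ.v i = σ.v (ov.s - (i + 1 - ov.p))
    rw [piecewise_mid h h']
    congr 1
    ring
  middle_deg i _ h h' := by
    rw [ov.length_complement h0] at h'
    change ov.piecewise τ.deg (fun t => σ.deg t - 1) i = σ.deg (ov.s - (i + 1 - ov.p)) - 1
    rw [piecewise_mid h h']
    congr 2
    ring
  middle_letter r x hx h h' := by
    have hl := ov.length_complement h0
    obtain ⟨hr, rfl⟩ := ov.getElem?_complement h0 hx
    rw [mem_surgery] at h h'
    change (ov.surgeryLetter _).elt = (if r = 0 then (τ.letter _).elt else 1) * _ *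
      (if r + 1 = _ then (τ.letter (ov.p + ov.L + 0)).elt else 1)
    rw [add_zero, Letter.elt_inv]
    -- The first letter is merged with τ_L, the last one with τ_R; for gap = 1 these are the same
    -- letter.
    rcases (show r = 0 ∨ 0 < r by omega) with rfl | h1
    · rw [Nat.cast_zero, add_zero] at h h'
      rw [mem_surgeryJ_left h0 (by omega)] at h
      rw [if_pos rfl, Nat.cast_zero, add_zero, sub_zero]
      rcases (show ov.gap = 1 ∨ 1 < ov.gap by omega) with h2 | h2
      · rw [mem_surgeryJ_right h0 (by omega),
          show ov.p + (ov.L + 2 - ov.gap) = ov.p + ov.L + 1 by omega] at h'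
        rw [if_pos (by omega), surgeryLetter_merge₂ (by omega) h2]
        exact EndCondition.merge₂_elt ov.left_end h (ov.right_end_of_gap_eq_one h2) h'
      · rw [if_neg (by omega), mul_one, surgeryLetter_mergeL (by omega) h2]
        exact ov.left_end.merge_elt h
    · rw [if_neg (by omega), one_mul]
      rcases (show (r : ℤ) + 1 < ov.gap ∨ (r : ℤ) + 1 = ov.gap by omega) with h2 | h2
      · rw [if_neg (by omega), mul_one, surgeryLetter_mid (by omega) (by omega), Letter.elt_inv]
        congr 3
        ring
      · rw [mem_surgeryJ_right h0 (by omega),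
          show ov.p + r + (ov.L + 2 - ov.gap) = ov.p + ov.L + 1 by omega] at h'
        rw [if_pos (by omega), surgeryLetter_mergeR (by omega) (by omega), Letter.elt_inv,
          ov.right_end.inv.merge_elt h', Letter.elt_inv, Letter.elt_inv, ← letter_gap,
          show ov.s - 1 - (r : ℤ) = ov.s - ov.gap by omega]
        simp
  right_v i _ h := by
    rw [ov.length_complement h0] at h ⊢
    change ov.piecewise τ.v σ.v i = τ.v (ov.p + ov.L + (i + 2 - ov.p - ov.gap))
    rw [piecewise_right h0 h]
    congr 1
    ring
  right_deg i _ h := by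
    rw [ov.length_complement h0] at h ⊢
    change ov.piecewise τ.deg (fun t => σ.deg t - 1) i =
      τ.deg (ov.p + ov.L + (i + 2 - ov.p - ov.gap))
    rw [piecewise_right h0 h]
    congr 1
    ring
  right_letter i _ _ h := by
    rw [ov.length_complement h0] at h ⊢
    change ov.surgeryLetter i = τ.letter (ov.p + ov.L + (i + 2 - ov.p - ov.gap))
    rw [surgeryLetter_right h0 h]
    congr 1
    ring

theorem elt_fL (h : ov.fL ≠ []) : (τ.letter (ov.p - 1)).elt * (σ.letter (ov.s - 1)).elt⁻¹ =
    (ov.fL.map FreeGroup.of).prod⁻¹ := by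
  rw [← ov.left_end.merge_elt (ov.mem_left_of_ne h), Letter.merge, if_neg h]
  rfl

theorem elt_fR (h : ov.fR ≠ []) : (σ.letter (ov.s + ov.L)).elt⁻¹ * (τ.letter (ov.p + ov.L)).elt =
    (ov.fR.map FreeGroup.of).prod := by
  have := ov.right_end.inv.merge_elt (ov.mem_right_of_ne h)
  rw [Letter.merge, if_neg h, Letter.elt_inv, Letter.elt_inv, inv_inv] at this
  rw [← inv_inj, mul_inv_rev, inv_inv, ← this]
  rfl

end Overlap

end Gentle

end

theorem theorem2p2 {V E k : Type u} [Fintype V] [Finite E] [Field k]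
    (Q : BoundQuiver V E) (hQ : Q.IsGentle)
    (σ : HBand Q) (τ : HString Q)
    (d : ℤ) (hd : (σ.letter d).direct = true) (lam : kˣ)
    (ov : Overlap σ τ) (f : σ.complex k d lam ⟶ τ.complex k) (hf : ov.IsGraphMap f) :
    -- the overlap is a proper subword of the band
    ((∃ r, ov.word <:+: σ.rotation r ∧ ov.word ≠ σ.rotation r) →
      ∃ (α : List (Letter E)) (δ γ c : HString Q),
        σ.rotation ov.s = ov.word ++ α ∧
        IsConcat τ.toHWord ov.p δ.toHWord ov.word γ.toHWord ∧
        IsReducedConcat c.toHWord ov.p δ.toHWord (invList α)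
          (fun r => σ.v (ov.s - r)) (fun r => σ.deg (ov.s - r) - 1) γ.toHWord ∧
        (ov.fL ≠ [] → (δ.letter (ov.p - 1)).elt * (σ.letter (ov.s - 1)).elt⁻¹ =
          (ov.fL.map FreeGroup.of).prod⁻¹) ∧
        (ov.fR ≠ [] → (σ.letter (ov.s + ov.L)).elt⁻¹ * (γ.letter 0).elt =
          (ov.fR.map FreeGroup.of).prod) ∧
        IsoInHomotopyCategory (CochainComplex.mappingCone f) (c.complex k)) ∧
    -- the overlap contains a power of the band
    (∀ l : ℕ, 1 ≤ l →
      (∃ r, ov.word <:+: power (σ.rotation r) (l + 1) ∧ ov.word ≠ power (σ.rotation r) (l + 1)) →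
      (∃ r, power (σ.rotation r) l <:+: ov.word) →
      ∃ (α β : List (Letter E)) (δ γ c : HString Q),
        σ.rotation ov.s = β ++ α ∧
        ov.word = power (σ.rotation ov.s) l ++ β ∧
        IsConcat τ.toHWord ov.p δ.toHWord (power (σ.rotation ov.s) l ++ β) γ.toHWord ∧
        IsConcat c.toHWord ov.p δ.toHWord (power (σ.rotation ov.s) (l - 1) ++ β) γ.toHWord ∧
        IsoInHomotopyCategory (CochainComplex.mappingCone f) (c.complex k)) := by
  refine ⟨?_, ?_⟩
  · rintro ⟨r, h, h'⟩
    -- The first power of the rotation is the rotation itself, so the bound on lengths applies with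
    -- l = 1 and puts this case into the short regime.
    have hL : ov.L < 1 * σ.n :=
      ov.L_lt_of_isInfix (l := 1) (r := r) (by simpa [power] using h) (by simpa [power] using h')
    rw [one_mul] at hL
    have h0 : 0 < ov.gap := by
      unfold Overlap.gap
      omega
    refine ⟨ov.complement, τ.leftPart ov.p ov.mem_p, τ.rightPart (ov.p + ov.L) ov.mem_end,
      ov.surgery hQ h0, ov.rotation_eq_append hL.le, ?_, ov.isReducedConcat_surgery hQ h0,
      fun h => ov.elt_fL h, fun h => ?_, ov.iso_surgery hQ h0 f hf⟩
    · refine τ.isConcat_parts _ _ ov.mem_p _ ?_ ov.mem_end ?_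
      · rw [ov.length_word]
      · rw [ov.length_word, ov.segment_p]
    · rw [← ov.elt_fR h]
      change _ * (τ.letter (ov.p + ov.L + 0)).elt = _
      rw [add_zero]
  · rintro l hl ⟨r, h, h'⟩ ⟨r', h''⟩
    have hL := ov.L_lt_of_isInfix h h'
    have hL' := h''.length_le
    rw [ov.length_word, σ.length_power_rotation] at hL'
    have hn : σ.n ≤ ov.L := le_trans (by nlinarith) hL'
    -- Here l n ≤ L < (l + 1) n, so ρ read from s consists of l full periods and a rest β of L - l n
    -- < n letters; by periodicity β is the beginning of the rotation at s, and α below is the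
    -- remainder of that period.
    have hw : ov.word = power (σ.rotation ov.s) l ++ σ.segment ov.s (ov.L - l * σ.n) := by
      rw [σ.power_rotation, ← σ.segment_add_mul_n ov.s l (ov.L - l * σ.n), ← HWord.segment_add,
        Nat.add_sub_cancel' hL']
      rfl
    refine ⟨σ.segment (ov.s + (ov.L - l * σ.n : ℕ)) (σ.n - (ov.L - l * σ.n)),
      σ.segment ov.s (ov.L - l * σ.n), τ.leftPart ov.p ov.mem_p,
      τ.rightPart (ov.p + ov.L) ov.mem_end, ov.cutString hQ hn, ?_, hw, ?_,
      ov.isConcat_cutString hQ hn l hl hL' _ rfl ov.mem_end, ov.iso_cutString hQ hn f hf⟩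
    · rw [← HWord.segment_add, Nat.add_sub_cancel']
      · rfl
      · rw [add_mul, one_mul] at hL
        omega
    · rw [← hw]
      refine τ.isConcat_parts _ _ ov.mem_p _ ?_ ov.mem_end ?_
      · rw [ov.length_word]
      · rw [ov.length_word, ov.segment_p]
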